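/- Let $n\ge 3$, let $(M^n,g)$ be a smooth Riemannian manifold (possibly with boundary), and let $B_r\subset M$ be a geodesic ball of radius $r$, that is, the diffeomorphic image, under the exponential map at a point, of the Euclidean ball of radius $r$. Write $\sigma_k$ for the $k$-th elementary symmetric function and $\Gamma_k=\{\lambda\in\mathbb R^n:\sigma_j(\lambda)>0,\ 1\le j\le k\}$. Let $\Gamma\subset\mathbb R^n$ be an open convex symmetric cone with vertex at the origin, $\Gamma_n\subset\Gamma\subset\Gamma_1$, and let $F$ be a $C^2$ symmetric function on $\Gamma$, homogeneous of degree one, with $F(1,\dots,1)=1$, such that in $\Gamma$: $F>0$; $F$ is concave; $\partial F/\partial\lambda_i>0$ for all $i$; and $\partial F/\partial\lambda_i\ge\varepsilon F/\sigma_1$ for all $i$, for some constant $\varepsilon>0$. Let $t\le 1$ be a constant, $a,b$ be $C^2$ functions and $S$ a $C^2$ symmetric $2$-tensor on $B_r$, and let $f=f(x,z)$ be a positive $C^2$ function on $B_r\times\mathbb R$. Let $u$ be a $C^4$ solution on $B_r$ of $$F(g^{-1}W)=f(x,u),\qquad W=\nabla^2u+\frac{1-t}{n-2}\,\Delta u\,g+a\,du\otimes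 du+b\,|\nabla u|^2g+S,$$ where $F(g^{-1}W)$ is $F$ evaluated at the eigenvalues of $W$ with respect to $g$, and suppose that these eigenvalues lie in $\Gamma$ at each point of $B_r$. Suppose that $|\nabla_xf|\le\Lambda f$ and $|f_z|\le\Lambda f$ at $(x,u(x))$, $x\in B_r$, for a constant $\Lambda>0$, and put $$c_{\sup}(r)=\sup_{x\in B_r}\big(f+|\nabla_xf|+|f_z|+|\nabla_x^2f|+|\nabla_xf_z|+|f_{zz}|\big)(x,u(x)).$$ Case (a). If $\Gamma\subset\Gamma_2$ and, on $B_r$, $\frac{1-t}{n-2}a-b\ge\delta_1>0$ and $\min\{2ab+b^2,\,b^2\}\ge\delta_2>0$, then $$\sup_{B_{r/2}}\big(|\nabla^2u|+|\nabla u|^2\big)\le C,$$ where $C$ depends only on $r,n,t,\Lambda,\delta_1,\delta_2$ and on upper bounds for $\|a\|_{C^2(B_r)},\|b\|_{C^2(B_r)},\|S\|_{C^2(B_r)},\|g\|_{C^3(B_r)}$ and $c_{\sup}(r)$. Case (b). If, on $B_r$, $\frac{1-t}{n-2}a-b\ge\delta_1>0$, $a+nb\le-\delta_3<0$ and $a\ge0$,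 then the same estimate holds, where $C$ depends only on $r,n,t,\varepsilon,\Lambda,\delta_1,\delta_3$ and on upper bounds for $\|a\|_{C^2(B_r)},\|b\|_{C^2(B_r)},\|S\|_{C^2(B_r)},\|g\|_{C^3(B_r)}$ and $c_{\sup}(r)$. Here derivatives and norms of $a,b,S,f,u$ are covariant with respect to $g$, and $\|g\|_{C^3(B_r)}$ is the $C^3$ norm of the components $g_{ij}$ in geodesic normal coordinates on $B_r$, together with the supremum of the components $g^{ij}$ of the inverse matrix. -/

import Mathlib

open Set Metric
open scoped Manifold ContDiff BigOperators Matrix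

universe v w

noncomputable section

/-! ### Symmetric functions and cones -/

/-- The `k`-th elementary symmetric function of `lam`. -/
def sigmaK {n : ℕ} (k : ℕ) (lam : Fin n → ℝ) : ℝ :=
  ∑ s ∈ (Finset.univ : Finset (Fin n)).powersetCard k, ∏ i ∈ s, lam i

/-- The cone `Γ_k` of all `lam` with `σ_j(lam) > 0` for `1 ≤ j ≤ k`. -/
def gammaCone (n k : ℕ) : Set (Fin n → ℝ) :=
  {lam | ∀ j : ℕ, 1 ≤ j → j ≤ k → 0 < sigmaK j lam}

/-- `Γ` is an open convex symmetric cone with vertex at the origin and `Γ_n ⊂ Γ ⊂ Γ_1`. -/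
structure AdmissibleCone {n : ℕ} (Γ : Set (Fin n → ℝ)) : Prop where
  isOpen : IsOpen Γ
  convex : Convex ℝ Γ
  smul_mem : ∀ c : ℝ, 0 < c → ∀ lam ∈ Γ, c • lam ∈ Γ
  perm_mem : ∀ (τ : Equiv.Perm (Fin n)), ∀ lam ∈ Γ, lam ∘ τ ∈ Γ
  gamma_n_subset : gammaCone n n ⊆ Γ
  subset_gamma_one : Γ ⊆ gammaCone n 1

/-- The structure conditions on `F` in the cone `Γ`: `F` is a `C²` symmetric function, homogeneous
of degree one, normalized by `F(1,…,1) = 1`, positive, concave, monotone, and satisfies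
`∂F/∂λ_i ≥ ε F / σ_1` for all `i`. -/
structure StructureConditions {n : ℕ} (Γ : Set (Fin n → ℝ)) (F : (Fin n → ℝ) → ℝ) (ε : ℝ) :
    Prop where
  cone : AdmissibleCone Γ
  contDiffOn : ContDiffOn ℝ 2 F Γ
  symmetric : ∀ (τ : Equiv.Perm (Fin n)), ∀ lam ∈ Γ, F (lam ∘ τ) = F lam
  homogeneous : ∀ c : ℝ, 0 < c → ∀ lam ∈ Γ, F (c • lam) = c * F lam
  normalized : F (fun _ => 1) = 1
  positive : ∀ lam ∈ Γ, 0 < F lam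
  concave : ConcaveOn ℝ Γ F
  monotone : ∀ lam ∈ Γ, ∀ i, 0 < fderiv ℝ F lam (Pi.single i 1)
  derivative_lower : ∀ lam ∈ Γ, ∀ i,
    ε * (F lam / sigmaK 1 lam) ≤ fderiv ℝ F lam (Pi.single i 1)

/-! ### Tensor calculus in coordinates

A metric on a domain of `ℝⁿ` is given by its matrix `G x = (g_ij(x))`; a covariant tensor field of
rank `k` is given by its components. -/

/-- The `i`-th partial derivative. -/
def pderivAt {n : ℕ} (i : Fin n) (h : EuclideanSpace ℝ (Fin n) → ℝ)
    (x : EuclideanSpace ℝ (Fin n)) : ℝ :=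
  fderiv ℝ h x (EuclideanSpace.single i 1)

/-- The Christoffel symbol `Γ^l_ij` of the metric `G` at `x`. -/
def christoffel {n : ℕ} (G : EuclideanSpace ℝ (Fin n) → Matrix (Fin n) (Fin n) ℝ)
    (x : EuclideanSpace ℝ (Fin n)) (l i j : Fin n) : ℝ :=
  (1 / 2) * ∑ m, (G x)⁻¹ l m *
    (pderivAt i (fun y => G y j m) x + pderivAt j (fun y => G y i m) x
      - pderivAt m (fun y => G y i j) x)

/-- Components of a covariant tensor field of rank `k`. -/
abbrev TensorComponents (n k : ℕ) : Type :=
  EuclideanSpace ℝ (Fin n) → (Fin k → Fin n) → ℝ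

/-- A function as a tensor field of rank `0`. -/
def scalarTensor {n : ℕ} (h : EuclideanSpace ℝ (Fin n) → ℝ) : TensorComponents n 0 :=
  fun x _ => h x

/-- A matrix-valued function as a tensor field of rank `2`. -/
def matrixTensor {n : ℕ} (A : EuclideanSpace ℝ (Fin n) → Matrix (Fin n) (Fin n) ℝ) :
    TensorComponents n 2 :=
  fun x ι => A x (ι 0) (ι 1)

/-- The Levi-Civita covariant derivative of a covariant tensor field (the new index comes first):
`(∇T)_{m i₁…i_k} = ∂_m T_{i₁…i_k} - ∑_s Γ^l_{m i_s} T_{i₁…l…i_k}`. -/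
def covDeriv {n k : ℕ} (G : EuclideanSpace ℝ (Fin n) → Matrix (Fin n) (Fin n) ℝ)
    (T : TensorComponents n k) : TensorComponents n (k + 1) :=
  fun x ι =>
    pderivAt (ι 0) (fun y => T y (Fin.tail ι)) x
      - ∑ s : Fin k, ∑ l : Fin n,
          christoffel G x l (ι 0) (ι s.succ) * T x (Function.update (Fin.tail ι) s l)

/-- The squared pointwise norm of a tensor field with respect to the metric `G`. -/
def tensorNormSq {n k : ℕ} (G : EuclideanSpace ℝ (Fin n) → Matrix (Fin n) (Fin n) ℝ)
    (T : TensorComponents n k) (x : EuclideanSpace ℝ (Fin n)) : ℝ :=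
  ∑ ι : Fin k → Fin n, ∑ κ : Fin k → Fin n, (∏ s, (G x)⁻¹ (ι s) (κ s)) * T x ι * T x κ

/-- The pointwise norm of a tensor field with respect to the metric `G`. -/
def tensorNorm {n k : ℕ} (G : EuclideanSpace ℝ (Fin n) → Matrix (Fin n) (Fin n) ℝ)
    (T : TensorComponents n k) (x : EuclideanSpace ℝ (Fin n)) : ℝ :=
  Real.sqrt (tensorNormSq G T x)

/-- The differential `du`, as a tensor of rank `1`. -/
def gradTensor {n : ℕ} (G : EuclideanSpace ℝ (Fin n) → Matrix (Fin n) (Fin n) ℝ)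
    (h : EuclideanSpace ℝ (Fin n) → ℝ) : TensorComponents n 1 :=
  covDeriv G (scalarTensor h)

/-- The covariant Hessian `∇²u`, as a tensor of rank `2`. -/
def hessTensor {n : ℕ} (G : EuclideanSpace ℝ (Fin n) → Matrix (Fin n) (Fin n) ℝ)
    (h : EuclideanSpace ℝ (Fin n) → ℝ) : TensorComponents n 2 :=
  covDeriv G (gradTensor G h)

/-- The Laplacian `Δu = g^{ij} ∇²_ij u`. -/
def laplacianOf {n : ℕ} (G : EuclideanSpace ℝ (Fin n) → Matrix (Fin n) (Fin n) ℝ)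
    (h : EuclideanSpace ℝ (Fin n) → ℝ) (x : EuclideanSpace ℝ (Fin n)) : ℝ :=
  ∑ i, ∑ j, (G x)⁻¹ i j * hessTensor G h x ![i, j]

/-- `‖T‖_{C²} ≤ N` on the ball of radius `r`, for `‖T‖_{C²} = sup (|T| + |∇T| + |∇²T|)`. -/
def CTwoNormLE {n k : ℕ} (G : EuclideanSpace ℝ (Fin n) → Matrix (Fin n) (Fin n) ℝ)
    (T : TensorComponents n k) (r N : ℝ) : Prop :=
  ∀ x ∈ ball (0 : EuclideanSpace ℝ (Fin n)) r,
    tensorNorm G T x + tensorNorm G (covDeriv G T) x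
      + tensorNorm G (covDeriv G (covDeriv G T)) x ≤ N

/-- `‖g‖_{C³} ≤ N` on the ball of radius `r`, in coordinates. Uniform positivity of the metric is
part of the norm: the components of the inverse matrix are bounded by `N` as well. -/
def MetricCThreeNormLE {n : ℕ} (G : EuclideanSpace ℝ (Fin n) → Matrix (Fin n) (Fin n) ℝ)
    (r N : ℝ) : Prop :=
  ∀ x ∈ ball (0 : EuclideanSpace ℝ (Fin n)) r, ∀ i j : Fin n,
    (∀ k : ℕ, k ≤ 3 → ‖iteratedFDeriv ℝ k (fun y => G y i j) x‖ ≤ N) ∧ |(G x)⁻¹ i j| ≤ N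

/-- The tensor `W = ∇²u + (1-t)/(n-2) Δu g + a du⊗du + b |∇u|² g + S` in coordinates. -/
def tensorW {n : ℕ} (G : EuclideanSpace ℝ (Fin n) → Matrix (Fin n) (Fin n) ℝ) (t : ℝ)
    (a b : EuclideanSpace ℝ (Fin n) → ℝ)
    (S : EuclideanSpace ℝ (Fin n) → Matrix (Fin n) (Fin n) ℝ)
    (u : EuclideanSpace ℝ (Fin n) → ℝ) (x : EuclideanSpace ℝ (Fin n)) :
    Matrix (Fin n) (Fin n) ℝ :=
  Matrix.of fun i j =>
    hessTensor G u x ![i, j] + (1 - t) / ((n : ℝ) - 2) * laplacianOf G u x * G x i j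
      + a x * gradTensor G u x ![i] * gradTensor G u x ![j]
      + b x * tensorNormSq G (gradTensor G u) x * G x i j + S x i j

/-- `lam` lists (with multiplicity) the eigenvalues `λ(g⁻¹W)` of the symmetric form `W` with respect
to the inner product `g`: some `g`-orthonormal basis (the columns of `P`) diagonalizes `W`, with
diagonal entries `lam`. -/
def IsEigenvaluesWrt {n : ℕ} (g W : Matrix (Fin n) (Fin n) ℝ) (lam : Fin n → ℝ) : Prop :=
  ∃ P : Matrix (Fin n) (Fin n) ℝ, Pᵀ * g * P = 1 ∧ Pᵀ * W * P = Matrix.diagonal lam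

/-- The quantity `f + |∇_x f| + |f_z| + |∇²_x f| + |∇_x f_z| + |f_zz|` at `(x, u(x))`, for `f` in
coordinates. -/
def cSupIntegrand {n : ℕ} (G : EuclideanSpace ℝ (Fin n) → Matrix (Fin n) (Fin n) ℝ)
    (f : EuclideanSpace ℝ (Fin n) → ℝ → ℝ) (u : EuclideanSpace ℝ (Fin n) → ℝ)
    (x : EuclideanSpace ℝ (Fin n)) : ℝ :=
  f x (u x) + tensorNorm G (gradTensor G (fun y => f y (u x))) x + |deriv (f x) (u x)|
    + tensorNorm G (hessTensor G (fun y => f y (u x))) x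
    + tensorNorm G (gradTensor G (fun y => deriv (f y) (u x))) x
    + |deriv (deriv (f x)) (u x)|

/-! ### Geodesic balls in a Riemannian manifold -/

section Manifold

variable {n : ℕ} {H : Type v} [TopologicalSpace H]
  (I : ModelWithCorners ℝ (EuclideanSpace ℝ (Fin n)) H)
  {M : Type w} [TopologicalSpace M] [ChartedSpace H M]

/-- The components, in the coordinates given by the parametrization `φ`, of a field of bilinear
forms on `M`. -/
def pullbackComponents
    (T : (p : M) → TangentSpace I p →L[ℝ] TangentSpace I p →L[ℝ] ℝ)
    (φ : EuclideanSpace ℝ (Fin n) → M) (x : EuclideanSpace ℝ (Fin n)) :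
    Matrix (Fin n) (Fin n) ℝ :=
  Matrix.of fun i j =>
    T (φ x) (mfderiv 𝓘(ℝ, EuclideanSpace ℝ (Fin n)) I φ x (EuclideanSpace.single i (1 : ℝ)))
      (mfderiv 𝓘(ℝ, EuclideanSpace ℝ (Fin n)) I φ x (EuclideanSpace.single j (1 : ℝ)))

/-- `φ` restricted to `ball 0 r` is a geodesic normal parametrization (the exponential map at `φ 0`
in an orthonormal basis), so that `φ '' ball 0 s` is the geodesic ball `B_s` for `s ≤ r`: it is a
smooth injective immersion, `g_ij = δ_ij` at the origin, and the rays from the origin are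
geodesics. -/
structure IsGeodesicBall
    (g : (p : M) → TangentSpace I p →L[ℝ] TangentSpace I p →L[ℝ] ℝ)
    (φ : EuclideanSpace ℝ (Fin n) → M) (r : ℝ) : Prop where
  contMDiffOn : ContMDiffOn 𝓘(ℝ, EuclideanSpace ℝ (Fin n)) I ∞ φ (ball 0 r)
  injOn : InjOn φ (ball 0 r)
  immersion : ∀ x ∈ ball (0 : EuclideanSpace ℝ (Fin n)) r,
    Function.Injective (mfderiv 𝓘(ℝ, EuclideanSpace ℝ (Fin n)) I φ x)
  orthonormal : pullbackComponents I g φ 0 = 1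
  geodesic : ∀ x ∈ ball (0 : EuclideanSpace ℝ (Fin n)) r, ∀ l,
    ∑ i, ∑ j, christoffel (pullbackComponents I g φ) x l i j * x i * x j = 0

/-- `u` is a `C⁴` solution of `F(g⁻¹W) = f(x,u)` with `W ∈ Γ` in the geodesic ball
`B_r = φ '' ball 0 r`; `a`, `b`, `S`, `f` are `C²`, `S` is symmetric and `f` is positive. -/
structure IsAdmissibleSolution [IsManifold I ∞ M]
    (Γ : Set (Fin n → ℝ)) (F : (Fin n → ℝ) → ℝ)
    (g : (p : M) → TangentSpace I p →L[ℝ] TangentSpace I p →L[ℝ] ℝ)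
    (φ : EuclideanSpace ℝ (Fin n) → M) (r t : ℝ) (a b : M → ℝ)
    (S : (p : M) → TangentSpace I p →L[ℝ] TangentSpace I p →L[ℝ] ℝ)
    (f : M → ℝ → ℝ) (u : M → ℝ) : Prop where
  a_contMDiffOn : ContMDiffOn I 𝓘(ℝ, ℝ) 2 a (φ '' ball 0 r)
  b_contMDiffOn : ContMDiffOn I 𝓘(ℝ, ℝ) 2 b (φ '' ball 0 r)
  S_contMDiffOn : ContMDiffOn I
    (I.prod 𝓘(ℝ, EuclideanSpace ℝ (Fin n) →L[ℝ] EuclideanSpace ℝ (Fin n) →L[ℝ] ℝ)) 2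
    (fun p => Bundle.TotalSpace.mk'
      (EuclideanSpace ℝ (Fin n) →L[ℝ] EuclideanSpace ℝ (Fin n) →L[ℝ] ℝ)
      (E := fun p : M => TangentSpace I p →L[ℝ] TangentSpace I p →L[ℝ] ℝ) p (S p))
    (φ '' ball 0 r)
  S_symm : ∀ p ∈ φ '' ball 0 r, ∀ X Y, S p X Y = S p Y X
  f_contMDiffOn : ContMDiffOn (I.prod 𝓘(ℝ, ℝ)) 𝓘(ℝ, ℝ) 2 (fun q : M × ℝ => f q.1 q.2)
    ((φ '' ball 0 r) ×ˢ univ)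
  f_pos : ∀ p ∈ φ '' ball 0 r, ∀ z, 0 < f p z
  u_contMDiffOn : ContMDiffOn I 𝓘(ℝ, ℝ) 4 u (φ '' ball 0 r)
  equation : ∀ x ∈ ball (0 : EuclideanSpace ℝ (Fin n)) r, ∃ lam : Fin n → ℝ,
    IsEigenvaluesWrt (pullbackComponents I g φ x)
      (tensorW (pullbackComponents I g φ) t (a ∘ φ) (b ∘ φ) (pullbackComponents I S φ)
        (u ∘ φ) x) lam ∧
      lam ∈ Γ ∧ F lam = f (φ x) (u (φ x))

/-- The bounds on the data in `B_r`: `|∇f| ≤ Λ f` and `|f_z| ≤ Λ f` at `(x, u(x))`, the norms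
`‖a‖_{C²}`, `‖b‖_{C²}`, `‖S‖_{C²}`, `‖g‖_{C³}` are at most `Na`, `Nb`, `NS`, `Ng`, and
`c_sup(r) ≤ Nf`. -/
structure DataBounds
    (g : (p : M) → TangentSpace I p →L[ℝ] TangentSpace I p →L[ℝ] ℝ)
    (φ : EuclideanSpace ℝ (Fin n) → M) (r : ℝ) (a b : M → ℝ)
    (S : (p : M) → TangentSpace I p →L[ℝ] TangentSpace I p →L[ℝ] ℝ)
    (f : M → ℝ → ℝ) (u : M → ℝ) (Λ Na Nb NS Ng Nf : ℝ) : Prop where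
  grad_f : ∀ x ∈ ball (0 : EuclideanSpace ℝ (Fin n)) r,
    tensorNorm (pullbackComponents I g φ)
      (gradTensor (pullbackComponents I g φ) (fun y => f (φ y) (u (φ x)))) x
      ≤ Λ * f (φ x) (u (φ x))
  f_z : ∀ x ∈ ball (0 : EuclideanSpace ℝ (Fin n)) r,
    |deriv (f (φ x)) (u (φ x))| ≤ Λ * f (φ x) (u (φ x))
  a_bound : CTwoNormLE (pullbackComponents I g φ) (scalarTensor (a ∘ φ)) r Na
  b_bound : CTwoNormLE (pullbackComponents I g φ) (scalarTensor (b ∘ φ)) r Nb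
  S_bound : CTwoNormLE (pullbackComponents I g φ) (matrixTensor (pullbackComponents I S φ)) r NS
  g_bound : MetricCThreeNormLE (pullbackComponents I g φ) r Ng
  f_bound : ∀ x ∈ ball (0 : EuclideanSpace ℝ (Fin n)) r,
    cSupIntegrand (pullbackComponents I g φ) (fun y => f (φ y)) (u ∘ φ) x ≤ Nf

/-- `|∇²u| + |∇u|² ≤ C` in the geodesic ball `B_s = φ '' ball 0 s`. -/
def InteriorBound
    (g : (p : M) → TangentSpace I p →L[ℝ] TangentSpace I p →L[ℝ] ℝ)
    (φ : EuclideanSpace ℝ (Fin n) → M) (s : ℝ) (u : M → ℝ) (C : ℝ) : Prop :=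
  ∀ x ∈ ball (0 : EuclideanSpace ℝ (Fin n)) s,
    tensorNorm (pullbackComponents I g φ) (hessTensor (pullbackComponents I g φ) (u ∘ φ)) x
      + tensorNorm (pullbackComponents I g φ)
          (gradTensor (pullbackComponents I g φ) (u ∘ φ)) x ^ 2 ≤ C

end Manifold

end

/-!
The estimate is obtained from the maximum principle, applied on the ball of radius `3r/4` to
`η² L`, where `η = 1 - |x|²/ρ²` is a cutoff function and
`L = ∑_{k ∈ s} ∇²u(Q_k, Q_k) + a |∇u|²`, maximized over points and orthonormal frames `Q`. The set
`s` consists of all indices in case (a), where `L = Δu + a |∇u|²`, and of one index in case (b),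
where the maximum over `Q` picks the largest eigenvalue of `∇²u`.

*The cancellation.* At a maximum point, choose an orthonormal frame that diagonalizes `W`. Since `F`
is concave, symmetric and homogeneous of degree one, `F(μ) ≤ ∑ F_i(λ) μ_i`, and this persists if `μ_i`
are the diagonal entries of `W` in an arbitrary orthonormal frame, by the theorems of Schur and
Birkhoff (`StructureConditions.le_frame`). Hence the function
`∑ F_i(λ) W(e_i, e_i) - f(x, u)`, for a smooth frame `e`, has a local minimum equal to zero at the
point. This replaces the differentiation of the equation, once and twice, and the diagonalization
is needed at a single point only. Applying the operator `∑ (F_i + c ∑ F) ∇²_ii`, with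
`c = (1-t)/(n-2)`, to `L` and subtracting the twice differentiated equation, the fourth derivatives
drop out; the terms `∇u * ∇³u` are removed by the differentiated equation and the equation of the
critical point, and then all terms of the form `∇²u * ∇u * ∇u` cancel exactly
(`linearized_identity`). What is left, `(ca - b) ∑ F ∑_{k ∈ s} |∇²u(Q_k, ·)|²` plus a nonnegative
term, is bounded by terms of lower weight (`leading_terms_ge`, `exists_bound_at_maximum`). As
`ca - b ≥ δ₁`, and as the conditions in each case bound `|∇u|²` and `∇²u` by the controlled second
derivatives at the maximum point (`exists_gradient_le_hessian`, `exists_bound_of_eigenvalue_le`),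
`η² (|∇²u| + |∇u|²)` is bounded there (`exists_cutoff_bound`). The bound for `L` then gives bounds for
`∇²u` and `∇u`, once more by the conditions in each case.

*Weights.* Lower order terms are counted by weight: with `q² = 1 + |∇u|² + |∇²u|` at the maximum
point, `∇u` has weight one and `∇²u` weight two, while the data have weight zero. A remainder is
harmless if it is `O(q²)` together with its first derivatives, and its second derivatives are
`O(q³)`; this is the predicate `JetW`. The constants are uniform because these predicates speak
of the family of all solutions with data bounded by `N`, together with their maximum points.

*Frames.* No curvature tensor appears. At a point, quadratic coordinates are used in which the
Christoffel symbols vanish and a given orthonormal frame is standard (`normalChart`); the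
coordinate frame is made orthonormal by the inverse square root of its Gram matrix (`chartFrame`).
This factor agrees with the identity to second order, so that the components of `∇²u` and `∇u` in
the frame differ from the partial derivatives in the coordinates by remainders that satisfy `JetW`
(`WeightedFun.jetW_hessRem`, `WeightedFun.jetW_gradRem`).
-/

noncomputable section

open Filter Asymptotics Topology

/-! ### Families of functions with uniformly bounded jets -/

theorem isBigO_one_iff {ι F : Type*} [NormedAddCommGroup F] {f : ι → F} :
    f =O[⊤] (fun _ => (1 : ℝ)) ↔ ∃ C, ∀ i, ‖f i‖ ≤ C := by
  rw [isBigO_top]; simp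

section UnifJet

variable {ι : Type*} {E F F' : Type*} [NormedAddCommGroup E] [NormedSpace ℝ E]
  [NormedAddCommGroup F] [NormedSpace ℝ F] [NormedAddCommGroup F'] [NormedSpace ℝ F']

/-- The `k`-jets of the functions `h i` at the points `x i` are bounded uniformly in `i`. -/
structure UnifJet (k : ℕ) (h : ι → E → F) (x : ι → E) : Prop where
  contDiffAt : ∀ i, ContDiffAt ℝ k (h i) (x i)
  isBigO : ∀ m ≤ k, (fun i => iteratedFDeriv ℝ m (h i) (x i)) =O[⊤] (fun _ => (1 : ℝ))

theorem ContDiffAt.exists_isOpen_contDiffOn {k : ℕ} {f : E → F} {x : E}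
    (h : ContDiffAt ℝ k f x) : ∃ s, IsOpen s ∧ x ∈ s ∧ ContDiffOn ℝ k f s := by
  obtain ⟨u, hu, hf⟩ := h.contDiffOn (m := k) le_rfl (by simp)
  obtain ⟨s, hs, hso, hxs⟩ := _root_.mem_nhds_iff.1 hu
  exact ⟨s, hso, hxs, hf.mono hs⟩

namespace UnifJet

variable {k : ℕ} {x : ι → E}

theorem exists_bound {h : ι → E → F} (H : UnifJet k h x) :
    ∃ C, 0 ≤ C ∧ ∀ i, ∀ m ≤ k, ‖iteratedFDeriv ℝ m (h i) (x i)‖ ≤ C := by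
  have h1 : ∀ m : ℕ, ∃ C : ℝ, ∀ i, m ≤ k → ‖iteratedFDeriv ℝ m (h i) (x i)‖ ≤ C := by
    intro m
    by_cases hm : m ≤ k
    · obtain ⟨C, hC⟩ := isBigO_one_iff.1 (H.isBigO m hm)
      exact ⟨C, fun i _ => hC i⟩
    · exact ⟨0, fun i h => absurd h hm⟩
  choose C hC using h1
  refine ⟨∑ m ∈ Finset.range (k + 1), |C m|, Finset.sum_nonneg fun _ _ => abs_nonneg _,
    fun i m hm => (hC m i hm).trans ((le_abs_self _).trans ?_)⟩
  exact Finset.single_le_sum (f := fun m => |C m|) (fun _ _ => abs_nonneg _)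
    (Finset.mem_range.2 (by omega))

theorem of_bound {h : ι → E → F} (hc : ∀ i, ContDiffAt ℝ k (h i) (x i)) (C : ℝ)
    (hC : ∀ i, ∀ m ≤ k, ‖iteratedFDeriv ℝ m (h i) (x i)‖ ≤ C) : UnifJet k h x :=
  ⟨hc, fun m hm => isBigO_one_iff.2 ⟨C, fun i => hC i m hm⟩⟩

theorem mono {h : ι → E → F} (H : UnifJet k h x) {k' : ℕ} (hk : k' ≤ k) : UnifJet k' h x :=
  ⟨fun i => (H.contDiffAt i).of_le (by exact_mod_cast hk), fun m hm => H.isBigO m (hm.trans hk)⟩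

theorem congr {h h' : ι → E → F} (H : UnifJet k h x) (e : ∀ i, h' i =ᶠ[𝓝 (x i)] h i) :
    UnifJet k h' x :=
  ⟨fun i => (H.contDiffAt i).congr_of_eventuallyEq (e i), fun m hm => by
    have : (fun i => iteratedFDeriv ℝ m (h' i) (x i))
        = fun i => iteratedFDeriv ℝ m (h i) (x i) := by
      funext i; exact ((e i).iteratedFDeriv ℝ m).eq_of_nhds
    rw [this]; exact H.isBigO m hm⟩

theorem const {c : ι → F} (hc : c =O[⊤] (fun _ => (1 : ℝ))) : UnifJet k (fun i _ => c i) x := by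
  obtain ⟨C, hC⟩ := isBigO_one_iff.1 hc
  refine of_bound (fun i => contDiffAt_const) (max C 0) fun i m _ => ?_
  rcases Nat.eq_zero_or_pos m with rfl | hm
  · rw [norm_iteratedFDeriv_zero]; exact (hC i).trans (le_max_left _ _)
  · rw [iteratedFDeriv_const_of_ne hm.ne']; simp

theorem add {h h' : ι → E → F} (H : UnifJet k h x) (H' : UnifJet k h' x) :
    UnifJet k (fun i y => h i y + h' i y) x := by
  refine ⟨fun i => (H.contDiffAt i).add (H'.contDiffAt i), fun m hm => ?_⟩
  have : (fun i => iteratedFDeriv ℝ m (fun y => h i y + h' i y) (x i))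
      = fun i => iteratedFDeriv ℝ m (h i) (x i) + iteratedFDeriv ℝ m (h' i) (x i) := by
    funext i
    exact iteratedFDeriv_add_apply ((H.contDiffAt i).of_le (by exact_mod_cast hm))
      ((H'.contDiffAt i).of_le (by exact_mod_cast hm))
  rw [this]
  exact (H.isBigO m hm).add (H'.isBigO m hm)

theorem clm_comp {h : ι → E → F} (H : UnifJet k h x) (L : F →L[ℝ] F') :
    UnifJet k (fun i y => L (h i y)) x := by
  obtain ⟨C, hC0, hC⟩ := H.exists_bound
  refine of_bound (fun i => L.contDiff.contDiffAt.comp (x i) (H.contDiffAt i)) (‖L‖ * C)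
    fun i m hm => ?_
  have := L.norm_iteratedFDeriv_comp_left (H.contDiffAt i) (n := m) (by exact_mod_cast hm)
  exact this.trans (mul_le_mul_of_nonneg_left (hC i m hm) (norm_nonneg _))

theorem neg {h : ι → E → F} (H : UnifJet k h x) : UnifJet k (fun i y => - h i y) x := by
  simpa using H.clm_comp (-ContinuousLinearMap.id ℝ F)

theorem sub {h h' : ι → E → F} (H : UnifJet k h x) (H' : UnifJet k h' x) :
    UnifJet k (fun i y => h i y - h' i y) x := by
  simpa [sub_eq_add_neg] using H.add H'.neg

theorem sum {κ : Type*} (s : Finset κ) {h : κ → ι → E → F} (H : ∀ j ∈ s, UnifJet k (h j) x) :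
    UnifJet k (fun i y => ∑ j ∈ s, h j i y) x := by
  classical
  induction s using Finset.induction_on with
  | empty => simpa using UnifJet.const (k := k) (x := x) (c := fun _ => (0 : F)) (isBigO_zero _ _)
  | insert j s hj ih =>
    have := (H j (Finset.mem_insert_self _ _)).add
      (ih fun j' hj' => H j' (Finset.mem_insert_of_mem hj'))
    simpa [Finset.sum_insert hj] using this

/-- A bounded family of bilinear combinations; only products of real functions with vectors are
needed. -/
theorem smul {h : ι → E → ℝ} {h' : ι → E → F} (H : UnifJet k h x) (H' : UnifJet k h' x) :
    UnifJet k (fun i y => h i y • h' i y) x := by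
  obtain ⟨C, hC0, hC⟩ := H.exists_bound
  obtain ⟨D, hD0, hD⟩ := H'.exists_bound
  refine of_bound (fun i => (H.contDiffAt i).smul (H'.contDiffAt i)) (2 ^ k * (C * D))
    fun i m hm => ?_
  obtain ⟨s, hs, hxs, hfs⟩ := (H.contDiffAt i).exists_isOpen_contDiffOn
  obtain ⟨t, ht, hxt, hft⟩ := (H'.contDiffAt i).exists_isOpen_contDiffOn
  have hst : IsOpen (s ∩ t) := hs.inter ht
  have hx : x i ∈ s ∩ t := ⟨hxs, hxt⟩
  have := norm_iteratedFDerivWithin_smul_le (hfs.mono inter_subset_left)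
    (hft.mono inter_subset_right) hst.uniqueDiffOn hx (n := m) (by exact_mod_cast hm)
  rw [iteratedFDerivWithin_of_isOpen m hst hx] at this
  refine this.trans ?_
  have : ∀ j ∈ Finset.range (m + 1), (m.choose j : ℝ) * ‖iteratedFDerivWithin ℝ j (h i) (s ∩ t) (x i)‖
      * ‖iteratedFDerivWithin ℝ (m - j) (h' i) (s ∩ t) (x i)‖ ≤ (m.choose j : ℝ) * (C * D) := by
    intro j hj
    rw [iteratedFDerivWithin_of_isOpen j hst hx, iteratedFDerivWithin_of_isOpen (m - j) hst hx,
      mul_assoc]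
    have hj' : j ≤ m := by simpa [Nat.lt_succ_iff] using hj
    exact mul_le_mul_of_nonneg_left (mul_le_mul (hC i j (hj'.trans hm))
      (hD i _ ((Nat.sub_le _ _).trans hm)) (norm_nonneg _) hC0) (by positivity)
  refine (Finset.sum_le_sum this).trans ?_
  rw [← Finset.sum_mul, ← Nat.cast_sum, Nat.sum_range_choose]
  push_cast
  exact mul_le_mul_of_nonneg_right (pow_le_pow_right₀ (by norm_num) hm) (mul_nonneg hC0 hD0)

theorem mul {h h' : ι → E → ℝ} (H : UnifJet k h x) (H' : UnifJet k h' x) :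
    UnifJet k (fun i y => h i y * h' i y) x := by
  simpa using H.smul H'

theorem prod {κ : Type*} (s : Finset κ) {h : κ → ι → E → ℝ} (H : ∀ j ∈ s, UnifJet k (h j) x) :
    UnifJet k (fun i y => ∏ j ∈ s, h j i y) x := by
  classical
  induction s using Finset.induction_on with
  | empty =>
    simpa using UnifJet.const (k := k) (x := x) (c := fun _ => (1 : ℝ)) (isBigO_refl _ _)
  | insert j s hj ih =>
    have := (H j (Finset.mem_insert_self _ _)).mul
      (ih fun j' hj' => H j' (Finset.mem_insert_of_mem hj'))
    simpa [Finset.prod_insert hj] using this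

/-- The chain rule with weights: if the inner functions satisfy `‖Dᵐ h‖ ≤ (C q)ᵐ`, the outer ones
have bounded jets, then `‖Dᵐ (g ∘ h)‖ = O(qᵐ)`. -/
theorem comp_weighted {g : ι → F → F'} {h : ι → E → F} (Hg : UnifJet k g (fun i => h i (x i)))
    (Hh : ∀ i, ContDiffAt ℝ k (h i) (x i)) (q : ι → ℝ)
    (hq : ∀ m, 1 ≤ m → m ≤ k → ∀ i, ‖iteratedFDeriv ℝ m (h i) (x i)‖ ≤ q i ^ m) :
    (∀ i, ContDiffAt ℝ k (fun y => g i (h i y)) (x i)) ∧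
    ∃ C, 0 ≤ C ∧ ∀ m ≤ k, ∀ i, ‖iteratedFDeriv ℝ m (fun y => g i (h i y)) (x i)‖ ≤ C * q i ^ m := by
  have hc : ∀ i, ContDiffAt ℝ k (fun y => g i (h i y)) (x i) :=
    fun i => (Hg.contDiffAt i).comp (x i) (Hh i)
  refine ⟨hc, ?_⟩
  obtain ⟨C, hC0, hC⟩ := Hg.exists_bound
  refine ⟨k.factorial * C, by positivity, fun m hm i => ?_⟩
  obtain ⟨t, ht, hxt, hft⟩ := (Hg.contDiffAt i).exists_isOpen_contDiffOn
  obtain ⟨s', hs', hxs', hfs'⟩ := (Hh i).exists_isOpen_contDiffOn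
  obtain ⟨s, hss, hs, hxs⟩ := _root_.mem_nhds_iff.1 (Filter.inter_mem
    ((Hh i).continuousAt.preimage_mem_nhds (ht.mem_nhds hxt)) (hs'.mem_nhds hxs'))
  have hmap : MapsTo (h i) s t := fun y hy => (hss hy).1
  have := norm_iteratedFDerivWithin_comp_le hft (hfs'.mono fun y hy => (hss hy).2)
    (n := m) (by exact_mod_cast hm) ht.uniqueDiffOn hs.uniqueDiffOn hmap hxs (C := C) (D := q i)
    (fun j hj => by
      rw [iteratedFDerivWithin_of_isOpen j ht hxt]; exact hC i j (hj.trans hm))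
    (fun j hj1 hj => by
      rw [iteratedFDerivWithin_of_isOpen j hs hxs]; exact hq j hj1 (hj.trans hm) i)
  rw [iteratedFDerivWithin_of_isOpen m hs hxs] at this
  refine this.trans ?_
  have hqm : 0 ≤ q i ^ m := by
    rcases Nat.eq_zero_or_pos m with rfl | hm1
    · simp
    · exact (norm_nonneg _).trans (hq m hm1 hm i)
  gcongr

theorem comp {g : ι → F → F'} {h : ι → E → F} (Hg : UnifJet k g (fun i => h i (x i)))
    (Hh : UnifJet k h x) : UnifJet k (fun i y => g i (h i y)) x := by
  obtain ⟨D, hD0, hD⟩ := Hh.exists_bound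
  obtain ⟨hc, C, hC0, hC⟩ := comp_weighted Hg Hh.contDiffAt (fun _ => 1 + D) (fun m hm1 hm i =>
    (hD i m hm).trans ((le_add_of_nonneg_left zero_le_one).trans
      (le_self_pow₀ (by linarith) (by omega))))
  refine of_bound hc (C * (1 + D) ^ k) fun i m hm => (hC m hm i).trans ?_
  exact mul_le_mul_of_nonneg_left (pow_le_pow_right₀ (by linarith) hm) hC0

/-- Composition with a fixed function at a fixed base point. -/
theorem comp_fixed {g : F → F'} {z : F} {h : ι → E → F} (hg : ContDiffAt ℝ k g z)
    (Hh : UnifJet k h x) (hz : ∀ i, h i (x i) = z) : UnifJet k (fun i y => g (h i y)) x := by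
  refine comp (g := fun _ => g) ⟨fun i => by rw [hz]; exact hg, fun m hm => ?_⟩ Hh
  simp only [hz]
  exact isBigO_const_const _ one_ne_zero _

theorem fderiv {h : ι → E → F} (H : UnifJet (k + 1) h x) :
    UnifJet k (fun i => fderiv ℝ (h i)) x := by
  obtain ⟨C, hC0, hC⟩ := H.exists_bound
  refine of_bound (fun i => (H.contDiffAt i).fderiv_right (m := k) (by norm_cast)) C fun i m hm => ?_
  rw [norm_iteratedFDeriv_fderiv]
  exact hC i (m + 1) (by omega)

theorem fderiv_apply {h : ι → E → F} (H : UnifJet (k + 1) h x) (X : E) :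
    UnifJet k (fun i y => _root_.fderiv ℝ (h i) y X) x :=
  H.fderiv.clm_comp (ContinuousLinearMap.apply ℝ F X)

theorem isBigO_apply {h : ι → E → F} (H : UnifJet k h x) :
    (fun i => h i (x i)) =O[⊤] (fun _ => (1 : ℝ)) := by
  obtain ⟨C, hC0, hC⟩ := H.exists_bound
  exact isBigO_one_iff.2 ⟨C, fun i => by simpa using hC i 0 (Nat.zero_le _)⟩

theorem clm (L : E →L[ℝ] F) (hx : x =O[⊤] (fun _ => (1 : ℝ))) : UnifJet k (fun _ => ⇑L) x := by
  obtain ⟨C, hC⟩ := isBigO_one_iff.1 hx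
  have hC0 : ∀ i : ι, 0 ≤ C := fun i => (norm_nonneg _).trans (hC i)
  refine of_bound (fun i => L.contDiff.contDiffAt) (‖L‖ * C + ‖L‖) fun i m _ => ?_
  match m with
  | 0 =>
    rw [norm_iteratedFDeriv_zero]
    have := L.le_opNorm_of_le (hC i)
    linarith [norm_nonneg L]
  | 1 =>
    rw [norm_iteratedFDeriv_one, L.fderiv]
    have := mul_nonneg (norm_nonneg L) (hC0 i)
    linarith
  | m + 2 =>
    rw [← norm_iteratedFDeriv_fderiv]
    have : _root_.fderiv ℝ (⇑L) = fun _ => L := by funext y; exact L.fderiv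
    rw [this, iteratedFDeriv_const_of_ne (by omega)]
    have := mul_nonneg (norm_nonneg L) (hC0 i)
    simp only [Pi.zero_apply, norm_zero]
    linarith [norm_nonneg L]

theorem pi {κ : Type*} [Fintype κ] {h : ι → E → κ → F} (H : ∀ j, UnifJet k (fun i y => h i y j) x) :
    UnifJet k h x := by
  classical
  have := UnifJet.sum Finset.univ (fun j _ => (H j).clm_comp
    (ContinuousLinearMap.single ℝ (fun _ : κ => F) j))
  refine this.congr fun i => Eventually.of_forall fun y => ?_
  funext j
  simp [Finset.sum_apply, Pi.single_apply]

end UnifJet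

end UnifJet

/-! ### Orthonormal frames of an inner product -/

section Frame

variable {n : ℕ} {g P : Matrix (Fin n) (Fin n) ℝ}

theorem frame_mul (hP : Pᵀ * g * P = 1) : P * (Pᵀ * g) = 1 := mul_eq_one_comm.1 hP

theorem frame_mul' (hP : Pᵀ * g * P = 1) : (g * P) * Pᵀ = 1 :=
  mul_eq_one_comm.1 (by rw [← Matrix.mul_assoc]; exact hP)

/-- A bilinear form with an orthonormal frame is symmetric, so that the existence of eigenvalues
entails the symmetry of the metric. -/
theorem frame_symm (hP : Pᵀ * g * P = 1) : gᵀ = g := by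
  have hPT : Pᵀ * gᵀ * P = 1 := by
    have := congrArg Matrix.transpose hP
    simpa [Matrix.transpose_mul, Matrix.mul_assoc] using this
  calc gᵀ = ((g * P) * Pᵀ) * gᵀ := by rw [frame_mul' hP, Matrix.one_mul]
    _ = g * (P * (Pᵀ * gᵀ)) := by simp only [Matrix.mul_assoc]
    _ = g := by rw [frame_mul hPT, Matrix.mul_one]

theorem frame_mul_transpose (hP : Pᵀ * g * P = 1) : (P * Pᵀ) * g = 1 := by
  rw [Matrix.mul_assoc]; exact frame_mul hP

theorem frame_inv (hP : Pᵀ * g * P = 1) : g⁻¹ = P * Pᵀ :=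
  Matrix.inv_eq_left_inv (frame_mul_transpose hP)

/-- Two orthonormal frames differ by an orthogonal matrix. -/
theorem frame_orthogonal {Q : Matrix (Fin n) (Fin n) ℝ} (hP : Pᵀ * g * P = 1)
    (hQ : Qᵀ * g * Q = 1) : P * (Pᵀ * g * Q) = Q ∧ (Pᵀ * g * Q)ᵀ * (Pᵀ * g * Q) = 1 := by
  have hPO : P * (Pᵀ * g * Q) = Q := by
    rw [← Matrix.mul_assoc, frame_mul hP, Matrix.one_mul]
  refine ⟨hPO, ?_⟩
  set O := Pᵀ * g * Q with hO
  have : Oᵀ * O = Oᵀ * (Pᵀ * g * P) * O := by rw [hP, Matrix.mul_one]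
  rw [this, ← hQ]
  conv_rhs => rw [← hPO, Matrix.transpose_mul]
  simp only [Matrix.mul_assoc]

end Frame

/-! ### Concave symmetric functions of the eigenvalues -/

section Concave

variable {n : ℕ} {Γ : Set (Fin n → ℝ)} {F : (Fin n → ℝ) → ℝ} {ε : ℝ}

theorem StructureConditions.differentiableAt (hF : StructureConditions Γ F ε) {lam : Fin n → ℝ}
    (h : lam ∈ Γ) : DifferentiableAt ℝ F lam :=
  (hF.contDiffOn.contDiffAt (hF.cone.isOpen.mem_nhds h)).differentiableAt (by norm_num)

theorem fderiv_pi_eq_sum (F : (Fin n → ℝ) → ℝ) (lam w : Fin n → ℝ) :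
    fderiv ℝ F lam w = ∑ i, fderiv ℝ F lam (Pi.single i 1) * w i := by
  conv_lhs => rw [← Finset.univ_sum_single w, map_sum]
  refine Finset.sum_congr rfl fun i _ => ?_
  have : Pi.single i (w i) = w i • (Pi.single i 1 : Fin n → ℝ) := by
    rw [← Pi.single_smul]; simp
  rw [this, map_smul, smul_eq_mul, mul_comm]

/-- Euler's identity for a function homogeneous of degree one. -/
theorem StructureConditions.euler (hF : StructureConditions Γ F ε) {lam : Fin n → ℝ}
    (h : lam ∈ Γ) : ∑ i, fderiv ℝ F lam (Pi.single i 1) * lam i = F lam := by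
  rw [← fderiv_pi_eq_sum]
  have hl : HasDerivAt (fun c : ℝ => c • lam) lam 1 := by
    simpa using (hasDerivAt_id (1 : ℝ)).smul_const lam
  have h1 : HasDerivAt (fun c : ℝ => F (c • lam)) (fderiv ℝ F lam lam) 1 := by
    have := (hF.differentiableAt h).hasFDerivAt
    rw [← one_smul ℝ lam] at this
    exact (by simpa using this.comp_hasDerivAt (1 : ℝ) hl :
      HasDerivAt (F ∘ fun c : ℝ => c • lam) (fderiv ℝ F lam lam) 1)
  have h2 : HasDerivAt (fun c : ℝ => c * F lam) (F lam) 1 := by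
    simpa using (hasDerivAt_id (1 : ℝ)).mul_const (F lam)
  refine h1.unique (h2.congr_of_eventuallyEq ?_)
  filter_upwards [lt_mem_nhds (zero_lt_one : (0 : ℝ) < 1)] with c hc
  exact hF.homogeneous c hc lam h

/-- A concave function lies below its tangent plane; for a function homogeneous of degree one this
plane passes through the origin. -/
theorem StructureConditions.le_linear (hF : StructureConditions Γ F ε) {lam mu : Fin n → ℝ}
    (h : lam ∈ Γ) (hm : mu ∈ Γ) : F mu ≤ ∑ i, fderiv ℝ F lam (Pi.single i 1) * mu i := by
  rw [← fderiv_pi_eq_sum]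
  have he : fderiv ℝ F lam lam = F lam := by rw [fderiv_pi_eq_sum, hF.euler h]
  suffices F mu - F lam ≤ fderiv ℝ F lam (mu - lam) by rw [map_sub, he] at this; linarith
  have hl : HasDerivAt (fun s : ℝ => lam + s • (mu - lam)) (mu - lam) 0 := by
    simpa using ((hasDerivAt_id (0 : ℝ)).smul_const (mu - lam)).const_add lam
  have h1 : HasDerivAt (fun s : ℝ => F (lam + s • (mu - lam))) (fderiv ℝ F lam (mu - lam)) 0 := by
    have := (hF.differentiableAt h).hasFDerivAt
    have h0 : lam = lam + (0 : ℝ) • (mu - lam) := by simp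
    rw [h0] at this
    have h2 := this.comp_hasDerivAt (0 : ℝ) hl
    rwa [← h0] at h2
  have h2 := h1.hasDerivWithinAt (s := Ioi 0)
  rw [hasDerivWithinAt_iff_tendsto_slope' (by simp)] at h2
  refine ge_of_tendsto h2 ?_
  have : Ioo (0 : ℝ) 1 ∈ 𝓝[>] (0 : ℝ) := Ioo_mem_nhdsGT zero_lt_one
  filter_upwards [this] with s hs
  have hc := hF.concave.2 h hm (sub_nonneg.2 hs.2.le) hs.1.le (by ring)
  have e : (1 - s) • lam + s • mu = lam + s • (mu - lam) := by
    rw [sub_smul, smul_sub, one_smul]; abel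
  rw [e] at hc
  simp only [smul_eq_mul] at hc
  rw [slope_def_field, sub_zero, zero_smul, add_zero, le_div_iff₀ hs.1]
  nlinarith

theorem one_mem_gammaCone (n k : ℕ) (hk : k ≤ n) : (fun _ => (1 : ℝ)) ∈ gammaCone n k := by
  intro j _ hj
  simp only [sigmaK, Finset.prod_const_one, Finset.sum_const, Finset.card_powersetCard,
    Finset.card_univ, Fintype.card_fin, nsmul_eq_mul, mul_one]
  exact_mod_cast Nat.choose_pos (hj.trans hk)

/-- The inequality `le_linear` at the point `(1, …, 1)`. -/
theorem StructureConditions.one_le_sum (hF : StructureConditions Γ F ε) {lam : Fin n → ℝ}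
    (h : lam ∈ Γ) : 1 ≤ ∑ i, fderiv ℝ F lam (Pi.single i 1) := by
  have := hF.le_linear h (hF.cone.gamma_n_subset (one_mem_gammaCone n n le_rfl))
  rw [hF.normalized] at this
  simpa using this

/-- If all entries of `lam` are at least `m ≥ 0`, then `m ≤ F lam`. -/
theorem StructureConditions.le_of_forall_le (hF : StructureConditions Γ F ε) {lam : Fin n → ℝ}
    (h : lam ∈ Γ) {m : ℝ} (hm : 0 ≤ m) (hlam : ∀ i, m ≤ lam i) : m ≤ F lam := by
  rw [← hF.euler h]
  calc m ≤ (∑ i, fderiv ℝ F lam (Pi.single i 1)) * m :=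
        le_mul_of_one_le_left hm (hF.one_le_sum h)
    _ = ∑ i, fderiv ℝ F lam (Pi.single i 1) * m := by rw [Finset.sum_mul]
    _ ≤ _ := Finset.sum_le_sum fun i _ =>
        mul_le_mul_of_nonneg_left (hlam i) (hF.monotone lam h i).le

/-- The inequality `F mu ≤ ∑ F_i(lam) mu_i` remains true when `mu` is replaced by the diagonal entries,
in any orthonormal basis, of a symmetric matrix with eigenvalues `mu`: by Schur and Birkhoff they form
a convex combination of permutations of `mu`. -/
theorem StructureConditions.le_linear_diag (hF : StructureConditions Γ F ε) {lam mu : Fin n → ℝ}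
    (h : lam ∈ Γ) (hm : mu ∈ Γ) {O : Matrix (Fin n) (Fin n) ℝ} (hO : Oᵀ * O = 1) :
    F mu ≤ ∑ i, fderiv ℝ F lam (Pi.single i 1) * (Oᵀ * Matrix.diagonal mu * O) i i := by
  have hO' : O * Oᵀ = 1 := mul_eq_one_comm.1 hO
  -- the squares of the entries of an orthogonal matrix form a doubly stochastic matrix
  have hD : (Matrix.of fun i j => O j i ^ 2) ∈ doublyStochastic ℝ (Fin n) := by
    rw [mem_doublyStochastic_iff_sum]
    refine ⟨fun i j => sq_nonneg _, fun i => ?_, fun j => ?_⟩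
    · have := congrFun (congrFun hO i) i
      simpa [Matrix.mul_apply, sq] using this
    · have := congrFun (congrFun hO' j) j
      simpa [Matrix.mul_apply, sq] using this
  obtain ⟨w, hw0, hw1, hw⟩ := exists_eq_sum_perm_of_mem_doublyStochastic hD
  have hdiag : ∀ i, (Oᵀ * Matrix.diagonal mu * O) i i = ∑ τ, w τ * mu (τ i) := by
    intro i
    have h1 : (Oᵀ * Matrix.diagonal mu * O) i i
        = ((Matrix.of fun i j => O j i ^ 2) *ᵥ mu) i := by
      rw [Matrix.mul_apply]
      simp only [Matrix.mul_diagonal, Matrix.transpose_apply, Matrix.mulVec,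
        dotProduct, Matrix.of_apply]
      exact Finset.sum_congr rfl fun j _ => by ring
    rw [h1, ← hw, Matrix.sum_mulVec, Finset.sum_apply]
    refine Finset.sum_congr rfl fun τ _ => ?_
    rw [Matrix.smul_mulVec, Pi.smul_apply, Matrix.permMatrix_mulVec, smul_eq_mul]
    rfl
  calc F mu = ∑ τ, w τ * F mu := by rw [← Finset.sum_mul, hw1, one_mul]
    _ ≤ ∑ τ, w τ * ∑ i, fderiv ℝ F lam (Pi.single i 1) * mu (τ i) := by
        refine Finset.sum_le_sum fun τ _ => mul_le_mul_of_nonneg_left ?_ (hw0 τ)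
        rw [← hF.symmetric τ mu hm]
        exact hF.le_linear h (hF.cone.perm_mem τ mu hm)
    _ = ∑ i, fderiv ℝ F lam (Pi.single i 1) * ∑ τ, w τ * mu (τ i) := by
        simp only [Finset.mul_sum]
        rw [Finset.sum_comm]
        exact Finset.sum_congr rfl fun i _ => Finset.sum_congr rfl fun τ _ => by ring
    _ = _ := by simp only [hdiag]

/-- The linearization of `F` at one symmetric form, evaluated on the diagonal entries of another form
in an arbitrary orthonormal frame, dominates `F` of that other form. -/
theorem StructureConditions.le_frame (hF : StructureConditions Γ F ε) {lam mu : Fin n → ℝ}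
    (h : lam ∈ Γ) (hm : mu ∈ Γ) {g W Q : Matrix (Fin n) (Fin n) ℝ} (hQ : Qᵀ * g * Q = 1)
    (hmu : IsEigenvaluesWrt g W mu) :
    F mu ≤ ∑ i, fderiv ℝ F lam (Pi.single i 1) * (Qᵀ * W * Q) i i := by
  obtain ⟨P, hP, hW⟩ := hmu
  obtain ⟨hPO, hO⟩ := frame_orthogonal hP hQ
  set O := Pᵀ * g * Q with hOdef
  have := hF.le_linear_diag h hm hO
  have e : Oᵀ * Matrix.diagonal mu * O = Qᵀ * W * Q := by
    conv_rhs => rw [← hPO, Matrix.transpose_mul]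
    rw [← hW]; simp only [Matrix.mul_assoc]
  rwa [e] at this

end Concave

/-! ### Directional derivatives and second-order jets -/

section DirD

variable {E : Type*} [NormedAddCommGroup E] [NormedSpace ℝ E]

/-- The derivative of `w` in the constant direction `X`, as a function of the point. -/
def dirD (X : E) (w : E → ℝ) : E → ℝ := fun y => fderiv ℝ w y X

theorem ContDiffAt.dirD {w : E → ℝ} {x : E} {k : ℕ} (hw : ContDiffAt ℝ (k + 1 : ℕ) w x) (X : E) :
    ContDiffAt ℝ k (dirD X w) x :=
  (hw.fderiv_right (m := k) (by norm_cast)).clm_apply contDiffAt_const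

theorem Filter.EventuallyEq.dirD {w w' : E → ℝ} {x : E} (h : w =ᶠ[𝓝 x] w') (X : E) :
    dirD X w =ᶠ[𝓝 x] dirD X w' := by
  filter_upwards [h.fderiv (𝕜 := ℝ)] with y hy
  simp only [_root_.dirD, hy]

theorem eventually_differentiableAt {w : E → ℝ} {x : E} (hw : ContDiffAt ℝ 1 w x) :
    ∀ᶠ y in 𝓝 x, DifferentiableAt ℝ w y := by
  filter_upwards [hw.eventually (by simp)] with y hy
  exact hy.differentiableAt one_ne_zero

theorem dirD_add {w w' : E → ℝ} {x : E} (hw : ContDiffAt ℝ 1 w x) (hw' : ContDiffAt ℝ 1 w' x)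
    (X : E) : dirD X (fun y => w y + w' y) =ᶠ[𝓝 x] fun y => dirD X w y + dirD X w' y := by
  filter_upwards [eventually_differentiableAt hw, eventually_differentiableAt hw'] with y h h'
  simp only [dirD]
  rw [fderiv_fun_add h h']; rfl

theorem dirD_mul {w w' : E → ℝ} {x : E} (hw : ContDiffAt ℝ 1 w x) (hw' : ContDiffAt ℝ 1 w' x)
    (X : E) : dirD X (fun y => w y * w' y)
      =ᶠ[𝓝 x] fun y => dirD X w y * w' y + w y * dirD X w' y := by
  filter_upwards [eventually_differentiableAt hw, eventually_differentiableAt hw'] with y h h'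
  simp only [dirD]
  rw [fderiv_fun_mul h h']
  simp only [add_apply, smul_apply, smul_eq_mul]
  ring

theorem dirD_dirD_apply {w : E → ℝ} {y : E} (hy : ContDiffAt ℝ 2 w y) (X Y : E) :
    dirD X (dirD Y w) y = fderiv ℝ (fderiv ℝ w) y X Y := by
  have hd : DifferentiableAt ℝ (fderiv ℝ w) y :=
    (hy.fderiv_right (m := 1) (by norm_num)).differentiableAt one_ne_zero
  change fderiv ℝ (fun z => fderiv ℝ w z Y) y X = _
  rw [fderiv_clm_apply hd (differentiableAt_const _)]
  simp

theorem dirD_comm {w : E → ℝ} {x : E} (hw : ContDiffAt ℝ 2 w x) (X Y : E) :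
    dirD X (dirD Y w) =ᶠ[𝓝 x] dirD Y (dirD X w) := by
  filter_upwards [hw.eventually (by simp)] with y hy
  rw [dirD_dirD_apply hy, dirD_dirD_apply hy]
  exact (hy.isSymmSndFDerivAt (by simp)).eq X Y

/-- `w` is `C²` at `x`, and `w₀`, `w₁`, `w₂` are its value and its first and second derivative
at `x` in the direction `X`. -/
structure HasJet (w : E → ℝ) (x X : E) (w₀ w₁ w₂ : ℝ) : Prop where
  contDiffAt : ContDiffAt ℝ 2 w x
  val : w x = w₀
  d1 : dirD X w x = w₁
  d2 : dirD X (dirD X w) x = w₂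

namespace HasJet

variable {x X : E} {w w' : E → ℝ} {w₀ w₁ w₂ w₀' w₁' w₂' : ℝ}

theorem self (hw : ContDiffAt ℝ 2 w x) :
    HasJet w x X (w x) (dirD X w x) (dirD X (dirD X w) x) := ⟨hw, rfl, rfl, rfl⟩

theorem const (c : ℝ) : HasJet (fun _ => c) x X c 0 0 := by
  have h : dirD X (fun _ : E => c) = fun _ => 0 := by funext y; simp [dirD]
  exact ⟨contDiffAt_const, rfl, by rw [h], by rw [h]; simp [dirD]⟩

theorem add (h : HasJet w x X w₀ w₁ w₂) (h' : HasJet w' x X w₀' w₁' w₂') :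
    HasJet (fun y => w y + w' y) x X (w₀ + w₀') (w₁ + w₁') (w₂ + w₂') := by
  have e := dirD_add (h.contDiffAt.of_le one_le_two) (h'.contDiffAt.of_le one_le_two) X
  refine ⟨h.contDiffAt.add h'.contDiffAt, by rw [h.val, h'.val], by
    rw [e.eq_of_nhds, h.d1, h'.d1], ?_⟩
  rw [(e.dirD X).eq_of_nhds, (dirD_add (ContDiffAt.dirD (k := 1) h.contDiffAt X)
    (ContDiffAt.dirD (k := 1) h'.contDiffAt X) X).eq_of_nhds, h.d2, h'.d2]

theorem mul (h : HasJet w x X w₀ w₁ w₂) (h' : HasJet w' x X w₀' w₁' w₂') :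
    HasJet (fun y => w y * w' y) x X (w₀ * w₀') (w₁ * w₀' + w₀ * w₁')
      (w₂ * w₀' + 2 * (w₁ * w₁') + w₀ * w₂') := by
  have h1 := h.contDiffAt.of_le one_le_two
  have h1' := h'.contDiffAt.of_le one_le_two
  have d1 := ContDiffAt.dirD (k := 1) h.contDiffAt X
  have d1' := ContDiffAt.dirD (k := 1) h'.contDiffAt X
  have e := dirD_mul h1 h1' X
  refine ⟨h.contDiffAt.mul h'.contDiffAt, by rw [h.val, h'.val], by
    rw [e.eq_of_nhds, h.d1, h'.d1, h.val, h'.val], ?_⟩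
  rw [(e.dirD X).eq_of_nhds, (dirD_add (d1.mul h1') (h1.mul d1') X).eq_of_nhds,
    (dirD_mul d1 h1' X).eq_of_nhds, (dirD_mul h1 d1' X).eq_of_nhds,
    h.d2, h'.d2, h.d1, h'.d1, h.val, h'.val]
  ring

theorem const_mul (c : ℝ) (h : HasJet w x X w₀ w₁ w₂) :
    HasJet (fun y => c * w y) x X (c * w₀) (c * w₁) (c * w₂) := by
  have := (const (x := x) (X := X) c).mul h
  simpa using this

theorem sub (h : HasJet w x X w₀ w₁ w₂) (h' : HasJet w' x X w₀' w₁' w₂') :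
    HasJet (fun y => w y - w' y) x X (w₀ - w₀') (w₁ - w₁') (w₂ - w₂') := by
  have := h.add (h'.const_mul (-1))
  simpa [sub_eq_add_neg] using this

theorem sum {κ : Type*} (s : Finset κ) {f : κ → E → ℝ} {f₀ f₁ f₂ : κ → ℝ}
    (h : ∀ j ∈ s, HasJet (f j) x X (f₀ j) (f₁ j) (f₂ j)) :
    HasJet (fun y => ∑ j ∈ s, f j y) x X (∑ j ∈ s, f₀ j) (∑ j ∈ s, f₁ j) (∑ j ∈ s, f₂ j) := by
  classical
  induction s using Finset.induction_on with
  | empty => simpa using const (x := x) (X := X) 0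
  | insert j s hj ih =>
    have := (h j (Finset.mem_insert_self _ _)).add
      (ih fun j' hj' => h j' (Finset.mem_insert_of_mem hj'))
    simpa [Finset.sum_insert hj] using this

/-- The first- and second-derivative tests at a local minimum. -/
theorem of_isLocalMin (h : HasJet w x X w₀ w₁ w₂) (hm : IsLocalMin w x) : w₁ = 0 ∧ 0 ≤ w₂ := by
  have h1 : w₁ = 0 := by
    rw [← h.d1, dirD, hm.fderiv_eq_zero]; rfl
  refine ⟨h1, ?_⟩
  set l : ℝ → E := fun s => x + s • X with hl
  have hl0 : l 0 = x := by simp [hl]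
  have hld : ∀ s, HasDerivAt l X s := fun s => by
    simpa [hl] using ((hasDerivAt_id s).smul_const X).const_add x
  have hlc : Tendsto l (𝓝 0) (𝓝 x) := by
    have := (hld 0).continuousAt.tendsto; rwa [hl0] at this
  have e1 : ∀ w : E → ℝ, ContDiffAt ℝ 1 w x →
      deriv (fun s => w (l s)) =ᶠ[𝓝 0] fun s => dirD X w (l s) := by
    intro w hw
    filter_upwards [hlc.eventually (eventually_differentiableAt hw)] with s hs
    exact (hs.hasFDerivAt.comp_hasDerivAt s (hld s)).deriv
  have ea := e1 w (h.contDiffAt.of_le one_le_two)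
  have eb := e1 (dirD X w) (ContDiffAt.dirD (k := 1) h.contDiffAt X)
  have d1 : deriv (fun s => w (l s)) 0 = 0 := by rw [ea.eq_of_nhds, hl0, h.d1, h1]
  have d2 : deriv (deriv (fun s => w (l s))) 0 = w₂ := by
    rw [ea.deriv_eq, eb.eq_of_nhds, hl0, h.d2]
  by_contra hneg
  push Not at hneg
  have hc : ContinuousAt (fun s => w (l s)) 0 := by
    refine ContinuousAt.comp (g := w) ?_ (hld 0).continuousAt
    rw [hl0]; exact h.contDiffAt.continuousAt
  -- a negative second derivative makes `w` constant along the line, a contradiction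
  have hmax := isLocalMax_of_deriv_deriv_neg (by rw [d2]; exact hneg) d1 hc
  have hmin : ∀ᶠ s in 𝓝 (0 : ℝ), w (l 0) ≤ w (l s) := by
    rw [hl0]; exact hlc.eventually hm
  have heq : (fun s => w (l s)) =ᶠ[𝓝 0] fun _ => w (l 0) := by
    filter_upwards [hmax, hmin] with s h1 h2 using le_antisymm h1 h2
  have : deriv (deriv (fun s => w (l s))) 0 = 0 := by
    have h3 := heq.deriv
    rw [h3.deriv_eq]; simp
  rw [d2] at this
  linarith

theorem of_isLocalMax (h : HasJet w x X w₀ w₁ w₂) (hm : IsLocalMax w x) : w₁ = 0 ∧ w₂ ≤ 0 := by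
  have := (h.const_mul (-1)).of_isLocalMin (by
    filter_upwards [hm] with y hy; linarith)
  constructor <;> linarith [this.1, this.2]

end HasJet

end DirD

/-! ### Weighted bounds on second-order jets -/

section Weight

variable {ι : Type*} {E : Type*} [NormedAddCommGroup E] [NormedSpace ℝ E]

/-- `f = O(q ^ d)`, uniformly over the index set. -/
def BigW (q : ι → ℝ) (d : ℕ) (f : ι → ℝ) : Prop := f =O[⊤] (fun i => q i ^ d)

namespace BigW

variable {q : ι → ℝ} {d d' : ℕ} {f g : ι → ℝ}

theorem iff_exists : BigW q d f ↔ ∃ C, ∀ i, |f i| ≤ C * |q i ^ d| := by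
  simp [BigW, isBigO_top]

theorem exists_bound (hq : ∀ i, 1 ≤ q i) (h : BigW q d f) :
    ∃ C, 0 ≤ C ∧ ∀ i, |f i| ≤ C * q i ^ d := by
  obtain ⟨C, hC⟩ := iff_exists.1 h
  refine ⟨|C|, abs_nonneg _, fun i => (hC i).trans ?_⟩
  rw [abs_of_nonneg (pow_nonneg (zero_le_one.trans (hq i)) d)]
  exact mul_le_mul_of_nonneg_right (le_abs_self _) (pow_nonneg (zero_le_one.trans (hq i)) d)

theorem of_bound (C : ℝ) (h : ∀ i, |f i| ≤ C * |q i ^ d|) : BigW q d f := iff_exists.2 ⟨C, h⟩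

theorem add (h : BigW q d f) (h' : BigW q d g) : BigW q d (fun i => f i + g i) := IsBigO.add h h'

theorem mul (h : BigW q d f) (h' : BigW q d' g) : BigW q (d + d') (fun i => f i * g i) := by
  have := IsBigO.mul h h'
  simpa only [BigW, pow_add] using this

theorem const_mul (c : ℝ) (h : BigW q d f) : BigW q d (fun i => c * f i) :=
  IsBigO.const_mul_left h c

theorem zero : BigW q d (fun _ => 0) := isBigO_zero _ _

theorem sum {κ : Type*} (s : Finset κ) {f : κ → ι → ℝ} (h : ∀ j ∈ s, BigW q d (f j)) :
    BigW q d (fun i => ∑ j ∈ s, f j i) := by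
  have := IsBigO.sum (l := ⊤) (g := fun i => q i ^ d) (A := f) (s := s) h
  simpa [BigW] using this

theorem mono (hq : ∀ i, 1 ≤ q i) (h : BigW q d f) (hd : d ≤ d') : BigW q d' f := by
  obtain ⟨C, hC0, hC⟩ := h.exists_bound hq
  refine of_bound C fun i => (hC i).trans ?_
  rw [abs_of_nonneg (pow_nonneg (zero_le_one.trans (hq i)) _)]
  exact mul_le_mul_of_nonneg_left (pow_le_pow_right₀ (hq i) hd) hC0

theorem of_isBigO_one (h : f =O[⊤] (fun _ => (1 : ℝ))) : BigW q 0 f := by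
  simpa [BigW] using h

end BigW

/-- The functions `f i` are `C²` at the origin, and their values, first and second directional
derivatives there are `O(q ^ d₀)`, `O(q ^ d₁)` and `O(q ^ d₂)`. -/
structure JetW (q : ι → ℝ) (d₀ d₁ d₂ : ℕ) (f : ι → E → ℝ) : Prop where
  contDiffAt : ∀ i, ContDiffAt ℝ 2 (f i) 0
  val : BigW q d₀ (fun i => f i 0)
  d1 : ∀ X : ι → E, (∀ i, ‖X i‖ ≤ 1) → BigW q d₁ (fun i => dirD (X i) (f i) 0)
  d2 : ∀ X : ι → E, (∀ i, ‖X i‖ ≤ 1) → BigW q d₂ (fun i => dirD (X i) (dirD (X i) (f i)) 0)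

namespace JetW

variable {q : ι → ℝ} {d₀ d₁ d₂ : ℕ} {f g : ι → E → ℝ}

theorem hasJet (h : JetW q d₀ d₁ d₂ f) (i : ι) (X : E) :
    HasJet (f i) 0 X (f i 0) (dirD X (f i) 0) (dirD X (dirD X (f i)) 0) :=
  HasJet.self (h.contDiffAt i)

theorem of_hasJet (hc : ∀ i, ContDiffAt ℝ 2 (f i) 0)
    (h : ∀ X : ι → E, (∀ i, ‖X i‖ ≤ 1) → ∃ f₀ f₁ f₂ : ι → ℝ,
      (∀ i, HasJet (f i) 0 (X i) (f₀ i) (f₁ i) (f₂ i)) ∧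
        BigW q d₀ f₀ ∧ BigW q d₁ f₁ ∧ BigW q d₂ f₂) : JetW q d₀ d₁ d₂ f := by
  refine ⟨hc, ?_, fun X hX => ?_, fun X hX => ?_⟩
  · obtain ⟨f₀, f₁, f₂, hj, h0, -, -⟩ := h (fun _ => 0) (by simp)
    simpa only [fun i => (hj i).val] using h0
  · obtain ⟨f₀, f₁, f₂, hj, -, h1, -⟩ := h X hX
    simpa only [fun i => (hj i).d1] using h1
  · obtain ⟨f₀, f₁, f₂, hj, -, -, h2⟩ := h X hX
    simpa only [fun i => (hj i).d2] using h2

theorem mono (hq : ∀ i, 1 ≤ q i) (h : JetW q d₀ d₁ d₂ f) {e₀ e₁ e₂ : ℕ} (h0 : d₀ ≤ e₀)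
    (h1 : d₁ ≤ e₁) (h2 : d₂ ≤ e₂) : JetW q e₀ e₁ e₂ f :=
  ⟨h.contDiffAt, h.val.mono hq h0, fun X hX => (h.d1 X hX).mono hq h1,
    fun X hX => (h.d2 X hX).mono hq h2⟩

theorem add (h : JetW q d₀ d₁ d₂ f) (h' : JetW q d₀ d₁ d₂ g) :
    JetW q d₀ d₁ d₂ (fun i y => f i y + g i y) :=
  of_hasJet (fun i => (h.contDiffAt i).add (h'.contDiffAt i)) fun X hX =>
    ⟨_, _, _, fun i => (h.hasJet i (X i)).add (h'.hasJet i (X i)), h.val.add h'.val,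
      (h.d1 X hX).add (h'.d1 X hX), (h.d2 X hX).add (h'.d2 X hX)⟩

theorem const_mul (c : ℝ) (h : JetW q d₀ d₁ d₂ f) : JetW q d₀ d₁ d₂ (fun i y => c * f i y) :=
  of_hasJet (fun i => contDiffAt_const.mul (h.contDiffAt i)) fun X hX =>
    ⟨_, _, _, fun i => (h.hasJet i (X i)).const_mul c, h.val.const_mul c,
      (h.d1 X hX).const_mul c, (h.d2 X hX).const_mul c⟩

theorem sum {κ : Type*} (s : Finset κ) {f : κ → ι → E → ℝ}
    (h : ∀ j ∈ s, JetW q d₀ d₁ d₂ (f j)) : JetW q d₀ d₁ d₂ (fun i y => ∑ j ∈ s, f j i y) :=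
  of_hasJet (fun i => ContDiffAt.sum fun j hj => (h j hj).contDiffAt i) fun X hX =>
    ⟨_, _, _, fun i => HasJet.sum s fun j hj => (h j hj).hasJet i (X i),
      BigW.sum s fun j hj => (h j hj).val,
      BigW.sum s fun j hj => (h j hj).d1 X hX, BigW.sum s fun j hj => (h j hj).d2 X hX⟩

/-- Multiplication by functions with bounded jets. -/
theorem bdd_mul (hq : ∀ i, 1 ≤ q i) (h : JetW q 0 0 0 f) (h' : JetW q 2 2 3 g) :
    JetW q 2 2 3 (fun i y => f i y * g i y) :=
  of_hasJet (fun i => (h.contDiffAt i).mul (h'.contDiffAt i)) fun X hX =>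
    ⟨_, _, _, fun i => (h.hasJet i (X i)).mul (h'.hasJet i (X i)),
      (h.val.mul h'.val).mono hq (by norm_num),
      (((h.d1 X hX).mul h'.val).mono hq (by norm_num)).add
        ((h.val.mul (h'.d1 X hX)).mono hq (by norm_num)),
      ((((h.d2 X hX).mul h'.val).mono hq (by norm_num)).add
        ((((h.d1 X hX).mul (h'.d1 X hX)).const_mul 2).mono hq (by norm_num))).add
        ((h.val.mul (h'.d2 X hX)).mono hq (by norm_num))⟩

/-- Multiplication by functions with bounded jets that vanish at the origin: the second
derivatives of the other factor do not matter. -/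
theorem vanish_mul (hq : ∀ i, 1 ≤ q i) (h : JetW q 0 0 0 f) (h0 : ∀ i, f i 0 = 0)
    (hg : ∀ i, ContDiffAt ℝ 2 (g i) 0) (hg0 : BigW q 2 (fun i => g i 0))
    (hg1 : ∀ X : ι → E, (∀ i, ‖X i‖ ≤ 1) → BigW q 3 (fun i => dirD (X i) (g i) 0)) :
    JetW q 2 2 3 (fun i y => f i y * g i y) :=
  of_hasJet (fun i => (h.contDiffAt i).mul (hg i)) fun X hX =>
    ⟨fun _ => 0, fun i => dirD (X i) (f i) 0 * g i 0,
      fun i => dirD (X i) (dirD (X i) (f i)) 0 * g i 0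
        + 2 * (dirD (X i) (f i) 0 * dirD (X i) (g i) 0), fun i => by
        have := (h.hasJet i (X i)).mul (HasJet.self (X := X i) (hg i))
        simpa [h0] using this,
      BigW.zero, ((h.d1 X hX).mul hg0).mono hq (by norm_num),
      (((h.d2 X hX).mul hg0).mono hq (by norm_num)).add
        ((((h.d1 X hX).mul (hg1 X hX)).const_mul 2).mono hq (by norm_num))⟩

/-- Multiplication by functions with bounded jets that vanish to second order at the origin: no
derivative of the other factor matters. -/
theorem vanish_two_mul (hq : ∀ i, 1 ≤ q i) (h : JetW q 0 0 0 f) (h0 : ∀ i, f i 0 = 0)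
    (h1 : ∀ i X, dirD X (f i) 0 = 0)
    (hg : ∀ i, ContDiffAt ℝ 2 (g i) 0) (hg0 : BigW q 2 (fun i => g i 0)) :
    JetW q 2 2 3 (fun i y => f i y * g i y) :=
  of_hasJet (fun i => (h.contDiffAt i).mul (hg i)) fun X hX =>
    ⟨fun _ => 0, fun _ => 0,
      fun i => dirD (X i) (dirD (X i) (f i)) 0 * g i 0, fun i => by
        have := (h.hasJet i (X i)).mul (HasJet.self (X := X i) (hg i))
        simpa [h0, h1] using this,
      BigW.zero, BigW.zero, ((h.d2 X hX).mul hg0).mono hq (by norm_num)⟩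

/-- Derivatives of order at most two bounded in norm. -/
theorem of_norm_bound (hq : ∀ i, 1 ≤ q i) (hc : ∀ i, ContDiffAt ℝ 2 (f i) 0) {C : ℝ}
    (h0 : ∀ i, ‖iteratedFDeriv ℝ 0 (f i) 0‖ ≤ C * q i ^ d₀)
    (h1 : ∀ i, ‖iteratedFDeriv ℝ 1 (f i) 0‖ ≤ C * q i ^ d₁)
    (h2 : ∀ i, ‖iteratedFDeriv ℝ 2 (f i) 0‖ ≤ C * q i ^ d₂) : JetW q d₀ d₁ d₂ f := by
  have hqp : ∀ d i, |q i ^ d| = q i ^ d :=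
    fun d i => abs_of_nonneg (pow_nonneg (zero_le_one.trans (hq i)) d)
  refine ⟨hc, BigW.of_bound C fun i => ?_, fun X hX => BigW.of_bound C fun i => ?_,
    fun X hX => BigW.of_bound C fun i => ?_⟩
  · rw [hqp, ← Real.norm_eq_abs, ← norm_iteratedFDeriv_zero (𝕜 := ℝ)]; exact h0 i
  · rw [hqp, ← Real.norm_eq_abs]
    refine le_trans ?_ (h1 i)
    rw [norm_iteratedFDeriv_one]
    exact (ContinuousLinearMap.le_opNorm _ _).trans
      (mul_le_of_le_one_right (norm_nonneg _) (hX i))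
  · rw [hqp, ← Real.norm_eq_abs]
    refine le_trans ?_ (h2 i)
    have : dirD (X i) (dirD (X i) (f i)) 0 = iteratedFDeriv ℝ 2 (f i) 0 ![X i, X i] := by
      rw [iteratedFDeriv_two_apply, dirD_dirD_apply (hc i)]; rfl
    rw [this]
    refine (ContinuousMultilinearMap.le_opNorm _ _).trans
      (mul_le_of_le_one_right (norm_nonneg _) ?_)
    simp only [Fin.prod_univ_two, Matrix.cons_val_zero, Matrix.cons_val_one]
    exact mul_le_one₀ (hX i) (norm_nonneg _) (hX i)

end JetW

theorem UnifJet.jetW {q : ι → ℝ} {f : ι → E → ℝ} (hq : ∀ i, 1 ≤ q i)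
    (h : UnifJet 2 f (fun _ => 0)) : JetW q 0 0 0 f := by
  obtain ⟨C, -, hC⟩ := h.exists_bound
  exact JetW.of_norm_bound hq h.contDiffAt (C := C) (fun i => by simpa using hC i 0 (by norm_num))
    (fun i => by simpa using hC i 1 (by norm_num)) (fun i => by simpa using hC i 2 le_rfl)

end Weight

/-! ### The cancellation of the cubic terms -/

section Cancellation

variable {n : ℕ}

/-- The identity behind the estimate. When the linearized operator `F i + c ∑ F` is applied to the
test function, all terms that are cubic in first and second derivatives cancel, up to the
defects `R'` and `R` of the differentiated equation and of the critical point equation. Here `p` and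
`h` are the first and second derivatives, `t m l` is the third derivative in directions `m`, `m`, `l`,
and `hE`, `te`, `q4` are the second, third and fourth derivatives which involve the distinguished
directions `k ∈ s` once, twice and twice. -/
theorem linearized_identity (s : Finset (Fin n)) (F p : Fin n → ℝ) (FF c a b : ℝ)
    (hFF : FF = ∑ m, F m) (h t hE te q4 : Fin n → Fin n → ℝ) (hs : ∀ i j, h i j = h j i)
    (R R' : Fin n → ℝ)
    (hR : ∀ m, R m = ∑ k ∈ s, te k m + 2 * a * ∑ l, p l * h l m)
    (hR' : ∀ l, R' l = ∑ m, F m * (t m l + c * ∑ j, t j l + 2 * a * (p m * h m l)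
      + 2 * b * ∑ j, p j * h j l)) :
    ∑ i, (F i + c * FF) * (∑ k ∈ s, q4 k i + a * ∑ l, (2 * h i l ^ 2 + 2 * (p l * t i l)))
      - ∑ k ∈ s, ∑ m, F m * (q4 k m + c * ∑ j, q4 k j + a * (2 * hE k m ^ 2 + 2 * (p m * te k m))
        + b * ∑ j, (2 * hE k j ^ 2 + 2 * (p j * te k j)))
    = 2 * (a * ∑ m, F m * (∑ l, h m l ^ 2 - ∑ k ∈ s, hE k m ^ 2)
        + c * a * FF * ∑ m, ∑ l, h m l ^ 2 - b * FF * ∑ k ∈ s, ∑ l, hE k l ^ 2)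
      + 2 * a * ∑ l, p l * R' l - 2 * a * ∑ m, F m * (p m * R m) - 2 * b * FF * ∑ j, p j * R j := by
  -- all sums are reduced to sums of `F m * …` and `FF * …`, for which the identity is linear
  set D : Fin n → ℝ := fun m => ∑ l, p l * h l m with hD
  set TE : Fin n → ℝ := fun m => ∑ k ∈ s, te k m with hTE
  have hFm : ∀ x : ℝ, ∑ m, F m * x = FF * x := fun x => by rw [hFF, Finset.sum_mul]
  have e0 : ∑ l, p l * ∑ m, F m * (p m * h m l) = ∑ m, F m * (p m * D m) := by
    simp only [hD, Finset.mul_sum]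
    rw [Finset.sum_comm]
    exact Finset.sum_congr rfl fun m _ => Finset.sum_congr rfl fun l _ => by rw [hs m l]; ring
  have e1 : ∑ l, p l * R' l = ∑ m, F m * ∑ l, p l * t m l + c * FF * ∑ m, ∑ l, p l * t m l
      + 2 * a * ∑ m, F m * (p m * D m) + 2 * b * FF * ∑ l, p l * D l := by
    have h1 : ∀ l, R' l = ∑ m, F m * t m l + FF * (c * ∑ j, t j l)
        + 2 * a * ∑ m, F m * (p m * h m l) + FF * (2 * b * D l) := by
      intro l
      rw [hR', ← hFm, ← hFm, Finset.mul_sum (a := 2 * a), ← Finset.sum_add_distrib,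
        ← Finset.sum_add_distrib, ← Finset.sum_add_distrib]
      exact Finset.sum_congr rfl fun m _ => by ring
    have h2 : ∀ l, p l * R' l = p l * ∑ m, F m * t m l + c * FF * (p l * ∑ j, t j l)
        + 2 * a * (p l * ∑ m, F m * (p m * h m l)) + 2 * b * FF * (p l * D l) := by
      intro l; rw [h1]; ring
    simp only [h2, Finset.sum_add_distrib, ← Finset.mul_sum]
    rw [e0]
    have h3 : ∑ l, p l * ∑ m, F m * t m l = ∑ m, F m * ∑ l, p l * t m l := by
      simp only [Finset.mul_sum]
      rw [Finset.sum_comm]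
      exact Finset.sum_congr rfl fun m _ => Finset.sum_congr rfl fun l _ => by ring
    have h4 : ∑ l, p l * ∑ m, t m l = ∑ m, ∑ l, p l * t m l := by
      simp only [Finset.mul_sum]
      rw [Finset.sum_comm]
    rw [h3, h4]
  have e2 : ∑ m, F m * (p m * R m) = ∑ m, F m * (p m * TE m) + 2 * a * ∑ m, F m * (p m * D m) := by
    rw [Finset.mul_sum (a := 2 * a), ← Finset.sum_add_distrib]
    exact Finset.sum_congr rfl fun m _ => by rw [hR]; ring
  have e3 : ∑ m, p m * R m = ∑ m, p m * TE m + 2 * a * ∑ m, p m * D m := by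
    rw [Finset.mul_sum (a := 2 * a), ← Finset.sum_add_distrib]
    exact Finset.sum_congr rfl fun m _ => by rw [hR]; ring
  have e4 : ∑ i, (F i + c * FF) * (∑ k ∈ s, q4 k i + a * ∑ l, (2 * h i l ^ 2 + 2 * (p l * t i l)))
      = ∑ m, F m * ∑ k ∈ s, q4 k m + c * FF * ∑ m, ∑ k ∈ s, q4 k m
        + 2 * a * (∑ m, F m * ∑ l, h m l ^ 2 + c * FF * ∑ m, ∑ l, h m l ^ 2)
        + 2 * a * (∑ m, F m * ∑ l, p l * t m l + c * FF * ∑ m, ∑ l, p l * t m l) := by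
    have h1 : ∀ i, (F i + c * FF) * (∑ k ∈ s, q4 k i + a * ∑ l, (2 * h i l ^ 2 + 2 * (p l * t i l)))
        = F i * ∑ k ∈ s, q4 k i + c * FF * ∑ k ∈ s, q4 k i
        + 2 * a * (F i * ∑ l, h i l ^ 2 + c * FF * ∑ l, h i l ^ 2)
        + 2 * a * (F i * ∑ l, p l * t i l + c * FF * ∑ l, p l * t i l) := by
      intro i
      rw [Finset.sum_add_distrib, ← Finset.mul_sum, ← Finset.mul_sum]; ring
    rw [Finset.sum_congr rfl fun i _ => h1 i]
    simp only [Finset.sum_add_distrib, ← Finset.mul_sum]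
  have e5 : ∑ k ∈ s, ∑ m, F m * (q4 k m + c * ∑ j, q4 k j
        + a * (2 * hE k m ^ 2 + 2 * (p m * te k m)) + b * ∑ j, (2 * hE k j ^ 2 + 2 * (p j * te k j)))
      = ∑ m, F m * ∑ k ∈ s, q4 k m + c * FF * ∑ m, ∑ k ∈ s, q4 k m
        + 2 * a * (∑ m, F m * ∑ k ∈ s, hE k m ^ 2 + ∑ m, F m * (p m * TE m))
        + 2 * b * FF * (∑ k ∈ s, ∑ l, hE k l ^ 2 + ∑ m, p m * TE m) := by
    have h1 : ∀ k, ∑ m, F m * (q4 k m + c * ∑ j, q4 k j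
        + a * (2 * hE k m ^ 2 + 2 * (p m * te k m)) + b * ∑ j, (2 * hE k j ^ 2 + 2 * (p j * te k j)))
        = ∑ m, F m * q4 k m + c * FF * ∑ j, q4 k j
        + 2 * a * (∑ m, F m * hE k m ^ 2 + ∑ m, F m * (p m * te k m))
        + 2 * b * FF * (∑ j, hE k j ^ 2 + ∑ j, p j * te k j) := by
      intro k
      have : ∑ j, (2 * hE k j ^ 2 + 2 * (p j * te k j))
          = 2 * (∑ j, hE k j ^ 2 + ∑ j, p j * te k j) := by
        rw [Finset.sum_add_distrib, ← Finset.mul_sum, ← Finset.mul_sum]; ring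
      rw [this]
      have h2 : ∀ m, F m * (q4 k m + c * ∑ j, q4 k j + a * (2 * hE k m ^ 2 + 2 * (p m * te k m))
          + b * (2 * (∑ j, hE k j ^ 2 + ∑ j, p j * te k j))) = F m * q4 k m
          + F m * (c * ∑ j, q4 k j) + 2 * a * (F m * hE k m ^ 2) + 2 * a * (F m * (p m * te k m))
          + F m * (b * (2 * (∑ j, hE k j ^ 2 + ∑ j, p j * te k j))) := fun m => by ring
      rw [Finset.sum_congr rfl fun i _ => h2 i]
      simp only [Finset.sum_add_distrib, hFm]
      simp only [← Finset.mul_sum]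
      ring
    rw [Finset.sum_congr rfl fun i _ => h1 i]
    simp only [Finset.sum_add_distrib, ← Finset.mul_sum]
    have h3 : ∀ f : Fin n → Fin n → ℝ, ∑ k ∈ s, ∑ m, F m * f k m = ∑ m, F m * ∑ k ∈ s, f k m := by
      intro f
      rw [Finset.sum_comm]
      exact Finset.sum_congr rfl fun m _ => by rw [Finset.mul_sum]
    have h4 : ∑ k ∈ s, ∑ j, p j * te k j = ∑ m, p m * TE m := by
      rw [Finset.sum_comm]
      exact Finset.sum_congr rfl fun m _ => by rw [Finset.mul_sum]
    have h5 : ∑ m, F m * ∑ k ∈ s, p m * te k m = ∑ m, F m * (p m * TE m) :=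
      Finset.sum_congr rfl fun m _ => by rw [← Finset.mul_sum]
    rw [h3 q4, h3 (fun k m => hE k m ^ 2), h3 (fun k m => p m * te k m), h4, h5,
      Finset.sum_comm (s := s)]
  have e6 : ∑ m, F m * (∑ l, h m l ^ 2 - ∑ k ∈ s, hE k m ^ 2)
      = ∑ m, F m * ∑ l, h m l ^ 2 - ∑ m, F m * ∑ k ∈ s, hE k m ^ 2 := by
    rw [← Finset.sum_sub_distrib]
    exact Finset.sum_congr rfl fun m _ => by ring
  rw [e4, e5, e6, e1, e2, e3]
  ring

/-- The resulting inequality for the leading quadratic terms in the second derivatives. The test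
function is cut off by `σ ^ 2`; `hX1` and `hX2` come from the equation differentiated once and twice,
`hY1` and `hY2` from the first and second derivatives at the maximum. The factor `σ` in `hY1` is the
one that the derivative of the cutoff function costs. -/
theorem linearized_inequality (s : Finset (Fin n)) (F p : Fin n → ℝ) (FF c a b C q σ : ℝ)
    (hFF : FF = ∑ m, F m) (hF : ∀ m, 0 ≤ F m) (hc : 0 ≤ c) (hC : 0 ≤ C) (hq : 0 ≤ q) (hσ : 0 ≤ σ)
    (h t hE te q4 : Fin n → Fin n → ℝ) (hs : ∀ i j, h i j = h j i)
    (ha : |a| ≤ C) (hb : |b| ≤ C) (hp : ∀ m, |p m| ≤ q)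
    (hX1 : ∀ l, |∑ m, F m * (t m l + c * ∑ j, t j l + 2 * a * (p m * h m l)
      + 2 * b * ∑ j, p j * h j l)| ≤ C * FF * q ^ 2)
    (hX2 : ∀ k ∈ s, -(C * FF * q ^ 3) ≤ ∑ m, F m * (q4 k m + c * ∑ j, q4 k j
      + a * (2 * hE k m ^ 2 + 2 * (p m * te k m)) + b * ∑ j, (2 * hE k j ^ 2 + 2 * (p j * te k j))))
    (hY1 : ∀ m, σ * |∑ k ∈ s, te k m + 2 * a * ∑ l, p l * h l m| ≤ C * q ^ 2)
    (hY2 : ∀ i, σ ^ 2 * (∑ k ∈ s, q4 k i + a * ∑ l, (2 * h i l ^ 2 + 2 * (p l * t i l)))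
      ≤ C * (σ ^ 2 * q ^ 3 + q ^ 2)) :
    σ ^ 2 * (2 * (a * ∑ m, F m * (∑ l, h m l ^ 2 - ∑ k ∈ s, hE k m ^ 2)
        + c * a * FF * ∑ m, ∑ l, h m l ^ 2 - b * FF * ∑ k ∈ s, ∑ l, hE k l ^ 2))
      ≤ FF * (((1 + n * c) * C + n * C + 2 * n * C ^ 2) * (σ ^ 2 * q ^ 3)
        + (1 + n * c) * C * q ^ 2 + (2 + 2 * n) * C ^ 2 * (σ * q ^ 3)) := by
  have hFF0 : 0 ≤ FF := hFF ▸ Finset.sum_nonneg fun m _ => hF m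
  set R : Fin n → ℝ := fun m => ∑ k ∈ s, te k m + 2 * a * ∑ l, p l * h l m with hR
  set R' : Fin n → ℝ := fun l => ∑ m, F m * (t m l + c * ∑ j, t j l + 2 * a * (p m * h m l)
      + 2 * b * ∑ j, p j * h j l) with hR'
  have id := linearized_identity s F p FF c a b hFF h t hE te q4 hs R R' (fun m => rfl)
    (fun l => rfl)
  have b1 : σ ^ 2 * ∑ i, (F i + c * FF)
      * (∑ k ∈ s, q4 k i + a * ∑ l, (2 * h i l ^ 2 + 2 * (p l * t i l)))
      ≤ (1 + n * c) * FF * (C * (σ ^ 2 * q ^ 3 + q ^ 2)) := by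
    have : (1 + n * c) * FF * (C * (σ ^ 2 * q ^ 3 + q ^ 2))
        = ∑ i, (F i + c * FF) * (C * (σ ^ 2 * q ^ 3 + q ^ 2)) := by
      rw [← Finset.sum_mul, Finset.sum_add_distrib, ← hFF, Finset.sum_const, Finset.card_univ,
        Fintype.card_fin, nsmul_eq_mul]
      ring
    rw [this, Finset.mul_sum]
    refine Finset.sum_le_sum fun i _ => ?_
    have := mul_le_mul_of_nonneg_left (hY2 i) (add_nonneg (hF i) (mul_nonneg hc hFF0))
    linarith
  have b2 : -(n * (C * FF * q ^ 3)) ≤ ∑ k ∈ s, ∑ m, F m * (q4 k m + c * ∑ j, q4 k j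
      + a * (2 * hE k m ^ 2 + 2 * (p m * te k m))
      + b * ∑ j, (2 * hE k j ^ 2 + 2 * (p j * te k j))) := by
    have h1 := Finset.card_nsmul_le_sum s _ _ hX2
    have h2 : (s.card : ℝ) ≤ n := by exact_mod_cast (Finset.card_le_univ s).trans (by simp)
    rw [nsmul_eq_mul] at h1
    have h3 : 0 ≤ C * FF * q ^ 3 := by positivity
    nlinarith
  have b3 : |∑ l, p l * R' l| ≤ n * (q * (C * FF * q ^ 2)) := by
    refine (Finset.abs_sum_le_sum_abs _ _).trans ((Finset.sum_le_card_nsmul _ _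
      (q * (C * FF * q ^ 2)) fun l _ => ?_).trans (by simp))
    rw [abs_mul]
    exact mul_le_mul (hp l) (hX1 l) (abs_nonneg _) hq
  have b4 : σ * |∑ m, F m * (p m * R m)| ≤ FF * (q * (C * q ^ 2)) := by
    rw [hFF, Finset.sum_mul]
    refine (mul_le_mul_of_nonneg_left (Finset.abs_sum_le_sum_abs _ _) hσ).trans ?_
    rw [Finset.mul_sum]
    refine Finset.sum_le_sum fun m _ => ?_
    rw [abs_mul, abs_mul, abs_of_nonneg (hF m)]
    have := mul_le_mul (hp m) (hY1 m) (by positivity) hq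
    calc σ * (F m * (|p m| * |R m|)) = F m * (|p m| * (σ * |R m|)) := by ring
      _ ≤ _ := mul_le_mul_of_nonneg_left this (hF m)
  have b5 : σ * |∑ m, p m * R m| ≤ n * (q * (C * q ^ 2)) := by
    refine (mul_le_mul_of_nonneg_left (Finset.abs_sum_le_sum_abs _ _) hσ).trans ?_
    rw [Finset.mul_sum]
    refine (Finset.sum_le_card_nsmul _ _ (q * (C * q ^ 2)) fun m _ => ?_).trans (by simp)
    rw [abs_mul]
    have := mul_le_mul (hp m) (hY1 m) (by positivity) hq
    linarith
  have c3 : -(σ ^ 2 * (2 * a * ∑ l, p l * R' l)) ≤ 2 * C * (n * (q * (C * FF * q ^ 2))) * σ ^ 2 := by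
    refine (neg_le_abs _).trans ?_
    rw [abs_mul, abs_mul, abs_mul, abs_of_nonneg (sq_nonneg σ), abs_two]
    have := mul_le_mul ha b3 (abs_nonneg _) hC
    nlinarith [sq_nonneg σ]
  have c4 : σ ^ 2 * (2 * a * ∑ m, F m * (p m * R m)) ≤ 2 * C * (FF * (q * (C * q ^ 2))) * σ := by
    refine (le_abs_self _).trans ?_
    rw [abs_mul, abs_mul, abs_mul, abs_of_nonneg (sq_nonneg σ), abs_two]
    have := mul_le_mul ha b4 (by positivity) hC
    nlinarith
  have c5 : σ ^ 2 * (2 * b * FF * ∑ m, p m * R m) ≤ 2 * C * FF * (n * (q * (C * q ^ 2))) * σ := by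
    refine (le_abs_self _).trans ?_
    rw [abs_mul, abs_mul, abs_mul, abs_mul, abs_of_nonneg (sq_nonneg σ), abs_two,
      abs_of_nonneg hFF0]
    have := mul_le_mul hb b5 (by positivity) hC
    have h6 : 0 ≤ 2 * FF * σ := by positivity
    nlinarith [mul_le_mul_of_nonneg_left this h6]
  have c2 := mul_le_mul_of_nonneg_left b2 (sq_nonneg σ)
  clear_value R R'
  generalize (∑ i, (F i + c * FF)
      * (∑ k ∈ s, q4 k i + a * ∑ l, (2 * h i l ^ 2 + 2 * (p l * t i l)))) = A at id b1
  generalize (∑ k ∈ s, ∑ m, F m * (q4 k m + c * ∑ j, q4 k j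
      + a * (2 * hE k m ^ 2 + 2 * (p m * te k m))
      + b * ∑ j, (2 * hE k j ^ 2 + 2 * (p j * te k j)))) = B at id c2
  generalize (a * ∑ m, F m * (∑ l, h m l ^ 2 - ∑ k ∈ s, hE k m ^ 2)
        + c * a * FF * ∑ m, ∑ l, h m l ^ 2 - b * FF * ∑ k ∈ s, ∑ l, hE k l ^ 2) = M at id ⊢
  have e : σ ^ 2 * (2 * M) = σ ^ 2 * A - σ ^ 2 * B - σ ^ 2 * (2 * a * ∑ l, p l * R' l)
      + σ ^ 2 * (2 * a * ∑ m, F m * (p m * R m)) + σ ^ 2 * (2 * b * FF * ∑ j, p j * R j) := by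
    linear_combination -σ ^ 2 * id
  rw [e]
  refine (add_le_add (add_le_add (add_le_add (sub_le_sub b1 c2) c3) c4) c5).trans
    (le_of_eq ?_) |>.trans' (le_of_eq (by ring))
  ring

end Cancellation

/-! ### The differential inequality at a maximum point -/

section MaximumPoint

variable {ι : Type*} {E : Type*} [NormedAddCommGroup E] [NormedSpace ℝ E] {n : ℕ}

theorem HasJet.sq {x X : E} {w : E → ℝ} {w₀ w₁ w₂ : ℝ} (h : HasJet w x X w₀ w₁ w₂) :
    HasJet (fun y => w y ^ 2) x X (w₀ ^ 2) (2 * (w₀ * w₁)) (2 * w₁ ^ 2 + 2 * (w₀ * w₂)) := by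
  have := h.mul h
  have e : (fun y => w y ^ 2) = fun y => w y * w y := by funext y; ring
  rw [e]
  convert this using 1 <;> ring

theorem BigW.exists_bound_fintype {q : ι → ℝ} (hq : ∀ i, 1 ≤ q i) {d : ℕ} {κ : Type*} [Fintype κ]
    {f : κ → ι → ℝ} (h : ∀ j, BigW q d (f j)) : ∃ C, 0 ≤ C ∧ ∀ j i, |f j i| ≤ C * q i ^ d := by
  choose C hC0 hC using fun j => (h j).exists_bound hq
  refine ⟨∑ j, C j, Finset.sum_nonneg fun j _ => hC0 j, fun j i => (hC j i).trans ?_⟩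
  exact mul_le_mul_of_nonneg_right
    (Finset.single_le_sum (f := C) (fun j _ => hC0 j) (Finset.mem_univ j))
    (pow_nonneg (zero_le_one.trans (hq i)) d)

theorem dirD_comm_three {v : E → ℝ} {x : E} (hv : ContDiffAt ℝ 4 v x) (X Y : E) :
    dirD Y (dirD X (dirD X v)) =ᶠ[𝓝 x] dirD X (dirD X (dirD Y v)) := by
  have h1 : ContDiffAt ℝ 2 (dirD X v) x :=
    (ContDiffAt.dirD (k := 3) hv X).of_le (by norm_num)
  exact (dirD_comm h1 Y X).trans ((dirD_comm (hv.of_le (by norm_num)) Y X).dirD X)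

theorem dirD_comm_four {v : E → ℝ} {x : E} (hv : ContDiffAt ℝ 4 v x) (X Y : E) :
    dirD Y (dirD Y (dirD X (dirD X v))) =ᶠ[𝓝 x] dirD X (dirD X (dirD Y (dirD Y v))) := by
  have h1 : ContDiffAt ℝ 3 (dirD Y v) x := ContDiffAt.dirD (k := 3) hv Y
  have h2 : ContDiffAt ℝ 2 (dirD X (dirD Y v)) x := ContDiffAt.dirD (k := 2) h1 X
  exact ((dirD_comm_three hv X Y).dirD Y).trans
    ((dirD_comm h2 Y X).trans ((dirD_comm (h1.of_le (by norm_num)) Y X).dirD X))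

set_option maxHeartbeats 1000000 in
/-- Suppose that the linearization of the operator at a point, minus the right-hand side, has a local
minimum there (`hΦ`), and that the test function, cut off by `ζ ^ 2`, has a local maximum (`hΨ`). Then
the leading quadratic terms in the second derivatives are controlled by terms of lower weight, where
first derivatives have weight one and second derivatives have weight two. -/
theorem exists_bound_at_maximum (s : Finset (Fin n)) {c : ℝ} (hc : 0 ≤ c) {e : Fin n → E}
    (he : ∀ m, ‖e m‖ ≤ 1) {X : ι → Fin n → E} (hX : ∀ i k, ‖X i k‖ ≤ 1) {v : ι → E → ℝ}
    (hv : ∀ i, ContDiffAt ℝ 4 (v i) 0) {q : ι → ℝ} (hq : ∀ i, 1 ≤ q i)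
    (hv1 : ∀ i m, |dirD (e m) (v i) 0| ≤ q i)
    (hvX : ∀ k, BigW q 2 fun i => dirD (X i k) (dirD (X i k) (v i)) 0)
    {α β : ι → ℝ} (hα : BigW q 0 α) (hβ : BigW q 0 β) {F : ι → Fin n → ℝ}
    (hF : ∀ i m, 0 ≤ F i m) (hF1 : ∀ i, 1 ≤ ∑ m, F i m) {rem : Fin n → ι → E → ℝ}
    (hrem : ∀ m, JetW q 2 2 3 (rem m)) {f : ι → E → ℝ} (hf : JetW q 2 2 3 f)
    (hΦ : ∀ i, IsLocalMin (fun y => ∑ m, F i m * (dirD (e m) (dirD (e m) (v i)) y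
      + c * ∑ l, dirD (e l) (dirD (e l) (v i)) y + α i * dirD (e m) (v i) y ^ 2
      + β i * ∑ l, dirD (e l) (v i) y ^ 2 + rem m i y) - f i y) 0)
    {rem' : ι → E → ℝ} (hrem' : JetW q 2 2 3 rem') {ζ : ι → E → ℝ} (hζ : JetW q 0 0 0 ζ)
    (hζ0 : ∀ i, 0 < ζ i 0) (hζ1 : ∀ i, ζ i 0 ≤ 1)
    (hΨ : ∀ i, IsLocalMax (fun y => ζ i y ^ 2 * (∑ k ∈ s, dirD (X i k) (dirD (X i k) (v i)) y
      + α i * ∑ l, dirD (e l) (v i) y ^ 2 + rem' i y)) 0) :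
    ∃ C, 0 ≤ C ∧ ∀ i, ζ i 0 ^ 2 * (2 * (α i * ∑ m, F i m *
          (∑ l, dirD (e l) (dirD (e m) (v i)) 0 ^ 2
            - ∑ k ∈ s, dirD (X i k) (dirD (e m) (v i)) 0 ^ 2)
        + c * α i * (∑ m, F i m) * ∑ m, ∑ l, dirD (e l) (dirD (e m) (v i)) 0 ^ 2
        - β i * (∑ m, F i m) * ∑ k ∈ s, ∑ l, dirD (X i k) (dirD (e l) (v i)) 0 ^ 2))
      ≤ (∑ m, F i m) * (C * (ζ i 0 ^ 2 * q i ^ 3 + ζ i 0 * q i ^ 3 + q i ^ 2)) := by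
  have hv1W : ∀ m, BigW q 1 fun i => dirD (e m) (v i) 0 := fun m =>
    BigW.of_bound 1 fun i => by
      rw [pow_one, one_mul]; exact (hv1 i m).trans (le_abs_self _)
  -- regularity of the derivatives of `v`
  have cd1 : ∀ i Y, ContDiffAt ℝ 2 (dirD Y (v i)) 0 := fun i Y =>
    (ContDiffAt.dirD (k := 3) (hv i) Y).of_le (by norm_num)
  have cd2 : ∀ i Y Z, ContDiffAt ℝ 2 (dirD Z (dirD Y (v i))) 0 := fun i Y Z =>
    ContDiffAt.dirD (k := 2) (ContDiffAt.dirD (k := 3) (hv i) Y) Z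
  -- jets of the two functions
  have jΦ : ∀ i Y, HasJet (fun y => ∑ m, F i m * (dirD (e m) (dirD (e m) (v i)) y
      + c * ∑ l, dirD (e l) (dirD (e l) (v i)) y + α i * dirD (e m) (v i) y ^ 2
      + β i * ∑ l, dirD (e l) (v i) y ^ 2 + rem m i y) - f i y) 0 Y _ _ _ := fun i Y =>
    (HasJet.sum Finset.univ fun m _ => (((((HasJet.self (X := Y) (cd2 i (e m) (e m))).add
      ((HasJet.sum Finset.univ fun l _ => HasJet.self (X := Y) (cd2 i (e l) (e l))).const_mul
        c)).add ((HasJet.self (X := Y) (cd1 i (e m))).sq.const_mul (α i))).add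
      ((HasJet.sum Finset.univ fun l _ => (HasJet.self (X := Y) (cd1 i (e l))).sq).const_mul
        (β i))).add ((hrem m).hasJet i Y)).const_mul (F i m)).sub (hf.hasJet i Y)
  have jL : ∀ i Y, HasJet (fun y => ∑ k ∈ s, dirD (X i k) (dirD (X i k) (v i)) y
      + α i * ∑ l, dirD (e l) (v i) y ^ 2 + rem' i y) 0 Y _ _ _ := fun i Y =>
    ((HasJet.sum s fun k _ => HasJet.self (X := Y) (cd2 i (X i k) (X i k))).add
      ((HasJet.sum Finset.univ fun l _ => (HasJet.self (X := Y) (cd1 i (e l))).sq).const_mul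
        (α i))).add (hrem'.hasJet i Y)
  have jΨ := fun i Y => ((hζ.hasJet i Y).sq.mul (jL i Y))
  -- uniform constants
  obtain ⟨Ca, hCa0, hCa⟩ := hα.exists_bound hq
  obtain ⟨Cb, hCb0, hCb⟩ := hβ.exists_bound hq
  obtain ⟨Cr1, hCr10, hCr1⟩ := BigW.exists_bound_fintype hq
    (f := fun (ml : Fin n × Fin n) i => dirD (e ml.2) (rem ml.1 i) 0)
    fun ml => (hrem ml.1).d1 (fun _ => e ml.2) fun _ => he _
  obtain ⟨Cr2, hCr20, hCr2⟩ := BigW.exists_bound_fintype hq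
    (f := fun (mk : Fin n × Fin n) i => dirD (X i mk.2) (dirD (X i mk.2) (rem mk.1 i)) 0)
    fun mk => (hrem mk.1).d2 (fun i => X i mk.2) fun i => hX i _
  obtain ⟨Cf1, hCf10, hCf1⟩ := BigW.exists_bound_fintype hq
    (f := fun (l : Fin n) i => dirD (e l) (f i) 0) fun l => hf.d1 (fun _ => e l) fun _ => he _
  obtain ⟨Cf2, hCf20, hCf2⟩ := BigW.exists_bound_fintype hq
    (f := fun (k : Fin n) i => dirD (X i k) (dirD (X i k) (f i)) 0)
    fun k => hf.d2 (fun i => X i k) fun i => hX i _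
  obtain ⟨Cs1, hCs10, hCs1⟩ := BigW.exists_bound_fintype hq
    (f := fun (l : Fin n) i => dirD (e l) (rem' i) 0) fun l => hrem'.d1 (fun _ => e l) fun _ => he _
  obtain ⟨Cs2, hCs20, hCs2⟩ := BigW.exists_bound_fintype hq
    (f := fun (l : Fin n) i => dirD (e l) (dirD (e l) (rem' i)) 0)
    fun l => hrem'.d2 (fun _ => e l) fun _ => he _
  obtain ⟨Cz1, hCz10, hCz1⟩ := BigW.exists_bound_fintype hq
    (f := fun (l : Fin n) i => dirD (e l) (ζ i) 0) fun l => hζ.d1 (fun _ => e l) fun _ => he _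
  obtain ⟨Cz2, hCz20, hCz2⟩ := BigW.exists_bound_fintype hq
    (f := fun (l : Fin n) i => dirD (e l) (dirD (e l) (ζ i)) 0)
    fun l => hζ.d2 (fun _ => e l) fun _ => he _
  obtain ⟨CL, hCL0, hCL⟩ : ∃ C, 0 ≤ C ∧ ∀ i, |∑ k ∈ s, dirD (X i k) (dirD (X i k) (v i)) 0
      + α i * ∑ l, dirD (e l) (v i) 0 ^ 2 + rem' i 0| ≤ C * q i ^ 2 := by
    refine BigW.exists_bound hq (((BigW.sum s fun k _ => hvX k).add
      ((hα.mul (BigW.sum Finset.univ fun l _ => ?_)).mono hq (le_of_eq (zero_add 2)))).add hrem'.val)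
    simpa [sq] using (hv1W l).mul (hv1W l)
  simp only [pow_zero, mul_one] at hCa hCb hCz1 hCz2
  set C := Ca + Cb + (Cr1 + Cf1) + (Cr2 + Cf2) + (2 * Cz1 * CL + Cs1)
    + (6 * Cz1 ^ 2 * CL + 2 * Cz2 * CL + Cs2) with hCdef
  have hC0 : 0 ≤ C := by positivity
  refine ⟨(1 + n * c) * C + n * C + 2 * n * C ^ 2 + (1 + n * c) * C + (2 + 2 * n) * C ^ 2,
    by positivity, fun i => ?_⟩
  set FF := ∑ m, F i m with hFF
  have hFF0 : 0 ≤ FF := zero_le_one.trans (hF1 i)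
  have hqi : 0 ≤ q i := zero_le_one.trans (hq i)
  set σ := ζ i 0 with hσdef
  have hσ0 : 0 < σ := hζ0 i
  have hσ1 : σ ≤ 1 := hζ1 i
  set L := ∑ k ∈ s, dirD (X i k) (dirD (X i k) (v i)) 0
      + α i * ∑ l, dirD (e l) (v i) 0 ^ 2 + rem' i 0 with hL
  have q2 : 0 ≤ q i ^ 2 := by positivity
  have q3 : 0 ≤ q i ^ 3 := by positivity
  -- critical point equation
  have crit : ∀ m, σ * (∑ k ∈ s, dirD (X i k) (dirD (X i k) (dirD (e m) (v i))) 0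
      + 2 * α i * ∑ l, dirD (e l) (v i) 0 * dirD (e m) (dirD (e l) (v i)) 0
      + dirD (e m) (rem' i) 0) = - 2 * dirD (e m) (ζ i) 0 * L := by
    intro m
    have h1 := ((jΨ i (e m)).of_isLocalMax (hΨ i)).1
    rw [← hL, ← hσdef] at h1
    have h2 : ∑ k ∈ s, dirD (e m) (dirD (X i k) (dirD (X i k) (v i))) 0
        = ∑ k ∈ s, dirD (X i k) (dirD (X i k) (dirD (e m) (v i))) 0 :=
      Finset.sum_congr rfl fun k _ => (dirD_comm_three (hv i) (X i k) (e m)).eq_of_nhds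
    rw [h2, ← Finset.mul_sum] at h1
    have h3 : σ * (σ * (∑ k ∈ s, dirD (X i k) (dirD (X i k) (dirD (e m) (v i))) 0
      + 2 * α i * ∑ l, dirD (e l) (v i) 0 * dirD (e m) (dirD (e l) (v i)) 0
      + dirD (e m) (rem' i) 0)) = σ * (- 2 * dirD (e m) (ζ i) 0 * L) := by
      linear_combination h1
    exact mul_left_cancel₀ hσ0.ne' h3
  have key := linearized_inequality s (F i) (fun m => dirD (e m) (v i) 0) FF c (α i) (β i) C (q i) σ
    hFF (hF i) hc hC0 hqi hσ0.le
    (fun m l => dirD (e l) (dirD (e m) (v i)) 0)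
    (fun m l => dirD (e l) (dirD (e m) (dirD (e m) (v i))) 0)
    (fun k m => dirD (X i k) (dirD (e m) (v i)) 0)
    (fun k m => dirD (X i k) (dirD (X i k) (dirD (e m) (v i))) 0)
    (fun k m => dirD (X i k) (dirD (X i k) (dirD (e m) (dirD (e m) (v i)))) 0)
    (fun m l => (dirD_comm ((hv i).of_le (by norm_num)) (e l) (e m)).eq_of_nhds)
    ((hCa i).trans (by rw [hCdef]; linarith [show 0 ≤ 2 * Cz1 * CL by positivity,
      show 0 ≤ 6 * Cz1 ^ 2 * CL by positivity, show 0 ≤ 2 * Cz2 * CL by positivity]))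
    ((hCb i).trans (by rw [hCdef]; linarith [show 0 ≤ 2 * Cz1 * CL by positivity,
      show 0 ≤ 6 * Cz1 ^ 2 * CL by positivity, show 0 ≤ 2 * Cz2 * CL by positivity]))
    (hv1 i) ?_ ?_ ?_ ?_
  · refine key.trans (mul_le_mul_of_nonneg_left ?_ hFF0)
    have s1 : 0 ≤ σ ^ 2 * q i ^ 3 := by positivity
    have s2 : 0 ≤ σ * q i ^ 3 := by positivity
    have k1 : 0 ≤ (1 + n * c) * C := by positivity
    have k2 : 0 ≤ n * C + 2 * n * C ^ 2 := by positivity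
    have k3 : 0 ≤ (2 + 2 * n) * C ^ 2 := by positivity
    have t1 := mul_nonneg (add_nonneg k1 k3) s1
    have t2 := mul_nonneg (add_nonneg (add_nonneg (add_nonneg k1 k2) k1) le_rfl) s2
    have t3 := mul_nonneg (add_nonneg (add_nonneg k1 k2) k3) q2
    linarith
  · -- the differentiated equation
    intro l
    have h1 := ((jΦ i (e l)).of_isLocalMin (hΦ i)).1
    have h2 : ∑ m, F i m * (dirD (e l) (dirD (e m) (dirD (e m) (v i))) 0
        + c * ∑ j, dirD (e l) (dirD (e j) (dirD (e j) (v i))) 0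
        + 2 * α i * (dirD (e m) (v i) 0 * dirD (e l) (dirD (e m) (v i)) 0)
        + 2 * β i * ∑ j, dirD (e j) (v i) 0 * dirD (e l) (dirD (e j) (v i)) 0)
        = dirD (e l) (f i) 0 - ∑ m, F i m * dirD (e l) (rem m i) 0 := by
      have h3 : dirD (e l) (f i) 0 = ∑ m, F i m * (dirD (e l) (dirD (e m) (dirD (e m) (v i))) 0
        + c * ∑ j, dirD (e l) (dirD (e j) (dirD (e j) (v i))) 0
        + 2 * α i * (dirD (e m) (v i) 0 * dirD (e l) (dirD (e m) (v i)) 0)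
        + 2 * β i * ∑ j, dirD (e j) (v i) 0 * dirD (e l) (dirD (e j) (v i)) 0)
        + ∑ m, F i m * dirD (e l) (rem m i) 0 := by
        rw [← Finset.sum_add_distrib]
        refine (sub_eq_zero.1 h1).symm.trans (Finset.sum_congr rfl fun m _ => ?_)
        rw [← Finset.mul_sum]
        ring
      rw [h3]; ring
    rw [h2]
    have h4 : |∑ m, F i m * dirD (e l) (rem m i) 0| ≤ FF * (Cr1 * q i ^ 2) := by
      refine (Finset.abs_sum_le_sum_abs _ _).trans ?_
      rw [hFF, Finset.sum_mul]
      refine Finset.sum_le_sum fun m _ => ?_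
      rw [abs_mul, abs_of_nonneg (hF i m)]
      exact mul_le_mul_of_nonneg_left (hCr1 (m, l) i) (hF i m)
    have h5 : |dirD (e l) (f i) 0| ≤ FF * (Cf1 * q i ^ 2) :=
      (hCf1 l i).trans (le_mul_of_one_le_left (by positivity) (hF1 i))
    have h6 : Cr1 + Cf1 ≤ C := by
      rw [hCdef]; linarith [show 0 ≤ 2 * Cz1 * CL by positivity,
        show 0 ≤ 6 * Cz1 ^ 2 * CL by positivity, show 0 ≤ 2 * Cz2 * CL by positivity]
    calc _ ≤ _ := abs_sub _ _
      _ ≤ FF * (Cf1 * q i ^ 2) + FF * (Cr1 * q i ^ 2) := add_le_add h5 h4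
      _ = (Cr1 + Cf1) * (FF * q i ^ 2) := by ring
      _ ≤ C * (FF * q i ^ 2) := mul_le_mul_of_nonneg_right h6 (by positivity)
      _ = _ := by ring
  · -- the equation differentiated twice
    intro k _
    have h1 := ((jΦ i (X i k)).of_isLocalMin (hΦ i)).2
    have h2 : ∑ m, F i m * (dirD (X i k) (dirD (X i k) (dirD (e m) (dirD (e m) (v i)))) 0
        + c * ∑ j, dirD (X i k) (dirD (X i k) (dirD (e j) (dirD (e j) (v i)))) 0
        + α i * (2 * dirD (X i k) (dirD (e m) (v i)) 0 ^ 2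
          + 2 * (dirD (e m) (v i) 0 * dirD (X i k) (dirD (X i k) (dirD (e m) (v i))) 0))
        + β i * ∑ j, (2 * dirD (X i k) (dirD (e j) (v i)) 0 ^ 2
          + 2 * (dirD (e j) (v i) 0 * dirD (X i k) (dirD (X i k) (dirD (e j) (v i))) 0)))
        + ∑ m, F i m * dirD (X i k) (dirD (X i k) (rem m i)) 0
        - dirD (X i k) (dirD (X i k) (f i)) 0 ≥ 0 := by
      rw [← Finset.sum_add_distrib]
      refine h1.trans (le_of_eq (congrArg₂ _ (Finset.sum_congr rfl fun m _ => ?_) rfl))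
      ring
    have h4 : |∑ m, F i m * dirD (X i k) (dirD (X i k) (rem m i)) 0| ≤ FF * (Cr2 * q i ^ 3) := by
      refine (Finset.abs_sum_le_sum_abs _ _).trans ?_
      rw [hFF, Finset.sum_mul]
      refine Finset.sum_le_sum fun m _ => ?_
      rw [abs_mul, abs_of_nonneg (hF i m)]
      exact mul_le_mul_of_nonneg_left (hCr2 (m, k) i) (hF i m)
    have h5 : |dirD (X i k) (dirD (X i k) (f i)) 0| ≤ FF * (Cf2 * q i ^ 3) :=
      (hCf2 k i).trans (le_mul_of_one_le_left (by positivity) (hF1 i))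
    have h6 : Cr2 + Cf2 ≤ C := by
      rw [hCdef]; linarith [show 0 ≤ 2 * Cz1 * CL by positivity,
        show 0 ≤ 6 * Cz1 ^ 2 * CL by positivity, show 0 ≤ 2 * Cz2 * CL by positivity]
    have h7 : (Cr2 + Cf2) * (FF * q i ^ 3) ≤ C * (FF * q i ^ 3) :=
      mul_le_mul_of_nonneg_right h6 (by positivity)
    have h8 := neg_abs_le (dirD (X i k) (dirD (X i k) (f i)) 0)
    have h9 := le_abs_self (∑ m, F i m * dirD (X i k) (dirD (X i k) (rem m i)) 0)
    linarith
  · -- the critical point equation, up to the remainder and the cutoff function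
    intro m
    have h1 := crit m
    have h2 : σ * (∑ k ∈ s, dirD (X i k) (dirD (X i k) (dirD (e m) (v i))) 0
      + 2 * α i * ∑ l, dirD (e l) (v i) 0 * dirD (e m) (dirD (e l) (v i)) 0)
      = - 2 * dirD (e m) (ζ i) 0 * L - σ * dirD (e m) (rem' i) 0 := by linear_combination h1
    have h0 : ∀ z : ℝ, σ * |z| = |σ * z| := fun z => by rw [abs_mul, abs_of_pos hσ0]
    rw [h0, h2]
    have h3 : |-2 * dirD (e m) (ζ i) 0 * L| ≤ 2 * Cz1 * (CL * q i ^ 2) := by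
      rw [abs_mul, abs_mul, abs_neg, abs_two]
      exact mul_le_mul (mul_le_mul_of_nonneg_left (hCz1 m i) (by norm_num)) (hCL i)
        (abs_nonneg _) (by positivity)
    have h4 : |σ * dirD (e m) (rem' i) 0| ≤ Cs1 * q i ^ 2 := by
      rw [abs_mul, abs_of_pos hσ0]
      exact (mul_le_of_le_one_left (abs_nonneg _) hσ1).trans (hCs1 m i)
    have h6 : 2 * Cz1 * CL + Cs1 ≤ C := by
      rw [hCdef]; linarith [show 0 ≤ 6 * Cz1 ^ 2 * CL by positivity,
        show 0 ≤ 2 * Cz2 * CL by positivity]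
    have h7 := mul_le_mul_of_nonneg_right h6 q2
    have := abs_sub (-2 * dirD (e m) (ζ i) 0 * L) (σ * dirD (e m) (rem' i) 0)
    linarith
  · -- the second derivatives of the cut off test function
    intro m
    have h1 := ((jΨ i (e m)).of_isLocalMax (hΨ i)).2
    rw [← hL, ← hσdef] at h1
    have h2 : ∑ k ∈ s, dirD (e m) (dirD (X i k) (dirD (X i k) (v i))) 0
        = ∑ k ∈ s, dirD (X i k) (dirD (X i k) (dirD (e m) (v i))) 0 :=
      Finset.sum_congr rfl fun k _ => (dirD_comm_three (hv i) (X i k) (e m)).eq_of_nhds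
    have h3 : ∑ k ∈ s, dirD (e m) (dirD (e m) (dirD (X i k) (dirD (X i k) (v i)))) 0
        = ∑ k ∈ s, dirD (X i k) (dirD (X i k) (dirD (e m) (dirD (e m) (v i)))) 0 :=
      Finset.sum_congr rfl fun k _ => (dirD_comm_four (hv i) (X i k) (e m)).eq_of_nhds
    have h4 : ∑ l, (2 * dirD (e m) (dirD (e l) (v i)) 0 ^ 2
          + 2 * (dirD (e l) (v i) 0 * dirD (e m) (dirD (e m) (dirD (e l) (v i))) 0))
        = ∑ l, (2 * dirD (e l) (dirD (e m) (v i)) 0 ^ 2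
          + 2 * (dirD (e l) (v i) 0 * dirD (e l) (dirD (e m) (dirD (e m) (v i))) 0)) := by
      refine Finset.sum_congr rfl fun l _ => ?_
      rw [(dirD_comm ((hv i).of_le (by norm_num)) (e m) (e l)).eq_of_nhds,
        (dirD_comm_three (hv i) (e m) (e l)).eq_of_nhds]
    rw [h2, h3, h4, ← Finset.mul_sum] at h1
    have h5 := crit m
    set Z := ∑ k ∈ s, dirD (X i k) (dirD (X i k) (dirD (e m) (dirD (e m) (v i)))) 0
      + α i * ∑ l, (2 * dirD (e l) (dirD (e m) (v i)) 0 ^ 2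
          + 2 * (dirD (e l) (v i) 0 * dirD (e l) (dirD (e m) (dirD (e m) (v i))) 0)) with hZ
    set L1 := ∑ k ∈ s, dirD (X i k) (dirD (X i k) (dirD (e m) (v i))) 0
      + 2 * α i * ∑ l, dirD (e l) (v i) 0 * dirD (e m) (dirD (e l) (v i)) 0
      + dirD (e m) (rem' i) 0 with hL1
    set z1 := dirD (e m) (ζ i) 0 with hz1
    set z2 := dirD (e m) (dirD (e m) (ζ i)) 0 with hz2
    -- the gradient of the test function is eliminated by the critical point equation
    have h6 : σ ^ 2 * Z ≤ 6 * z1 ^ 2 * L - 2 * σ * z2 * L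
        - σ ^ 2 * dirD (e m) (dirD (e m) (rem' i)) 0 := by
      have : 2 * (2 * (σ * z1) * L1) = -8 * z1 ^ 2 * L := by
        linear_combination 4 * z1 * h5
      have h7 : (2 * z1 ^ 2 + 2 * (σ * z2)) * L + 2 * (2 * (σ * z1) * L1)
          + σ ^ 2 * (Z + dirD (e m) (dirD (e m) (rem' i)) 0) ≤ 0 := by
        refine le_trans (le_of_eq ?_) h1
        rw [hL1]; ring
      linarith
    have b1 : 6 * z1 ^ 2 * L ≤ 6 * Cz1 ^ 2 * (CL * q i ^ 2) := by
      have : z1 ^ 2 ≤ Cz1 ^ 2 := sq_le_sq' (by linarith [(abs_le.1 (hCz1 m i)).1])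
        (abs_le.1 (hCz1 m i)).2
      calc 6 * z1 ^ 2 * L ≤ 6 * z1 ^ 2 * |L| :=
            mul_le_mul_of_nonneg_left (le_abs_self _) (by positivity)
        _ ≤ _ := mul_le_mul (by linarith) (hCL i) (abs_nonneg _) (by positivity)
    have b2 : -(2 * σ * z2 * L) ≤ 2 * Cz2 * (CL * q i ^ 2) := by
      refine (neg_le_abs _).trans ?_
      rw [abs_mul, abs_mul, abs_mul, abs_two, abs_of_pos hσ0]
      refine mul_le_mul ?_ (hCL i) (abs_nonneg _) (by positivity)
      have := mul_le_mul hσ1 (hCz2 m i) (abs_nonneg _) zero_le_one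
      linarith
    have b3 : -(σ ^ 2 * dirD (e m) (dirD (e m) (rem' i)) 0) ≤ Cs2 * (σ ^ 2 * q i ^ 3) := by
      refine (neg_le_abs _).trans ?_
      rw [abs_mul, abs_of_nonneg (sq_nonneg σ)]
      have := mul_le_mul_of_nonneg_left (hCs2 m i) (sq_nonneg σ)
      linarith
    have g1 : 6 * Cz1 ^ 2 * CL + 2 * Cz2 * CL ≤ C := by
      rw [hCdef]; linarith [show 0 ≤ 2 * Cz1 * CL by positivity]
    have g2 : Cs2 ≤ C := by
      rw [hCdef]; linarith [show 0 ≤ 2 * Cz1 * CL by positivity,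
        show 0 ≤ 6 * Cz1 ^ 2 * CL by positivity, show 0 ≤ 2 * Cz2 * CL by positivity]
    have g3 := mul_le_mul_of_nonneg_right g1 q2
    have g4 : Cs2 * (σ ^ 2 * q i ^ 3) ≤ C * (σ ^ 2 * q i ^ 3) :=
      mul_le_mul_of_nonneg_right g2 (by positivity)
    linarith

end MaximumPoint

/-! ### Pointwise consequences of the cone conditions -/

section Pointwise

variable {n : ℕ}

/-- In an orthonormal frame that diagonalizes `W`, the components `p` of the gradient, `h` of the
Hessian and `S` of the given tensor determine the eigenvalues `lam` of
`W = h + c (tr h) g + a p ⊗ p + b |p|² g + S`. -/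
structure IsDiagonalized (c a b : ℝ) (p : Fin n → ℝ) (h S : Fin n → Fin n → ℝ)
    (lam : Fin n → ℝ) : Prop where
  diag : ∀ m, h m m + c * ∑ l, h l l + a * p m ^ 2 + b * ∑ l, p l ^ 2 + S m m = lam m
  off_diag : ∀ m l, m ≠ l → h m l + a * p m * p l + S m l = 0

theorem IsDiagonalized.sum {c a b : ℝ} {p : Fin n → ℝ} {h S : Fin n → Fin n → ℝ}
    {lam : Fin n → ℝ} (H : IsDiagonalized c a b p h S lam) :
    ∑ m, lam m = (1 + n * c) * ∑ l, h l l + (a + n * b) * ∑ l, p l ^ 2 + ∑ m, S m m := by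
  simp only [← H.diag, Finset.sum_add_distrib, Finset.sum_const, Finset.card_univ,
    Fintype.card_fin, nsmul_eq_mul, ← Finset.mul_sum]
  ring

theorem sigmaK_one (lam : Fin n → ℝ) : sigmaK 1 lam = ∑ i, lam i := by
  simp [sigmaK, Finset.powersetCard_one]

theorem sum_pos_of_mem_gammaCone {k : ℕ} (hk : 1 ≤ k) {lam : Fin n → ℝ}
    (h : lam ∈ gammaCone n k) : 0 < ∑ i, lam i := by
  rw [← sigmaK_one]; exact h 1 le_rfl hk

theorem sq_sum_eq (s : Finset (Fin n)) (lam : Fin n → ℝ) :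
    (∑ j ∈ s, lam j) ^ 2
      = ∑ j ∈ s, lam j ^ 2 + 2 * ∑ t ∈ s.powersetCard 2, ∏ i ∈ t, lam i := by
  induction s using Finset.induction_on with
  | empty => rw [Finset.powersetCard_eq_empty.2 (by simp)]; simp
  | insert j s hj ih =>
    have hdisj : Disjoint (s.powersetCard 2) ((s.powersetCard 1).image (insert j)) := by
      rw [Finset.disjoint_left]
      intro t ht ht'
      obtain ⟨t', -, rfl⟩ := Finset.mem_image.1 ht'
      exact hj ((Finset.mem_powersetCard.1 ht).1 (Finset.mem_insert_self _ _))
    have hsum : ∑ t ∈ (s.powersetCard 1).image (insert j), ∏ i ∈ t, lam i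
        = lam j * ∑ i ∈ s, lam i := by
      rw [Finset.sum_image, Finset.powersetCard_one, Finset.sum_map, Finset.mul_sum]
      · refine Finset.sum_congr rfl fun i hi => ?_
        have : j ∉ ({i} : Finset (Fin n)) := by
          rw [Finset.mem_singleton]; rintro rfl; exact hj hi
        change ∏ i ∈ insert j {i}, lam i = _
        rw [Finset.prod_insert this, Finset.prod_singleton]
      · intro t ht t' ht' htt
        have h1 : j ∉ t := fun h => hj ((Finset.mem_powersetCard.1 ht).1 h)
        have h2 : j ∉ t' := fun h => hj ((Finset.mem_powersetCard.1 ht').1 h)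
        rw [← Finset.erase_insert h1, ← Finset.erase_insert h2]
        exact congrArg (fun u => u.erase j) htt
    rw [Finset.powersetCard_succ_insert hj, Finset.sum_union hdisj, hsum,
      Finset.sum_insert hj, Finset.sum_insert hj]
    linear_combination ih

/-- In the cone `Γ₂` every eigenvalue is bounded by the trace. -/
theorem abs_le_sum_of_mem_gammaCone {lam : Fin n → ℝ} (h : lam ∈ gammaCone n 2) (i : Fin n) :
    |lam i| ≤ ∑ j, lam j := by
  have h1 := sum_pos_of_mem_gammaCone (k := 2) (by norm_num) h
  have h2 : 0 < sigmaK 2 lam := h 2 (by norm_num) le_rfl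
  have h3 : (∑ j, lam j) ^ 2 = ∑ j, lam j ^ 2 + 2 * sigmaK 2 lam := sq_sum_eq _ lam
  have h4 : lam i ^ 2 ≤ ∑ j, lam j ^ 2 :=
    Finset.single_le_sum (f := fun j => lam j ^ 2) (fun j _ => sq_nonneg _) (Finset.mem_univ i)
  exact abs_le_of_sq_le_sq (by linarith) h1.le

theorem abs_sum_diag_le {S : Fin n → Fin n → ℝ} {N : ℝ} (hS : ∀ m l, |S m l| ≤ N) :
    |∑ m, S m m| ≤ n * N :=
  (Finset.abs_sum_le_sum_abs _ _).trans
    ((Finset.sum_le_card_nsmul _ _ N fun m _ => hS m m).trans (by simp))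

/-- In case (a), the gradient is controlled by the Hessian: where `b > 0` because `F` is
monotone and bounded from above, and where `b < 0` because the trace of `W` is positive. -/
theorem exists_gradient_le_hessian (n : ℕ) (c δ₁ δ₂ N : ℝ) (hc : 0 ≤ c) (hδ₁ : 0 < δ₁)
    (hδ₂ : 0 < δ₂) : ∃ C, 0 ≤ C ∧ ∀ (a b : ℝ) (p : Fin n → ℝ) (h S : Fin n → Fin n → ℝ)
      (lam : Fin n → ℝ) (κ : ℝ), IsDiagonalized c a b p h S lam → 0 ≤ κ →
      (∀ m l, |S m l| ≤ N) → (∀ m l, |h m l| ≤ κ) → 0 < ∑ m, lam m →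
      (∀ μ, 0 ≤ μ → (∀ m, μ ≤ lam m) → μ ≤ N) → δ₁ ≤ c * a - b →
      δ₂ ≤ min (2 * a * b + b ^ 2) (b ^ 2) → ∑ l, p l ^ 2 ≤ C * (1 + κ) := by
  rcases Nat.eq_zero_or_pos n with rfl | hn
  · exact ⟨0, le_rfl, fun a b p h S lam κ _ _ _ _ _ _ _ _ => by simp⟩
  have hn1 : (1 : ℝ) ≤ n := by exact_mod_cast hn
  set d := Real.sqrt δ₂ with hd
  have hd0 : 0 < d := Real.sqrt_pos.2 hδ₂
  have hd2 : d ^ 2 = δ₂ := Real.sq_sqrt hδ₂.le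
  refine ⟨((1 + n * c) * n + 2 * n * |N|) / d, by positivity, ?_⟩
  intro a b p h S lam κ H hκ hS hh hpos hF h1 h2
  have h2a := h2.trans (min_le_left _ _)
  have h2b := h2.trans (min_le_right _ _)
  have hP : 0 ≤ ∑ l, p l ^ 2 := Finset.sum_nonneg fun _ _ => sq_nonneg _
  have htr : |∑ l, h l l| ≤ n * κ := abs_sum_diag_le hh
  have hN : 0 ≤ N := (abs_nonneg _).trans (hS ⟨0, hn⟩ ⟨0, hn⟩)
  rw [abs_of_nonneg hN, div_mul_eq_mul_div, le_div_iff₀ hd0]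
  suffices d * ∑ l, p l ^ 2 ≤ (1 + n * c) * n * κ + 2 * n * N by
    have e1 : 0 ≤ (1 + n * c) * n := by positivity
    have e2 : 0 ≤ 2 * n * N * κ := by positivity
    linarith
  have hnc : 0 ≤ n * c := by positivity
  rcases lt_or_ge 0 b with hb | hb
  -- `b > 0`: all eigenvalues are at least `b |p|²` up to `O(1 + κ)`, but one of them is at most `N`
  · have hbd : d ≤ b := Real.sqrt_le_iff.2 ⟨hb.le, h2b⟩
    have ha : 0 < a := by
      by_contra hneg
      push Not at hneg
      have := mul_nonpos_of_nonneg_of_nonpos hc hneg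
      linarith
    have hlam : ∀ m, d * ∑ l, p l ^ 2 - ((1 + n * c) * κ + N) ≤ lam m := by
      intro m
      rw [← H.diag m]
      have g1 := neg_le_of_abs_le (hh m m)
      have g2 := neg_le_of_abs_le (hS m m)
      have g3 := mul_le_mul_of_nonneg_left (neg_le_of_abs_le htr) hc
      have g4 : 0 ≤ a * p m ^ 2 := by positivity
      have g5 := mul_le_mul_of_nonneg_right hbd hP
      linarith
    have g6 : (1 + n * c) * κ ≤ (1 + n * c) * n * κ := by
      have : 0 ≤ (1 + n * c) * κ := by positivity
      nlinarith
    have g7 : N ≤ n * N := le_mul_of_one_le_left hN hn1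
    by_contra hcon
    push Not at hcon
    have := hF _ (by linarith) hlam
    linarith
  -- `b < 0`: then `2a + b < 0`, hence `a + nb ≤ -d`, and the trace of `W` could not be positive
  · have hb0 : b < 0 := lt_of_le_of_ne hb fun h0 => by rw [h0] at h2b; norm_num at h2b; linarith
    have hbd : d ≤ -b := Real.sqrt_le_iff.2 ⟨by linarith, by simpa using h2b⟩
    have ha : 2 * a + b < 0 := by
      by_contra hneg
      push Not at hneg
      nlinarith [mul_nonpos_of_nonneg_of_nonpos hneg hb]
    have hab : a + n * b ≤ -d := by nlinarith
    rw [H.sum] at hpos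
    have g1 := mul_le_mul_of_nonneg_right hab hP
    have g2 := mul_le_mul_of_nonneg_left (le_of_abs_le htr) (by positivity : 0 ≤ 1 + n * c)
    have g3 := le_of_abs_le (abs_sum_diag_le hS)
    have g4 : 0 ≤ n * N := by positivity
    linarith

/-- In case (a), an upper bound for `tr h + a |p|²` bounds the gradient and the Hessian. -/
theorem exists_bound_of_trace_le (n : ℕ) (c δ₁ N K : ℝ) (hc : 0 ≤ c) (hδ₁ : 0 < δ₁) :
    ∃ C, 0 ≤ C ∧ ∀ (a b : ℝ) (p : Fin n → ℝ) (h S : Fin n → Fin n → ℝ)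
      (lam : Fin n → ℝ), IsDiagonalized c a b p h S lam → |a| ≤ N → |b| ≤ N →
      (∀ m l, |S m l| ≤ N) → lam ∈ gammaCone n 2 → δ₁ ≤ c * a - b →
      ∑ l, h l l + a * ∑ l, p l ^ 2 ≤ K → ∑ l, p l ^ 2 ≤ C ∧ ∀ m l, |h m l| ≤ C := by
  rcases Nat.eq_zero_or_pos n with rfl | hn
  · exact ⟨0, le_rfl, fun a b p h S lam _ _ _ _ _ _ _ => ⟨by simp, fun m => m.elim0⟩⟩
  have hn1 : (1 : ℝ) ≤ n := by exact_mod_cast hn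
  have hn0 : (0 : ℝ) < n := by linarith
  set T := (1 + n * c) * |K| + n * |N| with hT
  have hT0 : 0 ≤ T := by positivity
  set G := T / (n * δ₁) with hG
  have hG0 : 0 ≤ G := by positivity
  set R := T + (1 + n) * |N| * G + n * |N| with hR
  have hR0 : 0 ≤ R := by positivity
  refine ⟨G + (T + c * R + 2 * |N| * G + |N|), by positivity, ?_⟩
  intro a b p h S lam H ha hb hS hlam h1 hK
  have hP : 0 ≤ ∑ l, p l ^ 2 := Finset.sum_nonneg fun _ _ => sq_nonneg _
  have hN : 0 ≤ N := (abs_nonneg _).trans ha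
  rw [abs_of_nonneg hN] at hT hR
  have hSs := abs_le.1 (abs_sum_diag_le hS)
  have hpos := sum_pos_of_mem_gammaCone (k := 2) (by norm_num) hlam
  -- the trace of `W` is `(1 + nc) (tr h + a |p|²) - n (ca - b) |p|² + tr S`
  have hsum : ∑ m, lam m ≤ T - n * δ₁ * ∑ l, p l ^ 2 := by
    have e : ∑ m, lam m = (1 + n * c) * (∑ l, h l l + a * ∑ l, p l ^ 2)
        - n * ((c * a - b) * ∑ l, p l ^ 2) + ∑ m, S m m - (1 - 1) := by rw [H.sum]; ring
    have g1 := mul_le_mul_of_nonneg_left (hK.trans (le_abs_self K))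
      (by positivity : 0 ≤ 1 + n * c)
    have g2 := mul_le_mul_of_nonneg_left (mul_le_mul_of_nonneg_right h1 hP) hn0.le
    rw [e]; linarith
  have hPG : ∑ l, p l ^ 2 ≤ G := by
    rw [hG, le_div_iff₀ (by positivity)]; linarith
  have hlamT : ∀ m, |lam m| ≤ T := fun m => (abs_le_sum_of_mem_gammaCone hlam m).trans
    (hsum.trans (sub_le_self _ (by positivity)))
  have hp2 : ∀ m, p m ^ 2 ≤ G := fun m => (Finset.single_le_sum (f := fun l => p l ^ 2)
    (fun _ _ => sq_nonneg _) (Finset.mem_univ m)).trans hPG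
  have hbP : |b * ∑ l, p l ^ 2| ≤ N * G := by
    rw [abs_mul, abs_of_nonneg hP]; exact mul_le_mul hb hPG hP hN
  have haP : |a * ∑ l, p l ^ 2| ≤ N * G := by
    rw [abs_mul, abs_of_nonneg hP]; exact mul_le_mul ha hPG hP hN
  have htr : |∑ l, h l l| ≤ R := by
    have e := H.sum
    have g1 : |(1 + n * c) * ∑ l, h l l| ≤ R := by
      have e2 : (1 + n * c) * ∑ l, h l l = ∑ m, lam m - a * ∑ l, p l ^ 2
          - n * (b * ∑ l, p l ^ 2) - ∑ m, S m m := by rw [e]; ring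
      have g2 := abs_le.1 haP
      have g3 := abs_le.1 hbP
      have g4 : 0 ≤ n * δ₁ * ∑ l, p l ^ 2 := by positivity
      have g5 : |(n : ℝ) * (b * ∑ l, p l ^ 2)| ≤ n * (N * G) := by
        rw [abs_mul, abs_of_pos hn0]; exact mul_le_mul_of_nonneg_left hbP hn0.le
      have g6 := abs_le.1 g5
      rw [e2, hR, abs_le]
      constructor
      · linarith only [g2.2, g6.2, hSs.2, hpos, hT0]
      · linarith only [g2.1, g6.1, hSs.1, hsum, g4]
    rw [abs_mul, abs_of_pos (by positivity : 0 < 1 + n * c)] at g1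
    have g2 : 0 ≤ n * c * |∑ l, h l l| := by positivity
    linarith
  rw [abs_of_nonneg hN]
  refine ⟨hPG.trans (le_add_of_nonneg_right (by positivity)), fun m l => ?_⟩
  have hNG : 0 ≤ N * G := by positivity
  have hcR : 0 ≤ c * R := by positivity
  have s1 := abs_le.1 (hS m l)
  rcases eq_or_ne m l with rfl | hml
  · have e := H.diag m
    have g1 := abs_le.1 (hlamT m)
    have g2 : |c * ∑ l, h l l| ≤ c * R := by
      rw [abs_mul, abs_of_nonneg hc]; exact mul_le_mul_of_nonneg_left htr hc
    have g3 : |a * p m ^ 2| ≤ N * G := by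
      rw [abs_mul, abs_of_nonneg (sq_nonneg (p m))]; exact mul_le_mul ha (hp2 m) (sq_nonneg _) hN
    have g2' := abs_le.1 g2
    have g3' := abs_le.1 g3
    have g4' := abs_le.1 hbP
    rw [abs_le]
    constructor
    · linarith only [e, g1.1, g2'.2, g3'.2, g4'.2, s1.2, hG0]
    · linarith only [e, g1.2, g2'.1, g3'.1, g4'.1, s1.1, hG0]
  · have e := H.off_diag m l hml
    have g1 : |p m * p l| ≤ G := by
      rw [abs_le]
      constructor <;> nlinarith [hp2 m, hp2 l, sq_nonneg (p m + p l), sq_nonneg (p m - p l)]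
    have g3 : |a * (p m * p l)| ≤ N * G := by
      rw [abs_mul]; exact mul_le_mul ha g1 (abs_nonneg _) hN
    have g3' := abs_le.1 g3
    rw [abs_le]
    constructor
    · linarith only [e, g3'.2, s1.2, hG0, hT0, hcR, hNG]
    · linarith only [e, g3'.1, s1.1, hG0, hT0, hcR, hNG]

/-- The entries of a symmetric form are bounded if its eigenvalues are bounded from above and its
trace is bounded from below. -/
theorem abs_entry_le {h : Fin n → Fin n → ℝ} (hs : ∀ m l, h m l = h l m) {κ T : ℝ}
    (hκ : ∀ v : Fin n → ℝ, ∑ m, ∑ l, v m * v l * h m l ≤ κ * ∑ m, v m ^ 2)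
    (hT : -T ≤ ∑ m, h m m) (m l : Fin n) : |h m l| ≤ |κ| + n * |κ| + T := by
  have hd : ∀ m, h m m ≤ κ := by
    intro m
    have := hκ (Pi.single m 1)
    simpa [Pi.single_apply, ite_pow] using this
  have hlow : ∀ m, -(n * |κ| + T) ≤ h m m - κ := by
    intro m
    have h1 : ∑ j, (κ - h j j) = n * κ - ∑ j, h j j := by
      rw [Finset.sum_sub_distrib]; simp
    have h2 := Finset.single_le_sum (f := fun j => κ - h j j) (fun j _ => sub_nonneg.2 (hd j))
      (Finset.mem_univ m)
    have h3 : n * κ ≤ n * |κ| := mul_le_mul_of_nonneg_left (le_abs_self _) (Nat.cast_nonneg _)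
    simp only [h1] at h2
    linarith
  have hk := abs_le.1 (le_refl |κ|)
  rcases eq_or_ne m l with rfl | hml
  · rw [abs_le]
    have h0 : 0 ≤ n * |κ| := by positivity
    have := (hlow m).trans (sub_le_sub_right (hd m) κ)
    constructor <;> linarith [hd m, hlow m, hk.1, hk.2]
  -- polarization: the form on `e_m ± e_l`
  · have key : ∀ ε : ℝ, ε ^ 2 = 1 → h m m + h l l + 2 * ε * h m l ≤ 2 * κ := by
      intro ε hε
      have := hκ (Pi.single m 1 + Pi.single l ε)
      have e1 : ∑ i, ∑ j, (Pi.single m 1 + Pi.single l ε : Fin n → ℝ) i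
          * (Pi.single m 1 + Pi.single l ε : Fin n → ℝ) j * h i j
          = h m m + h l l + 2 * ε * h m l := by
        simp only [Pi.add_apply, add_mul, mul_add, Finset.sum_add_distrib, Pi.single_apply,
          ite_mul, mul_ite, zero_mul, mul_zero, Finset.sum_ite_eq', Finset.mem_univ, if_true]
        rw [hs l m]; simp; linear_combination h l l * hε
      have e2 : ∑ i, (Pi.single m 1 + Pi.single l ε : Fin n → ℝ) i ^ 2 = 2 := by
        have : ∀ i, (Pi.single m 1 + Pi.single l ε : Fin n → ℝ) i ^ 2
            = (if i = m then 1 else 0) + (if i = l then 1 else 0) := by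
          intro i
          simp only [Pi.add_apply, Pi.single_apply]
          split_ifs with h1 h2 h2
          · exact absurd (h1.symm.trans h2) hml
          · norm_num
          · simp [hε]
          · norm_num
        simp only [this, Finset.sum_add_distrib, Finset.sum_ite_eq', Finset.mem_univ, if_true]
        norm_num
      rw [e1, e2] at this; linarith
    have k1 := key 1 (by norm_num)
    have k2 := key (-1) (by norm_num)
    have l1 := hlow m
    have l2 := hlow l
    have h0 : 0 ≤ n * |κ| := by positivity
    rw [abs_le]
    constructor <;> linarith [hd m, hd l, abs_nonneg κ]

/-- In case (b), the gradient and the Hessian are controlled by the largest eigenvalue of the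
Hessian. -/
theorem exists_bound_of_eigenvalue_le (n : ℕ) (c δ₃ N : ℝ) (hc : 0 ≤ c) (hδ₃ : 0 < δ₃) :
    ∃ C, 0 ≤ C ∧ ∀ (a b : ℝ) (p : Fin n → ℝ) (h S : Fin n → Fin n → ℝ)
      (lam : Fin n → ℝ) (κ : ℝ), IsDiagonalized c a b p h S lam → (∀ m l, h m l = h l m) →
      (∀ m l, |S m l| ≤ N) → 0 < ∑ m, lam m → a + n * b ≤ -δ₃ →
      (∀ v : Fin n → ℝ, ∑ m, ∑ l, v m * v l * h m l ≤ κ * ∑ m, v m ^ 2) →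
      ∑ l, p l ^ 2 ≤ C * (1 + |κ|) ∧ ∀ m l, |h m l| ≤ C * (1 + |κ|) := by
  rcases Nat.eq_zero_or_pos n with rfl | hn
  · exact ⟨0, le_rfl, fun a b p h S lam κ _ _ _ _ _ _ => ⟨by simp, fun m => m.elim0⟩⟩
  set A := ((1 + n * c) * n + n * |N|) / δ₃ with hA
  have hA0 : 0 ≤ A := by positivity
  refine ⟨A + (1 + n + n * |N|), by positivity, ?_⟩
  intro a b p h S lam κ H hs hS hpos hab hκ
  have hP : 0 ≤ ∑ l, p l ^ 2 := Finset.sum_nonneg fun _ _ => sq_nonneg _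
  have hN : 0 ≤ N := (abs_nonneg _).trans (hS ⟨0, hn⟩ ⟨0, hn⟩)
  have hSs := abs_le.1 (abs_sum_diag_le hS)
  have htr : ∑ l, h l l ≤ n * |κ| := by
    have hd : ∀ m, h m m ≤ |κ| := by
      intro m
      have := hκ (Pi.single m 1)
      simp only [Pi.single_apply, ite_pow, ite_mul, mul_ite, zero_mul, mul_zero,
        Finset.sum_ite_eq', Finset.mem_univ, if_true] at this
      simp at this
      exact this.trans (le_abs_self _)
    exact (Finset.sum_le_card_nsmul _ _ |κ| fun m _ => hd m).trans (by simp)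
  rw [H.sum] at hpos
  have g1 := mul_le_mul_of_nonneg_right hab hP
  have hnc : 0 ≤ n * c := by positivity
  -- the trace of `W` is positive, and `a + nb ≤ -δ₃ < 0`
  have g2 : -(n * N) ≤ ∑ l, h l l := by
    by_contra hneg
    push Not at hneg
    have g3 : 0 ≤ δ₃ * ∑ l, p l ^ 2 := by positivity
    have g4 : 0 ≤ n * N := by positivity
    nlinarith
  have hk := abs_nonneg κ
  rw [abs_of_nonneg hN] at hA ⊢
  have hPA : ∑ l, p l ^ 2 ≤ A * (1 + |κ|) := by
    rw [hA, div_mul_eq_mul_div, le_div_iff₀ hδ₃]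
    have g3 := mul_le_mul_of_nonneg_left htr (by positivity : 0 ≤ 1 + n * c)
    have g4 : 0 ≤ n * N * |κ| := by positivity
    have g5 : 0 ≤ (1 + n * c) * n := by positivity
    linarith
  have hn0 : (0 : ℝ) ≤ n := Nat.cast_nonneg _
  have hnN : 0 ≤ n * N := by positivity
  refine ⟨hPA.trans (mul_le_mul_of_nonneg_right (by linarith) (by positivity)), fun m l => ?_⟩
  refine (abs_entry_le hs hκ g2 m l).trans ?_
  have g5 : 0 ≤ A * (1 + |κ|) := by positivity
  have g6 : 0 ≤ n * N * |κ| := by positivity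
  linarith

/-- The leading quadratic terms dominate the square of the components of the Hessian in the
distinguished directions; `O` is the orthogonal matrix whose columns are these directions. -/
theorem leading_terms_ge (s : Finset (Fin n)) {O : Matrix (Fin n) (Fin n) ℝ} (hO : Oᵀ * O = 1)
    {h hE : Fin n → Fin n → ℝ} (hhE : ∀ k m, hE k m = ∑ j, O j k * h m j) {F : Fin n → ℝ}
    (hF : ∀ m, 0 ≤ F m) {a b c δ₁ : ℝ} (hc : 0 ≤ c) (hδ : δ₁ ≤ c * a - b)
    (hs : 0 ≤ a ∨ s = Finset.univ) :
    δ₁ * (∑ m, F m) * ∑ k ∈ s, ∑ l, hE k l ^ 2 ≤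
      a * ∑ m, F m * (∑ l, h m l ^ 2 - ∑ k ∈ s, hE k m ^ 2)
        + c * a * (∑ m, F m) * ∑ m, ∑ l, h m l ^ 2
        - b * (∑ m, F m) * ∑ k ∈ s, ∑ l, hE k l ^ 2 := by
  have hFF : 0 ≤ ∑ m, F m := Finset.sum_nonneg fun m _ => hF m
  have hO' : O * Oᵀ = 1 := mul_eq_one_comm.1 hO
  have parseval : ∀ m, ∑ k, hE k m ^ 2 = ∑ l, h m l ^ 2 := by
    intro m
    have e1 : (fun k => hE k m) = (h m) ᵥ* O := by
      funext k; rw [hhE]; simp only [Matrix.vecMul, dotProduct]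
      exact Finset.sum_congr rfl fun j _ => mul_comm _ _
    have e2 : ∑ k, hE k m ^ 2 = (h m ᵥ* O) ⬝ᵥ (h m ᵥ* O) := by
      rw [← e1]; simp only [dotProduct, sq]
    rw [e2, ← Matrix.dotProduct_mulVec, Matrix.mulVec_vecMul, hO', Matrix.one_mulVec]
    simp only [dotProduct, sq]
  have bessel : ∀ m, ∑ k ∈ s, hE k m ^ 2 ≤ ∑ l, h m l ^ 2 := fun m => by
    rw [← parseval m]
    exact Finset.sum_le_sum_of_subset_of_nonneg (Finset.subset_univ _) fun _ _ _ => sq_nonneg _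
  have hswap : ∑ k ∈ s, ∑ l, hE k l ^ 2 = ∑ m, ∑ k ∈ s, hE k m ^ 2 := Finset.sum_comm
  have hX0 : 0 ≤ ∑ k ∈ s, ∑ l, hE k l ^ 2 :=
    Finset.sum_nonneg fun _ _ => Finset.sum_nonneg fun _ _ => sq_nonneg _
  have hmain : δ₁ * (∑ m, F m) * ∑ k ∈ s, ∑ l, hE k l ^ 2
      ≤ (c * a - b) * (∑ m, F m) * ∑ k ∈ s, ∑ l, hE k l ^ 2 :=
    mul_le_mul_of_nonneg_right (mul_le_mul_of_nonneg_right hδ hFF) hX0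
  -- for all directions, Bessel's inequality is an equality and the sign of `a` is irrelevant
  rcases hs with ha | rfl
  · have g1 : 0 ≤ a * ∑ m, F m * (∑ l, h m l ^ 2 - ∑ k ∈ s, hE k m ^ 2) :=
      mul_nonneg ha (Finset.sum_nonneg fun m _ => mul_nonneg (hF m) (sub_nonneg.2 (bessel m)))
    have g2 : ∑ k ∈ s, ∑ l, hE k l ^ 2 ≤ ∑ m, ∑ l, h m l ^ 2 := by
      rw [hswap]; exact Finset.sum_le_sum fun m _ => bessel m
    have g3 := mul_le_mul_of_nonneg_left g2 (mul_nonneg (mul_nonneg hc ha) hFF)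
    linarith
  · have g1 : ∑ k, ∑ l, hE k l ^ 2 = ∑ m, ∑ l, h m l ^ 2 := by
      rw [hswap]; exact Finset.sum_congr rfl fun m _ => parseval m
    have g2 : ∑ m, F m * (∑ l, h m l ^ 2 - ∑ k, hE k m ^ 2) = 0 :=
      Finset.sum_eq_zero fun m _ => by rw [parseval m]; ring
    rw [g2, ← g1]
    linarith

/-- The final step of the estimate: `(σ q)⁴` is bounded by a cubic polynomial in `σ q`. -/
theorem exists_cutoff_bound (C C' δ₁ : ℝ) (hC : 0 ≤ C) (hC' : 0 ≤ C') (hδ₁ : 0 < δ₁) :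
    ∃ B, 0 ≤ B ∧ ∀ σ q X : ℝ, 0 < σ → σ ≤ 1 → 1 ≤ q →
      σ ^ 2 * (2 * (δ₁ * X)) ≤ C * (σ ^ 2 * q ^ 3 + σ * q ^ 3 + q ^ 2) →
      q ^ 4 ≤ C' * (1 + X) → σ ^ 2 * q ^ 2 ≤ B := by
  set D := C' * (1 + 3 * C / (2 * δ₁)) with hD
  have hD0 : 0 ≤ D := by positivity
  refine ⟨(1 + D) ^ 2, by positivity, ?_⟩
  intro σ q X hσ hσ1 hq hX hq4
  set y := σ * q with hy
  have hy0 : 0 ≤ y := by positivity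
  rw [← mul_pow, ← hy]
  refine pow_le_pow_left₀ hy0 ?_ 2
  by_contra hlt
  push Not at hlt
  have hy1 : 1 ≤ y := by linarith
  have s2 : 0 ≤ σ ^ 2 := sq_nonneg _
  have h1 : σ ^ 2 * (σ ^ 2 * (2 * (δ₁ * X))) ≤ C * (3 * y ^ 3) := by
    refine (mul_le_mul_of_nonneg_left hX s2).trans ?_
    have e : σ ^ 2 * (C * (σ ^ 2 * q ^ 3 + σ * q ^ 3 + q ^ 2))
        = C * (σ * y ^ 3 + y ^ 3 + y ^ 2) := by rw [hy]; ring
    rw [e]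
    refine mul_le_mul_of_nonneg_left ?_ hC
    have e1 : σ * y ^ 3 ≤ y ^ 3 := mul_le_of_le_one_left (by positivity) hσ1
    have e2 : y ^ 2 ≤ y ^ 3 := pow_le_pow_right₀ hy1 (by norm_num)
    linarith
  have h2 : σ ^ 4 * X ≤ 3 * C / (2 * δ₁) * y ^ 3 := by
    rw [div_mul_eq_mul_div, le_div_iff₀ (by positivity)]
    nlinarith
  have h3 : y ^ 4 ≤ D * y ^ 3 := by
    calc y ^ 4 = σ ^ 4 * q ^ 4 := by rw [hy]; ring
      _ ≤ σ ^ 4 * (C' * (1 + X)) := mul_le_mul_of_nonneg_left hq4 (by positivity)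
      _ = C' * (σ ^ 4 + σ ^ 4 * X) := by ring
      _ ≤ C' * (y ^ 3 + 3 * C / (2 * δ₁) * y ^ 3) := by
          refine mul_le_mul_of_nonneg_left (add_le_add ?_ h2) hC'
          exact (pow_le_one₀ hσ.le hσ1).trans (one_le_pow₀ hy1)
      _ = D * y ^ 3 := by rw [hD]; ring
  have h4 : y ≤ D := by
    have : 0 < y ^ 3 := by positivity
    have h5 : y * y ^ 3 ≤ D * y ^ 3 := by linarith [show y * y ^ 3 = y ^ 4 by ring]
    exact le_of_mul_le_mul_right h5 this
  linarith

end Pointwise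

/-! ### The inverse square root of a matrix near the identity -/

section InvSqrt

variable {n : ℕ}

/-- The identity matrix as an element of the normed space `Fin n → Fin n → ℝ`. -/
def idArr (n : ℕ) : Fin n → Fin n → ℝ := fun i j => if i = j then 1 else 0

theorem of_idArr : Matrix.of (idArr n) = 1 := by
  ext i j; simp [idArr, Matrix.one_apply]

/-- A determinant as a function of its entries. -/
theorem contDiffAt_det {E : Type*} [NormedAddCommGroup E] [NormedSpace ℝ E] {k : ℕ∞ω}
    {A : E → Matrix (Fin n) (Fin n) ℝ} {x : E} (hA : ∀ i j, ContDiffAt ℝ k (fun y => A y i j) x) :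
    ContDiffAt ℝ k (fun y => (A y).det) x := by
  simp only [Matrix.det_apply]
  refine ContDiffAt.sum fun σ _ => ?_
  refine ContDiffAt.const_smul _ (contDiffAt_prod fun i _ => hA _ _)

theorem contDiffAt_matrix_inv {E : Type*} [NormedAddCommGroup E] [NormedSpace ℝ E] {k : ℕ∞ω}
    {A : E → Matrix (Fin n) (Fin n) ℝ} {x : E} (hA : ∀ i j, ContDiffAt ℝ k (fun y => A y i j) x)
    (hx : (A x).det ≠ 0) (i j : Fin n) : ContDiffAt ℝ k (fun y => (A y)⁻¹ i j) x := by
  have : (fun y => (A y)⁻¹ i j) = fun y => ((A y).det)⁻¹ * (A y).adjugate i j := by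
    funext y; simp [Matrix.inv_def]
  rw [this]
  refine ((contDiffAt_det hA).inv hx).mul ?_
  simp only [Matrix.adjugate_apply]
  refine contDiffAt_det fun a b => ?_
  rcases eq_or_ne a j with rfl | h
  · simpa [Matrix.updateRow_self] using contDiffAt_const
  · simpa [Matrix.updateRow_ne h] using hA a b

/-- A `C²` map `σ` near the identity matrix which sends a symmetric matrix `M` to a matrix that makes
the form `M` standard: the inverse of the square root given by the inverse function theorem. -/
theorem exists_inv_sqrt (n : ℕ) : ∃ σ : (Fin n → Fin n → ℝ) → Fin n → Fin n → ℝ,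
    ContDiffAt ℝ 2 σ (idArr n) ∧ σ (idArr n) = idArr n ∧
    ∀ᶠ M in 𝓝 (idArr n), (Matrix.of M)ᵀ = Matrix.of M →
      (Matrix.of (σ M))ᵀ * Matrix.of M * Matrix.of (σ M) = 1 := by
  set f : (Fin n → Fin n → ℝ) → Fin n → Fin n → ℝ :=
    fun X i j => ∑ k, X i k * X k j with hf
  have hfm : ∀ X, Matrix.of (f X) = Matrix.of X * Matrix.of X := by
    intro X; ext i j; simp [hf, Matrix.mul_apply]
  have hentry : ∀ i j, ContDiff ℝ 2 (fun X : Fin n → Fin n → ℝ => X i j) := fun i j =>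
    (contDiff_apply_apply ℝ ℝ i j)
  have hfc : ContDiffAt ℝ 2 f (idArr n) := by
    refine (contDiff_pi.2 fun i => contDiff_pi.2 fun j => ?_).contDiffAt
    exact ContDiff.sum fun k _ => (hentry i k).mul (hentry k j)
  have hf1 : f (idArr n) = idArr n := by
    have := hfm (idArr n)
    rw [of_idArr, Matrix.one_mul, ← of_idArr] at this
    exact Matrix.of.injective this
  -- the derivative of `X ↦ X * X` at the identity is multiplication by two
  set f' : (Fin n → Fin n → ℝ) ≃L[ℝ] (Fin n → Fin n → ℝ) :=
    ContinuousLinearEquiv.smulLeft (Units.mk0 (2 : ℝ) two_ne_zero) with hf'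
  have hfd : HasFDerivAt f (f' : (Fin n → Fin n → ℝ) →L[ℝ] (Fin n → Fin n → ℝ)) (idArr n) := by
    rw [hasFDerivAt_pi']
    intro i
    rw [hasFDerivAt_pi']
    intro j
    set ev : Fin n → Fin n → (Fin n → Fin n → ℝ) →L[ℝ] ℝ := fun a b =>
      (ContinuousLinearMap.proj (R := ℝ) (φ := fun _ : Fin n => ℝ) b).comp
        (ContinuousLinearMap.proj (R := ℝ) (φ := fun _ : Fin n => Fin n → ℝ) a) with hev
    have he : ∀ a b, HasFDerivAt (fun X : Fin n → Fin n → ℝ => X a b) (ev a b) (idArr n) :=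
      fun a b => (ev a b).hasFDerivAt
    have hs := HasFDerivAt.fun_sum (u := Finset.univ) fun k _ => (he i k).fun_mul (he k j)
    refine hs.congr_fderiv ?_
    ext H
    simp [idArr, hf', hev, Finset.sum_add_distrib]
    ring
  have hn : (2 : ℕ∞ω) ≠ 0 := two_ne_zero
  set R := hfc.localInverse hfd hn with hR
  have hRc : ContDiffAt ℝ 2 R (idArr n) := by
    have := hfc.to_localInverse hfd hn
    rwa [hf1] at this
  have hR1 : R (idArr n) = idArr n := by
    have := hfc.localInverse_apply_image hfd hn
    rwa [hf1] at this
  set Φ := hfc.toOpenPartialHomeomorph f hfd hn with hΦ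
  have hsrc : Φ.source ∈ 𝓝 (idArr n) :=
    Φ.open_source.mem_nhds (hfc.mem_toOpenPartialHomeomorph_source hfd hn)
  have hright : ∀ᶠ M in 𝓝 (idArr n), f (R M) = M := by
    have := (hfc.hasStrictFDerivAt' hfd hn).eventually_right_inverse
    rwa [hf1] at this
  have hRt : Tendsto R (𝓝 (idArr n)) (𝓝 (idArr n)) := by
    have := hRc.continuousAt.tendsto
    rwa [hR1] at this
  have htr : Tendsto (fun X : Fin n → Fin n → ℝ => fun i j => X j i) (𝓝 (idArr n))
      (𝓝 (idArr n)) := by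
    have hc : Continuous fun X : Fin n → Fin n → ℝ => fun i j => X j i := by fun_prop
    have := hc.tendsto (idArr n)
    have e : (fun i j => idArr n j i) = idArr n := by
      funext i j; simp [idArr, eq_comm]
    rwa [e] at this
  have hdet1 : (Matrix.of (R (idArr n))).det ≠ 0 := by rw [hR1, of_idArr]; simp
  have hRe : ∀ i j, ContDiffAt ℝ 2 (fun M => Matrix.of (R M) i j) (idArr n) := fun i j =>
    (hentry i j).contDiffAt.comp _ hRc
  refine ⟨fun M i j => (Matrix.of (R M))⁻¹ i j, ?_, ?_, ?_⟩
  · rw [contDiffAt_pi]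
    intro i
    rw [contDiffAt_pi]
    intro j
    exact contDiffAt_matrix_inv hRe hdet1 i j
  · funext i j
    change (Matrix.of (R (idArr n)))⁻¹ i j = Matrix.of (idArr n) i j
    rw [hR1, of_idArr, inv_one]
  · have hdet : ∀ᶠ M in 𝓝 (idArr n), (Matrix.of (R M)).det ≠ 0 :=
      (contDiffAt_det hRe).continuousAt.eventually_ne hdet1
    filter_upwards [hright, hdet, hRt.eventually hsrc, (htr.comp hRt).eventually hsrc]
      with M h1 h2 h3 h4 hM
    set X := Matrix.of (R M) with hX
    have hXX : X * X = Matrix.of M := by rw [hX, ← hfm, h1]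
    -- `X` and `Xᵀ` are square roots of the same matrix, in the domain of injectivity
    have hXt : Xᵀ = X := by
      have e1 : f (fun i j => R M j i) = f (R M) := by
        apply Matrix.of.injective
        rw [hfm, hfm]
        have : Matrix.of (fun i j => R M j i) = Xᵀ := rfl
        rw [this, ← Matrix.transpose_mul, hXX, hM]
      have e2 := Φ.injOn h4 h3 e1
      ext i j
      exact congrFun (congrFun e2 i) j
    have hunit : IsUnit X.det := isUnit_iff_ne_zero.2 h2
    have e3 : Matrix.of (fun i j => X⁻¹ i j) = X⁻¹ := rfl
    change (Matrix.of (fun i j => X⁻¹ i j))ᵀ * _ * Matrix.of (fun i j => X⁻¹ i j) = 1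
    rw [e3, Matrix.transpose_nonsing_inv, hXt, ← hXX, ← Matrix.mul_assoc,
      Matrix.nonsing_inv_mul _ hunit, Matrix.one_mul, Matrix.mul_nonsing_inv _ hunit]

end InvSqrt

/-! ### Coordinates adapted to a point and a frame -/

section NormalChart

variable {n : ℕ}

/-- The standard basis of `ℝⁿ`. -/
abbrev stdE (i : Fin n) : EuclideanSpace ℝ (Fin n) := EuclideanSpace.single i 1

theorem eq_sum_stdE (w : EuclideanSpace ℝ (Fin n)) : w = ∑ p, w p • stdE p := by
  ext i
  simp [Finset.sum_apply, Pi.single_apply]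

theorem clm_apply_eq_sum (L : EuclideanSpace ℝ (Fin n) →L[ℝ] ℝ) (w : EuclideanSpace ℝ (Fin n)) :
    L w = ∑ p, w p * L (stdE p) := by
  conv_lhs => rw [eq_sum_stdE w, map_sum]
  exact Finset.sum_congr rfl fun p _ => by rw [map_smul, smul_eq_mul]

theorem dirD_eq_sum (w : EuclideanSpace ℝ (Fin n) → ℝ) (X y : EuclideanSpace ℝ (Fin n)) :
    dirD X w y = ∑ p, X p * dirD (stdE p) w y := clm_apply_eq_sum _ _

theorem dirD_dirD_eq_sum {w : EuclideanSpace ℝ (Fin n) → ℝ} {y : EuclideanSpace ℝ (Fin n)}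
    (hw : ContDiffAt ℝ 2 w y) (X : EuclideanSpace ℝ (Fin n)) :
    dirD X (dirD X w) y = ∑ i, ∑ j, X i * X j * dirD (stdE j) (dirD (stdE i) w) y := by
  have h1 : ∀ Z, dirD X (dirD Z w) y = ∑ j, X j * dirD (stdE j) (dirD Z w) y :=
    fun Z => dirD_eq_sum _ _ _
  rw [(dirD_comm hw X X).eq_of_nhds, dirD_eq_sum]
  refine Finset.sum_congr rfl fun i _ => ?_
  rw [(dirD_comm hw (stdE i) X).eq_of_nhds, h1, Finset.mul_sum]
  exact Finset.sum_congr rfl fun j _ => by ring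

/-- The chain rule in coordinates. -/
theorem dirD_comp {u : EuclideanSpace ℝ (Fin n) → ℝ}
    {ψ : EuclideanSpace ℝ (Fin n) → EuclideanSpace ℝ (Fin n)} {y : EuclideanSpace ℝ (Fin n)}
    (hu : DifferentiableAt ℝ u (ψ y)) (hψ : DifferentiableAt ℝ ψ y)
    (Y : EuclideanSpace ℝ (Fin n)) :
    dirD Y (fun z => u (ψ z)) y = ∑ p, dirD Y (fun z => ψ z p) y * dirD (stdE p) u (ψ y) := by
  have h1 : dirD Y (fun z => u (ψ z)) y = fderiv ℝ u (ψ y) (fderiv ℝ ψ y Y) := by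
    have := (hu.hasFDerivAt.comp y hψ.hasFDerivAt).fderiv
    have e : (fun z => u (ψ z)) = u ∘ ψ := rfl
    rw [dirD, e, this]; rfl
  rw [h1, clm_apply_eq_sum]
  refine Finset.sum_congr rfl fun p _ => ?_
  have h2 : dirD Y (fun z => ψ z p) y = (fderiv ℝ ψ y Y) p := by
    have := ((EuclideanSpace.proj (𝕜 := ℝ) p).hasFDerivAt.comp y hψ.hasFDerivAt).fderiv
    have e : (fun z => ψ z p) = (EuclideanSpace.proj (𝕜 := ℝ) p) ∘ ψ := rfl
    rw [dirD, e, this]; rfl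
  rw [h2]; rfl

theorem christoffel_symm {G : EuclideanSpace ℝ (Fin n) → Matrix (Fin n) (Fin n) ℝ}
    {x : EuclideanSpace ℝ (Fin n)} (hG : ∀ᶠ y in 𝓝 x, (G y)ᵀ = G y) (l i j : Fin n) :
    christoffel G x l i j = christoffel G x l j i := by
  have h : ∀ a b m, pderivAt m (fun y => G y a b) x = pderivAt m (fun y => G y b a) x := by
    intro a b m
    have : (fun y => G y a b) =ᶠ[𝓝 x] fun y => G y b a := by
      filter_upwards [hG] with y hy
      conv_lhs => rw [← hy]
      rfl
    exact (this.dirD (stdE m)).eq_of_nhds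
  simp only [christoffel]
  congr 1
  refine Finset.sum_congr rfl fun m _ => ?_
  rw [h i j m]; ring

/-- The matrix `(Γ^c_{pa})_{c,a}` of Christoffel symbols. -/
def chrMat (G : EuclideanSpace ℝ (Fin n) → Matrix (Fin n) (Fin n) ℝ)
    (x : EuclideanSpace ℝ (Fin n)) (p : Fin n) : Matrix (Fin n) (Fin n) ℝ :=
  Matrix.of fun c a => christoffel G x c p a

/-- The Levi-Civita connection is compatible with the metric. -/
theorem pderivAt_metric {G : EuclideanSpace ℝ (Fin n) → Matrix (Fin n) (Fin n) ℝ}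
    {x : EuclideanSpace ℝ (Fin n)} (hG : ∀ᶠ y in 𝓝 x, (G y)ᵀ = G y) (hdet : IsUnit (G x).det)
    (p : Fin n) : Matrix.of (fun a b => pderivAt p (fun y => G y a b) x)
      = (chrMat G x p)ᵀ * G x + G x * chrMat G x p := by
  have hGx : (G x)ᵀ = G x := hG.self_of_nhds
  have hsym : ∀ a b m, pderivAt m (fun y => G y a b) x = pderivAt m (fun y => G y b a) x := by
    intro a b m
    have : (fun y => G y a b) =ᶠ[𝓝 x] fun y => G y b a := by
      filter_upwards [hG] with y hy
      conv_lhs => rw [← hy]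
      rfl
    exact (this.dirD (stdE m)).eq_of_nhds
  have key : ∀ a b, (G x * chrMat G x p) a b = (1 / 2) * (pderivAt p (fun y => G y b a) x
      + pderivAt b (fun y => G y p a) x - pderivAt a (fun y => G y p b) x) := by
    intro a b
    set D : Fin n → ℝ := fun m => pderivAt p (fun y => G y b m) x
      + pderivAt b (fun y => G y p m) x - pderivAt m (fun y => G y p b) x with hD
    have e1 : (fun c => chrMat G x p c b) = (1 / 2 : ℝ) • ((G x)⁻¹ *ᵥ D) := by
      funext c; simp [chrMat, christoffel, Matrix.mulVec, dotProduct, hD]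
    have e2 : (G x * chrMat G x p) a b = (G x *ᵥ (fun c => chrMat G x p c b)) a := by
      simp [Matrix.mul_apply, Matrix.mulVec, dotProduct]
    rw [e2, e1, Matrix.mulVec_smul, Matrix.mulVec_mulVec, Matrix.mul_nonsing_inv _ hdet,
      Matrix.one_mulVec]
    simp [hD]
  ext a b
  have e3 : ((chrMat G x p)ᵀ * G x) a b = (G x * chrMat G x p) b a := by
    have : (chrMat G x p)ᵀ * G x = (G x * chrMat G x p)ᵀ := by
      rw [Matrix.transpose_mul, hGx]
    rw [this]; rfl
  rw [Matrix.add_apply, e3, key, key, Matrix.of_apply, hsym b a p, hsym p b a, hsym p a b]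
  ring

/-- The Christoffel symbols at `x`, in the frame `P`: the entry `(l, i)` is the symbol with upper
index `l` and lower indices `k`, `i`. The transformation rule has `P⁻¹ = Pᵀ G`. -/
def frameChr (G : EuclideanSpace ℝ (Fin n) → Matrix (Fin n) (Fin n) ℝ)
    (x : EuclideanSpace ℝ (Fin n)) (P : Matrix (Fin n) (Fin n) ℝ) (k : Fin n) :
    Matrix (Fin n) (Fin n) ℝ :=
  Pᵀ * G x * (∑ p, P p k • chrMat G x p) * P

theorem frameChr_symm {G : EuclideanSpace ℝ (Fin n) → Matrix (Fin n) (Fin n) ℝ}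
    {x : EuclideanSpace ℝ (Fin n)} (hG : ∀ᶠ y in 𝓝 x, (G y)ᵀ = G y)
    (P : Matrix (Fin n) (Fin n) ℝ) (l i k : Fin n) :
    frameChr G x P k l i = frameChr G x P i l k := by
  have e : ∀ k i : Fin n, frameChr G x P k l i
      = ∑ c : Fin n, (Pᵀ * G x) l c * ∑ a : Fin n, ∑ p : Fin n,
        P p k * P a i * christoffel G x c p a := by
    intro k i
    have h1 : ∀ c a : Fin n, (∑ p, P p k • chrMat G x p : Matrix (Fin n) (Fin n) ℝ) c a
        = ∑ p, P p k * christoffel G x c p a := by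
      intro c a; simp [Matrix.sum_apply, chrMat]
    rw [frameChr, Matrix.mul_assoc, Matrix.mul_apply]
    refine Finset.sum_congr rfl fun c _ => ?_
    rw [Matrix.mul_apply (N := P)]
    refine congrArg _ (Finset.sum_congr rfl fun a _ => ?_)
    rw [h1, Finset.sum_mul]
    exact Finset.sum_congr rfl fun p _ => by ring
  rw [e, e]
  refine Finset.sum_congr rfl fun c _ => ?_
  rw [Finset.sum_comm]
  refine congrArg _ (Finset.sum_congr rfl fun a _ => Finset.sum_congr rfl fun p _ => ?_)
  rw [christoffel_symm hG c]; ring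

/-- The Jacobian matrix of the chart `normalChart`. -/
def chartJac (G : EuclideanSpace ℝ (Fin n) → Matrix (Fin n) (Fin n) ℝ)
    (x : EuclideanSpace ℝ (Fin n)) (P : Matrix (Fin n) (Fin n) ℝ)
    (y : EuclideanSpace ℝ (Fin n)) : Matrix (Fin n) (Fin n) ℝ :=
  Matrix.of fun p i => P p i - ∑ k, y k * (P * frameChr G x P k) p i

/-- Coordinates centred at `x` in which the frame `P` is the standard basis and the Christoffel
symbols vanish at the origin. -/
def normalChart (G : EuclideanSpace ℝ (Fin n) → Matrix (Fin n) (Fin n) ℝ)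
    (x : EuclideanSpace ℝ (Fin n)) (P : Matrix (Fin n) (Fin n) ℝ)
    (y : EuclideanSpace ℝ (Fin n)) : EuclideanSpace ℝ (Fin n) :=
  WithLp.toLp 2 fun p => x p + (∑ i, P p i * y i
    - 1 / 2 * ∑ k, ∑ i, y k * y i * (P * frameChr G x P k) p i)

section

variable (G : EuclideanSpace ℝ (Fin n) → Matrix (Fin n) (Fin n) ℝ)
  (x : EuclideanSpace ℝ (Fin n)) (P : Matrix (Fin n) (Fin n) ℝ)

theorem chartJac_zero : chartJac G x P 0 = P := by
  ext p i; simp [chartJac]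

theorem normalChart_zero : normalChart G x P 0 = x := by
  ext p; simp [normalChart]

theorem contDiff_coord (k : Fin n) {m : ℕ∞ω} :
    ContDiff ℝ m (fun y : EuclideanSpace ℝ (Fin n) => y k) :=
  (EuclideanSpace.proj (𝕜 := ℝ) k).contDiff

theorem dirD_coord (Y : EuclideanSpace ℝ (Fin n)) (k : Fin n) :
    dirD Y (fun y : EuclideanSpace ℝ (Fin n) => y k) = fun _ => Y k := by
  funext y
  exact congrArg (fun L => L Y) (EuclideanSpace.proj (𝕜 := ℝ) k).hasFDerivAt.fderiv

theorem contDiff_normalChart {m : ℕ∞ω} : ContDiff ℝ m (normalChart G x P) := by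
  rw [contDiff_euclidean]
  intro p
  change ContDiff ℝ m fun y : EuclideanSpace ℝ (Fin n) => x p + (∑ i, P p i * y i
    - 1 / 2 * ∑ k, ∑ i, y k * y i * (P * frameChr G x P k) p i)
  refine contDiff_const.add ((ContDiff.sum fun i _ => contDiff_const.mul (contDiff_coord i)).sub
    (contDiff_const.mul (ContDiff.sum fun k _ => ContDiff.sum fun i _ =>
      ((contDiff_coord k).mul (contDiff_coord i)).mul contDiff_const)))

theorem hasJet_coord (y X : EuclideanSpace ℝ (Fin n)) (k : Fin n) :
    HasJet (fun y : EuclideanSpace ℝ (Fin n) => y k) y X (y k) (X k) 0 := by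
  refine ⟨(contDiff_coord k).contDiffAt, rfl, by rw [dirD_coord], ?_⟩
  rw [dirD_coord]; simp [dirD]

theorem hasJet_chartJac (y X : EuclideanSpace ℝ (Fin n)) (p i : Fin n) :
    HasJet (fun y => chartJac G x P y p i) y X (chartJac G x P y p i)
      (-∑ k, X k * (P * frameChr G x P k) p i) 0 := by
  have := (HasJet.const (x := y) (X := X) (P p i)).sub (HasJet.sum Finset.univ fun k _ =>
    (hasJet_coord y X k).mul (HasJet.const ((P * frameChr G x P k) p i)))
  simpa [chartJac] using this

variable {G x P}

/-- The Jacobian of `normalChart`; it uses the symmetry of the Christoffel symbols. -/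
theorem dirD_normalChart (hG : ∀ᶠ y in 𝓝 x, (G y)ᵀ = G y) (y : EuclideanSpace ℝ (Fin n))
    (p i : Fin n) : dirD (stdE i) (fun z => normalChart G x P z p) y = chartJac G x P y p i := by
  have hs : ∀ k i, (P * frameChr G x P k) p i = (P * frameChr G x P i) p k := by
    intro k i
    simp only [Matrix.mul_apply]
    exact Finset.sum_congr rfl fun l _ => by rw [frameChr_symm hG]
  have h1 := (HasJet.const (x := y) (X := stdE i) (x p)).add ((HasJet.sum Finset.univ fun j _ =>
    (hasJet_coord y (stdE i) j).const_mul (P p j)).sub ((HasJet.sum Finset.univ fun k _ =>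
      HasJet.sum Finset.univ fun j _ =>
        ((hasJet_coord y (stdE i) k).mul (hasJet_coord y (stdE i) j)).mul
          (HasJet.const ((P * frameChr G x P k) p j))).const_mul (1 / 2)))
  refine h1.d1.trans ?_
  simp only [PiLp.single_apply, chartJac, Matrix.of_apply, mul_zero, add_zero, zero_add,
    ite_mul, mul_ite, one_mul, mul_one, zero_mul, Finset.sum_ite_eq', Finset.mem_univ, if_true,
    add_mul, Finset.sum_add_distrib]
  rw [Finset.sum_comm]
  simp only [Finset.sum_ite_eq', Finset.mem_univ, if_true]
  rw [Finset.sum_congr rfl fun k _ => by rw [hs i k]]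
  ring

end

end NormalChart

/-! ### The orthonormal frame of the adapted coordinates -/

section AdaptedFrame

variable {n : ℕ}

theorem gradTensor_eq (G : EuclideanSpace ℝ (Fin n) → Matrix (Fin n) (Fin n) ℝ)
    (u : EuclideanSpace ℝ (Fin n) → ℝ) (x : EuclideanSpace ℝ (Fin n)) (κ : Fin 1 → Fin n) :
    gradTensor G u x κ = dirD (stdE (κ 0)) u x := by
  simp only [gradTensor, covDeriv, scalarTensor, Finset.univ_eq_empty, Finset.sum_empty, sub_zero]
  rfl

theorem hessTensor_eq (G : EuclideanSpace ℝ (Fin n) → Matrix (Fin n) (Fin n) ℝ)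
    (u : EuclideanSpace ℝ (Fin n) → ℝ) (x : EuclideanSpace ℝ (Fin n)) (κ : Fin 2 → Fin n) :
    hessTensor G u x κ = dirD (stdE (κ 0)) (dirD (stdE (κ 1)) u) x
      - ∑ l, christoffel G x l (κ 0) (κ 1) * dirD (stdE l) u x := by
  rw [hessTensor, covDeriv]
  simp only [gradTensor_eq, Finset.univ_unique, Finset.sum_singleton]
  rfl

/-- The matrix of the covariant Hessian. -/
def hessMat (G : EuclideanSpace ℝ (Fin n) → Matrix (Fin n) (Fin n) ℝ)
    (u : EuclideanSpace ℝ (Fin n) → ℝ) (x : EuclideanSpace ℝ (Fin n)) :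
    Matrix (Fin n) (Fin n) ℝ :=
  Matrix.of fun i j => hessTensor G u x ![i, j]

theorem HasJet.matrix_mul {M N : EuclideanSpace ℝ (Fin n) → Matrix (Fin n) (Fin n) ℝ}
    {x X : EuclideanSpace ℝ (Fin n)} {M₀ M₁ M₂ N₀ N₁ N₂ : Matrix (Fin n) (Fin n) ℝ}
    (hM : ∀ i j, HasJet (fun y => M y i j) x X (M₀ i j) (M₁ i j) (M₂ i j))
    (hN : ∀ i j, HasJet (fun y => N y i j) x X (N₀ i j) (N₁ i j) (N₂ i j)) (i j : Fin n) :
    HasJet (fun y => (M y * N y) i j) x X ((M₀ * N₀) i j) ((M₁ * N₀ + M₀ * N₁) i j)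
      ((M₂ * N₀ + (2 : ℝ) • (M₁ * N₁) + M₀ * N₂) i j) := by
  have := HasJet.sum Finset.univ fun k _ => (hM i k).mul (hN k j)
  simp only [Matrix.mul_apply, Matrix.add_apply, Matrix.smul_apply, smul_eq_mul, Finset.mul_sum,
    ← Finset.sum_add_distrib]
  convert this using 4

variable (G : EuclideanSpace ℝ (Fin n) → Matrix (Fin n) (Fin n) ℝ)
  (x : EuclideanSpace ℝ (Fin n)) (P : Matrix (Fin n) (Fin n) ℝ)

/-- The metric in the coordinates `normalChart`. -/
def chartMetric (y : EuclideanSpace ℝ (Fin n)) : Matrix (Fin n) (Fin n) ℝ :=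
  (chartJac G x P y)ᵀ * G (normalChart G x P y) * chartJac G x P y

/-- The components of `chartMetric`, as an element of a normed space. -/
def chartMetricArr (y : EuclideanSpace ℝ (Fin n)) : Fin n → Fin n → ℝ :=
  fun i j => chartMetric G x P y i j

/-- A `C²` choice of `M ↦ M^{-1/2}` near the identity. -/
def invSqrt (n : ℕ) : (Fin n → Fin n → ℝ) → Fin n → Fin n → ℝ := (exists_inv_sqrt n).choose

/-- The matrix which makes the coordinate frame of `normalChart` orthonormal. -/
def gramFactor (y : EuclideanSpace ℝ (Fin n)) : Matrix (Fin n) (Fin n) ℝ :=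
  Matrix.of (invSqrt n (chartMetricArr G x P y))

/-- The orthonormal frame adapted to `normalChart`: its columns are vectors at
`normalChart G x P y`. -/
def chartFrame (y : EuclideanSpace ℝ (Fin n)) : Matrix (Fin n) (Fin n) ℝ :=
  chartJac G x P y * gramFactor G x P y

/-- The inverse of the Jacobian of `normalChart`, by the orthonormality of `chartFrame`. -/
def chartJacInv (y : EuclideanSpace ℝ (Fin n)) : Matrix (Fin n) (Fin n) ℝ :=
  gramFactor G x P y * ((chartFrame G x P y)ᵀ * G (normalChart G x P y))

/-- The matrix of Christoffel symbols with the upper index `k`. -/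
def chrUpper (z : EuclideanSpace ℝ (Fin n)) (k : Fin n) : Matrix (Fin n) (Fin n) ℝ :=
  Matrix.of fun p q => christoffel G z k p q

/-- The negative of the Christoffel symbol with upper index `l` in the coordinates
`normalChart`. -/
def chartOmega (l i j : Fin n) (y : EuclideanSpace ℝ (Fin n)) : ℝ :=
  ∑ k, chartJacInv G x P y l k * ((P * frameChr G x P i) k j
    - ((chartJac G x P y)ᵀ * chrUpper G (normalChart G x P y) k * chartJac G x P y) i j)

variable {G x P}

theorem contDiffAt_chartMetric (hGc : ∀ a b, ContDiffAt ℝ 2 (fun y => G y a b) x) (i j : Fin n) :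
    ContDiffAt ℝ 2 (fun y => chartMetric G x P y i j) 0 := by
  have hJ : ∀ p i, ContDiffAt ℝ 2 (fun y => chartJac G x P y p i) 0 := fun p i =>
    (hasJet_chartJac G x P 0 0 p i).contDiffAt
  have hψ : ContDiffAt ℝ 2 (normalChart G x P) 0 := (contDiff_normalChart G x P).contDiffAt
  have hGψ : ∀ a b, ContDiffAt ℝ 2 (fun y => G (normalChart G x P y) a b) 0 := fun a b => by
    refine ContDiffAt.comp (g := fun z => G z a b) 0 ?_ hψ
    rw [normalChart_zero]; exact hGc a b
  simp only [chartMetric, Matrix.mul_apply, Matrix.transpose_apply]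
  exact ContDiffAt.sum fun b _ => (ContDiffAt.sum fun a _ => (hJ a i).mul (hGψ a b)).mul (hJ b j)

theorem chartMetric_zero (hP : Pᵀ * G x * P = 1) : chartMetric G x P 0 = 1 := by
  rw [chartMetric, chartJac_zero, normalChart_zero, hP]

/-- The first derivatives of the metric vanish at the origin. -/
theorem dirD_chartMetric (hG : ∀ᶠ y in 𝓝 x, (G y)ᵀ = G y)
    (hGc : ∀ a b, ContDiffAt ℝ 2 (fun y => G y a b) x) (hP : Pᵀ * G x * P = 1)
    (Y : EuclideanSpace ℝ (Fin n)) (i j : Fin n) :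
    dirD Y (fun y => chartMetric G x P y i j) 0 = 0 := by
  have hGx : (G x)ᵀ = G x := hG.self_of_nhds
  have hdet : IsUnit (G x).det := by
    rw [← Matrix.isUnit_iff_isUnit_det]
    exact IsUnit.of_mul_eq_one _ (mul_eq_one_comm.1 (frame_mul_transpose hP))
  rw [dirD_eq_sum]
  refine Finset.sum_eq_zero fun k _ => ?_
  have hψ : ContDiffAt ℝ 2 (normalChart G x P) 0 := (contDiff_normalChart G x P).contDiffAt
  have hGψ : ∀ a b, ContDiffAt ℝ 2 (fun y => G (normalChart G x P y) a b) 0 := fun a b => by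
    refine ContDiffAt.comp (g := fun z => G z a b) 0 ?_ hψ
    rw [normalChart_zero]; exact hGc a b
  set C : Matrix (Fin n) (Fin n) ℝ := ∑ p, P p k • chrMat G x p with hC
  set A := frameChr G x P k with hA
  have jJ : ∀ p i, HasJet (fun y => chartJac G x P y p i) 0 (stdE k) (P p i) ((-(P * A)) p i)
      ((0 : Matrix (Fin n) (Fin n) ℝ) p i) := by
    intro p i
    have := hasJet_chartJac G x P 0 (stdE k) p i
    rw [chartJac_zero] at this
    convert this using 1 <;> simp [hA, PiLp.single_apply]
  have jG : ∀ a b, HasJet (fun y => G (normalChart G x P y) a b) 0 (stdE k) (G x a b)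
      ((Cᵀ * G x + G x * C) a b)
      (dirD (stdE k) (dirD (stdE k) (fun y => G (normalChart G x P y) a b)) 0) := by
    intro a b
    have h1 := HasJet.self (X := stdE k) (hGψ a b)
    rw [normalChart_zero] at h1
    convert h1 using 1
    have h2 := dirD_comp (u := fun z => G z a b) (ψ := normalChart G x P) (y := 0)
      (by rw [normalChart_zero]; exact (hGc a b).differentiableAt (by norm_num))
      (hψ.differentiableAt (by norm_num)) (stdE k)
    rw [h2]
    simp only [dirD_normalChart hG, chartJac_zero, normalChart_zero]
    have h3 : ∀ p, dirD (stdE p) (fun z => G z a b) x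
        = ((chrMat G x p)ᵀ * G x + G x * chrMat G x p) a b := by
      intro p; rw [← pderivAt_metric hG hdet p]; rfl
    simp only [h3, hC, Matrix.transpose_sum, Matrix.transpose_smul, Finset.sum_mul,
      Finset.mul_sum, Matrix.smul_mul, Matrix.mul_smul, Matrix.add_apply, Matrix.sum_apply,
      Matrix.smul_apply, smul_eq_mul, mul_add, Finset.sum_add_distrib]
  have jJT : ∀ p i, HasJet (fun y => (chartJac G x P y)ᵀ p i) 0 (stdE k) (Pᵀ p i)
      ((-(P * A))ᵀ p i) ((0 : Matrix (Fin n) (Fin n) ℝ) p i) := fun p i => jJ i p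
  have h := ((HasJet.matrix_mul (HasJet.matrix_mul (M := fun y => (chartJac G x P y)ᵀ)
    (N := fun y => G (normalChart G x P y)) (N₂ := Matrix.of fun a b => _) jJT jG)
    (N := fun y => chartJac G x P y) jJ) i j).d1
  refine mul_eq_zero_of_right _ (h.trans ?_)
  have hA' : A = Pᵀ * G x * C * P := rfl
  have e : (((-(P * A))ᵀ * G x + Pᵀ * (Cᵀ * G x + G x * C)) * P + Pᵀ * G x * -(P * A)) = 0 := by
    have e1 : (-(P * A))ᵀ * G x * P = -Aᵀ := by
      rw [Matrix.transpose_neg, Matrix.transpose_mul, Matrix.neg_mul, Matrix.neg_mul,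
        Matrix.mul_assoc, Matrix.mul_assoc, ← Matrix.mul_assoc Pᵀ, hP, Matrix.mul_one]
    have e2 : Pᵀ * G x * -(P * A) = -A := by
      rw [Matrix.mul_neg, ← Matrix.mul_assoc, hP, Matrix.one_mul]
    have e3 : Aᵀ = Pᵀ * (Cᵀ * G x) * P := by
      rw [hA', Matrix.transpose_mul, Matrix.transpose_mul, Matrix.transpose_mul,
        Matrix.transpose_transpose, hGx]
      simp only [Matrix.mul_assoc]
    have e4 : A = Pᵀ * (G x * C) * P := by rw [hA']; simp only [Matrix.mul_assoc]
    rw [Matrix.add_mul, e1, e2, Matrix.mul_add, Matrix.add_mul, ← e3, ← e4]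
    abel
  exact congrFun (congrFun e i) j

theorem chartMetricArr_zero (hP : Pᵀ * G x * P = 1) : chartMetricArr G x P 0 = idArr n := by
  funext i j
  rw [chartMetricArr, chartMetric_zero hP, ← of_idArr]; rfl

theorem contDiffAt_chartMetricArr (hGc : ∀ a b, ContDiffAt ℝ 2 (fun y => G y a b) x) :
    ContDiffAt ℝ 2 (chartMetricArr G x P) 0 :=
  contDiffAt_pi.2 fun i => contDiffAt_pi.2 fun j => contDiffAt_chartMetric hGc i j

theorem tendsto_chartMetric (hGc : ∀ a b, ContDiffAt ℝ 2 (fun y => G y a b) x)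
    (hP : Pᵀ * G x * P = 1) :
    Tendsto (chartMetricArr G x P) (𝓝 0) (𝓝 (idArr n)) := by
  rw [← chartMetricArr_zero hP]
  exact (contDiffAt_chartMetricArr hGc).continuousAt

theorem gramFactor_zero (hP : Pᵀ * G x * P = 1) : gramFactor G x P 0 = 1 := by
  rw [gramFactor, chartMetricArr_zero hP, invSqrt, (exists_inv_sqrt n).choose_spec.2.1, of_idArr]

theorem chartFrame_zero (hP : Pᵀ * G x * P = 1) : chartFrame G x P 0 = P := by
  rw [chartFrame, chartJac_zero, gramFactor_zero hP, Matrix.mul_one]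

/-- The columns of `chartFrame` are orthonormal near the origin. -/
theorem eventually_chartFrame (hG : ∀ᶠ y in 𝓝 x, (G y)ᵀ = G y)
    (hGc : ∀ a b, ContDiffAt ℝ 2 (fun y => G y a b) x) (hP : Pᵀ * G x * P = 1) :
    ∀ᶠ y in 𝓝 0,
      (chartFrame G x P y)ᵀ * G (normalChart G x P y) * chartFrame G x P y = 1 := by
  have h1 := (tendsto_chartMetric hGc hP).eventually (exists_inv_sqrt n).choose_spec.2.2
  have h2 : Tendsto (normalChart G x P) (𝓝 0) (𝓝 x) := by
    have := (contDiff_normalChart G x P (m := 2)).continuous.tendsto 0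
    rwa [normalChart_zero] at this
  filter_upwards [h1, h2.eventually hG] with y hy hy2
  have h3 : (chartMetric G x P y)ᵀ = chartMetric G x P y := by
    rw [chartMetric, Matrix.transpose_mul, Matrix.transpose_mul, Matrix.transpose_transpose, hy2,
      Matrix.mul_assoc]
  have h4 : (gramFactor G x P y)ᵀ * chartMetric G x P y * gramFactor G x P y = 1 := hy h3
  rw [chartFrame, Matrix.transpose_mul, ← h4, chartMetric]
  simp only [Matrix.mul_assoc]

theorem contDiffAt_gramFactor (hGc : ∀ a b, ContDiffAt ℝ 2 (fun y => G y a b) x)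
    (hP : Pᵀ * G x * P = 1) (i j : Fin n) :
    ContDiffAt ℝ 2 (fun y => gramFactor G x P y i j) 0 := by
  have h2 : ContDiffAt ℝ 2 (chartMetricArr G x P) 0 := contDiffAt_chartMetricArr hGc
  have h3 : ContDiffAt ℝ 2 (fun y => invSqrt n (chartMetricArr G x P y)) 0 := by
    refine ContDiffAt.comp (g := invSqrt n) 0 ?_ h2
    rw [chartMetricArr_zero hP]; exact (exists_inv_sqrt n).choose_spec.1
  exact contDiffAt_pi.1 (contDiffAt_pi.1 h3 i) j

/-- As the first derivatives of the metric vanish at the origin, the Gram factor is constant to first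
order there. -/
theorem dirD_gramFactor (hG : ∀ᶠ y in 𝓝 x, (G y)ᵀ = G y)
    (hGc : ∀ a b, ContDiffAt ℝ 2 (fun y => G y a b) x) (hP : Pᵀ * G x * P = 1)
    (Y : EuclideanSpace ℝ (Fin n)) (i j : Fin n) :
    dirD Y (fun y => gramFactor G x P y i j) 0 = 0 := by
  have h2 : ContDiffAt ℝ 2 (chartMetricArr G x P) 0 := contDiffAt_chartMetricArr hGc
  have hd := h2.differentiableAt (by norm_num)
  have h3 : fderiv ℝ (chartMetricArr G x P) 0 Y = 0 := by
    funext a b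
    have e1 := (hasFDerivAt_pi'.1 ((hasFDerivAt_pi'.1 hd.hasFDerivAt) a)) b
    have e2 := congrArg (fun L => L Y) e1.fderiv
    exact e2.symm.trans (dirD_chartMetric hG hGc hP Y a b)
  have hσ : DifferentiableAt ℝ (fun M => invSqrt n M i j) (chartMetricArr G x P 0) := by
    rw [chartMetricArr_zero hP]
    have := (exists_inv_sqrt n).choose_spec.1
    exact (contDiffAt_pi.1 (contDiffAt_pi.1 this i) j).differentiableAt (by norm_num)
  have h4 := (hσ.hasFDerivAt.comp (0 : EuclideanSpace ℝ (Fin n)) hd.hasFDerivAt).fderiv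
  have e : (fun y => gramFactor G x P y i j)
      = (fun M => invSqrt n M i j) ∘ chartMetricArr G x P := rfl
  rw [dirD, e, h4, ContinuousLinearMap.comp_apply, h3, map_zero]

end AdaptedFrame

/-! ### Covariant derivatives in the adapted frame -/

section AdaptedFrameDerivatives

variable {n : ℕ} (G : EuclideanSpace ℝ (Fin n) → Matrix (Fin n) (Fin n) ℝ)
  (x : EuclideanSpace ℝ (Fin n)) (P : Matrix (Fin n) (Fin n) ℝ)

/-- The coefficient of the second derivatives in the Hessian in direction `chartFrame *ᵥ X`, minus
its value at the origin. -/
def chartKappa (X : EuclideanSpace ℝ (Fin n)) (i j : Fin n) (y : EuclideanSpace ℝ (Fin n)) : ℝ :=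
  (∑ k, gramFactor G x P y i k * X k) * (∑ k, gramFactor G x P y j k * X k) - X i * X j

/-- The coefficient of the first derivatives in the Hessian in direction `chartFrame *ᵥ X`. -/
def chartDrift (X : EuclideanSpace ℝ (Fin n)) (l : Fin n) (y : EuclideanSpace ℝ (Fin n)) : ℝ :=
  ∑ i, ∑ j, (∑ k, gramFactor G x P y i k * X k) * (∑ k, gramFactor G x P y j k * X k)
    * chartOmega G x P l i j y

variable {G x P} {u : EuclideanSpace ℝ (Fin n) → ℝ} {y : EuclideanSpace ℝ (Fin n)}

theorem chartJacInv_mul (hy : (chartFrame G x P y)ᵀ * G (normalChart G x P y)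
    * chartFrame G x P y = 1) : chartJacInv G x P y * chartJac G x P y = 1 := by
  have h1 : ((chartFrame G x P y)ᵀ * G (normalChart G x P y) * chartJac G x P y)
      * gramFactor G x P y = 1 := by
    rw [Matrix.mul_assoc, ← chartFrame, hy]
  rw [chartJacInv, Matrix.mul_assoc]
  exact mul_eq_one_comm.1 h1

theorem dirD_comp_normalChart (hG : ∀ᶠ y in 𝓝 x, (G y)ᵀ = G y)
    (hu : DifferentiableAt ℝ u (normalChart G x P y)) (j : Fin n) :
    dirD (stdE j) (fun z => u (normalChart G x P z)) y
      = ∑ p, chartJac G x P y p j * dirD (stdE p) u (normalChart G x P y) := by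
  rw [dirD_comp hu ((contDiff_normalChart G x P (m := 1)).differentiable (by norm_num) y)]
  simp only [dirD_normalChart hG]

/-- The components of the gradient in the frame `chartFrame`. -/
theorem chartFrame_grad (hG : ∀ᶠ y in 𝓝 x, (G y)ᵀ = G y)
    (hu : DifferentiableAt ℝ u (normalChart G x P y)) (m : Fin n) :
    ∑ p, chartFrame G x P y p m * dirD (stdE p) u (normalChart G x P y)
      = ∑ i, gramFactor G x P y i m * dirD (stdE i) (fun z => u (normalChart G x P z)) y := by
  simp only [dirD_comp_normalChart hG hu, chartFrame, Matrix.mul_apply, Finset.sum_mul,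
    Finset.mul_sum]
  rw [Finset.sum_comm]
  exact Finset.sum_congr rfl fun i _ => Finset.sum_congr rfl fun p _ => by ring

theorem dirD_dirD_comp_normalChart (hG : ∀ᶠ y in 𝓝 x, (G y)ᵀ = G y)
    (hu : ContDiffAt ℝ 2 u (normalChart G x P y)) (i j : Fin n) :
    dirD (stdE i) (dirD (stdE j) (fun z => u (normalChart G x P z))) y
      = ∑ p, ∑ q, chartJac G x P y p i * chartJac G x P y q j
          * dirD (stdE p) (dirD (stdE q) u) (normalChart G x P y)
        - ∑ q, (P * frameChr G x P i) q j * dirD (stdE q) u (normalChart G x P y) := by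
  have hψ : ContDiffAt ℝ 2 (normalChart G x P) y := (contDiff_normalChart G x P).contDiffAt
  have hψ1 : ContDiffAt ℝ 1 (normalChart G x P) y := hψ.of_le (by norm_num)
  have e1 : dirD (stdE j) (fun z => u (normalChart G x P z)) =ᶠ[𝓝 y]
      fun z => ∑ p, chartJac G x P z p j * dirD (stdE p) u (normalChart G x P z) := by
    filter_upwards [hψ.continuousAt.eventually
      (eventually_differentiableAt (hu.of_le (by norm_num)))] with z hz
    exact dirD_comp_normalChart hG hz j
  rw [(e1.dirD (stdE i)).eq_of_nhds]
  have hd : ∀ p, ContDiffAt ℝ 1 (dirD (stdE p) u) (normalChart G x P y) := fun p =>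
    ContDiffAt.dirD (k := 1) hu (stdE p)
  have hJ : ∀ p i, ContDiffAt ℝ 1 (fun y => chartJac G x P y p i) y := fun p i =>
    (hasJet_chartJac G x P y 0 p i).contDiffAt.of_le (by norm_num)
  have h2 : ∀ p, ContDiffAt ℝ 1 (fun z => dirD (stdE p) u (normalChart G x P z)) y := fun p =>
    ContDiffAt.comp y (hd p) hψ1
  have e2 : dirD (stdE i) (fun z => ∑ q, chartJac G x P z q j
      * dirD (stdE q) u (normalChart G x P z)) y
      = ∑ q, dirD (stdE i) (fun z => chartJac G x P z q j
        * dirD (stdE q) u (normalChart G x P z)) y := by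
    have h3 := (HasFDerivAt.fun_sum (u := Finset.univ) fun q _ =>
      (((hJ q j).mul (h2 q)).differentiableAt (by norm_num)).hasFDerivAt).fderiv
    refine (congrArg (fun L => L (stdE i)) h3).trans ?_
    rw [sum_apply]
    rfl
  rw [e2, Finset.sum_comm, ← Finset.sum_sub_distrib]
  refine Finset.sum_congr rfl fun q _ => ?_
  rw [(dirD_mul (hJ q j) (h2 q) (stdE i)).eq_of_nhds,
    dirD_comp_normalChart hG ((hd q).differentiableAt (by norm_num)) i,
    (hasJet_chartJac G x P y (stdE i) q j).d1]
  simp only [PiLp.single_apply, ite_mul, one_mul, zero_mul, Finset.sum_ite_eq', Finset.mem_univ,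
    if_true, Finset.mul_sum]
  rw [add_comm, neg_mul, ← sub_eq_add_neg]
  congr 1
  exact Finset.sum_congr rfl fun p _ => by ring

/-- The covariant Hessian in the coordinates `normalChart`. -/
theorem chartJac_hess (hG : ∀ᶠ y in 𝓝 x, (G y)ᵀ = G y)
    (hu : ContDiffAt ℝ 2 u (normalChart G x P y))
    (hy : (chartFrame G x P y)ᵀ * G (normalChart G x P y) * chartFrame G x P y = 1)
    (i j : Fin n) :
    ((chartJac G x P y)ᵀ * hessMat G u (normalChart G x P y) * chartJac G x P y) i j
      = dirD (stdE i) (dirD (stdE j) (fun z => u (normalChart G x P z))) y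
        + ∑ l, chartOmega G x P l i j y * dirD (stdE l) (fun z => u (normalChart G x P z)) y := by
  have hinv := chartJacInv_mul hy
  have hinv' : (chartJac G x P y) * chartJacInv G x P y = 1 := mul_eq_one_comm.1 hinv
  set J := chartJac G x P y with hJ
  set z := normalChart G x P y with hz
  set du : Fin n → ℝ := fun p => dirD (stdE p) u z with hdu
  -- the first derivatives of `u` in terms of those of the composition
  have h1 : ∀ l, dirD (stdE l) (fun z => u (normalChart G x P z)) y = (Jᵀ *ᵥ du) l := fun l =>
    dirD_comp_normalChart hG (hu.differentiableAt (by norm_num)) l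
  have h2 : ∀ k, du k = ∑ l, chartJacInv G x P y l k * (Jᵀ *ᵥ du) l := by
    intro k
    have : du = (chartJacInv G x P y)ᵀ *ᵥ (Jᵀ *ᵥ du) := by
      rw [Matrix.mulVec_mulVec, ← Matrix.transpose_mul, hinv', Matrix.transpose_one,
        Matrix.one_mulVec]
    exact congrFun this k
  have h3 : ∑ l, chartOmega G x P l i j y * (Jᵀ *ᵥ du) l
      = ∑ k, ((P * frameChr G x P i) k j - (Jᵀ * chrUpper G z k * J) i j) * du k := by
    simp only [chartOmega, Finset.sum_mul]
    rw [Finset.sum_comm]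
    refine Finset.sum_congr rfl fun k _ => ?_
    rw [h2 k, Finset.mul_sum]
    exact Finset.sum_congr rfl fun l _ => by ring
  have h4 : ∀ M : Matrix (Fin n) (Fin n) ℝ, (Jᵀ * M * J) i j
      = ∑ p, ∑ q, J p i * J q j * M p q := by
    intro M
    simp only [Matrix.mul_apply, Matrix.transpose_apply, Finset.sum_mul]
    rw [Finset.sum_comm]
    exact Finset.sum_congr rfl fun p _ => Finset.sum_congr rfl fun q _ => by ring
  have h5 : ∀ p q, hessMat G u z p q
      = dirD (stdE p) (dirD (stdE q) u) z - ∑ k, chrUpper G z k p q * du k := by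
    intro p q
    exact hessTensor_eq G u z ![p, q]
  simp only [h1]
  rw [h3, dirD_dirD_comp_normalChart hG hu, h4]
  simp only [h5, h4, mul_sub, sub_mul, Finset.sum_sub_distrib]
  have h6 : ∑ p, ∑ q, J p i * J q j * ∑ k, chrUpper G z k p q * du k
      = ∑ k, (∑ p, ∑ q, J p i * J q j * chrUpper G z k p q) * du k := by
    simp only [Finset.mul_sum, Finset.sum_mul]
    rw [Finset.sum_congr rfl fun p _ => Finset.sum_comm, Finset.sum_comm]
    exact Finset.sum_congr rfl fun k _ => Finset.sum_congr rfl fun p _ =>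
      Finset.sum_congr rfl fun q _ => by ring
  rw [h6]
  ring

/-- The covariant Hessian in the direction with constant components `X` in the frame `chartFrame`. -/
theorem chartFrame_hess (hG : ∀ᶠ y in 𝓝 x, (G y)ᵀ = G y)
    (hu : ContDiffAt ℝ 2 u (normalChart G x P y))
    (hy : (chartFrame G x P y)ᵀ * G (normalChart G x P y) * chartFrame G x P y = 1)
    (X : EuclideanSpace ℝ (Fin n)) :
    ∑ m, ∑ m', X m * X m' * ((chartFrame G x P y)ᵀ * hessMat G u (normalChart G x P y)
        * chartFrame G x P y) m m'
      = dirD X (dirD X (fun z => u (normalChart G x P z))) y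
        + ∑ i, ∑ j, chartKappa G x P X i j y
          * dirD (stdE i) (dirD (stdE j) (fun z => u (normalChart G x P z))) y
        + ∑ l, chartDrift G x P X l y * dirD (stdE l) (fun z => u (normalChart G x P z)) y := by
  set v := fun z => u (normalChart G x P z) with hv
  have hψ : ContDiffAt ℝ 2 (normalChart G x P) y := (contDiff_normalChart G x P).contDiffAt
  have hvc : ContDiffAt ℝ 2 v y := ContDiffAt.comp y hu hψ
  set B := gramFactor G x P y with hB
  set H := hessMat G u (normalChart G x P y) with hH
  set K := (chartJac G x P y)ᵀ * H * chartJac G x P y with hK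
  have quad : ∀ (M : Matrix (Fin n) (Fin n) ℝ) (Z : Fin n → ℝ),
      ∑ m, ∑ m', Z m * Z m' * M m m' = Z ⬝ᵥ (M *ᵥ Z) := by
    intro M Z
    simp only [dotProduct, Matrix.mulVec, Finset.mul_sum]
    exact Finset.sum_congr rfl fun p _ => Finset.sum_congr rfl fun q _ => by ring
  have e1 : (chartFrame G x P y)ᵀ * H * chartFrame G x P y = Bᵀ * K * B := by
    rw [chartFrame, Matrix.transpose_mul, hK]; simp only [Matrix.mul_assoc, ← hB]
  have e2 : ∑ m, ∑ m', X m * X m' * (Bᵀ * K * B) m m'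
      = ∑ i, ∑ j, (B *ᵥ X) i * (B *ᵥ X) j * K i j := by
    rw [quad _ (fun i => X i), quad _ (B *ᵥ X)]
    rw [← Matrix.mulVec_mulVec, ← Matrix.mulVec_mulVec, Matrix.dotProduct_mulVec,
      Matrix.vecMul_transpose]
  have e3 : dirD X (dirD X v) y
      = ∑ i, ∑ j, X i * X j * dirD (stdE i) (dirD (stdE j) v) y := by
    rw [dirD_dirD_eq_sum hvc, Finset.sum_comm]
    exact Finset.sum_congr rfl fun p _ => Finset.sum_congr rfl fun q _ => by ring
  have e4 : ∀ i, (B *ᵥ X) i = ∑ k, B i k * X k := fun i => rfl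
  have e6 : ∀ i j, K i j = dirD (stdE i) (dirD (stdE j) v) y
      + ∑ l, chartOmega G x P l i j y * dirD (stdE l) v y := chartJac_hess hG hu hy
  rw [e1, e2, e3]
  simp only [e6, chartKappa, chartDrift, ← hB, ← e4, mul_add, sub_mul,
    Finset.sum_add_distrib, Finset.sum_sub_distrib]
  have e5 : ∑ i, ∑ j, (B *ᵥ X) i * (B *ᵥ X) j * ∑ l, chartOmega G x P l i j y * dirD (stdE l) v y
      = ∑ l, (∑ i, ∑ j, (B *ᵥ X) i * (B *ᵥ X) j * chartOmega G x P l i j y)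
        * dirD (stdE l) v y := by
    simp only [Finset.mul_sum, Finset.sum_mul]
    rw [Finset.sum_congr rfl fun p _ => Finset.sum_comm, Finset.sum_comm]
    exact Finset.sum_congr rfl fun k _ => Finset.sum_congr rfl fun p _ =>
      Finset.sum_congr rfl fun q _ => by ring
  rw [e5]
  ring

theorem chartKappa_zero (hP : Pᵀ * G x * P = 1) (X : EuclideanSpace ℝ (Fin n)) (i j : Fin n) :
    chartKappa G x P X i j 0 = 0 := by
  have h : ∀ i, ∑ k, (1 : Matrix (Fin n) (Fin n) ℝ) i k * X k = X i := by
    intro i; simp [Matrix.one_apply]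
  rw [chartKappa, gramFactor_zero hP, h, h, sub_self]

theorem dirD_chartKappa_zero (hG : ∀ᶠ y in 𝓝 x, (G y)ᵀ = G y)
    (hGc : ∀ a b, ContDiffAt ℝ 2 (fun y => G y a b) x) (hP : Pᵀ * G x * P = 1)
    (X Y : EuclideanSpace ℝ (Fin n)) (i j : Fin n) :
    dirD Y (chartKappa G x P X i j) 0 = 0 := by
  have h1 : ∀ i, HasJet (fun y => ∑ k, gramFactor G x P y i k * X k) 0 Y _ _ _ := fun i =>
    HasJet.sum Finset.univ fun k _ =>
      (HasJet.self (X := Y) (contDiffAt_gramFactor hGc hP i k)).mul (HasJet.const (X k))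
  have h2 := (((h1 i).mul (h1 j)).sub (HasJet.const (X i * X j))).d1
  refine h2.trans ?_
  simp [dirD_gramFactor hG hGc hP]

/-- The Christoffel symbols in the coordinates `normalChart` vanish at the origin. -/
theorem chartOmega_zero (hP : Pᵀ * G x * P = 1) (l i j : Fin n) :
    chartOmega G x P l i j 0 = 0 := by
  rw [chartOmega, chartJac_zero, normalChart_zero]
  refine Finset.sum_eq_zero fun k _ => mul_eq_zero_of_right _ (sub_eq_zero.2 ?_)
  have h1 : P * frameChr G x P i = (∑ p, P p i • chrMat G x p) * P := by
    rw [frameChr, Matrix.mul_assoc (Pᵀ * G x), ← Matrix.mul_assoc, frame_mul hP, Matrix.one_mul]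
  rw [h1]
  simp only [Matrix.mul_apply, Matrix.sum_apply, Matrix.smul_apply, Finset.sum_mul,
    Matrix.transpose_apply, chrMat, chrUpper, Matrix.of_apply, smul_eq_mul]

theorem chartDrift_zero (hP : Pᵀ * G x * P = 1) (X : EuclideanSpace ℝ (Fin n)) (l : Fin n) :
    chartDrift G x P X l 0 = 0 := by
  simp [chartDrift, chartOmega_zero hP]

end AdaptedFrameDerivatives

/-! ### Uniform bounds for adapted frames -/

section UniformFrames

variable {n : ℕ} {ι : Type*}

theorem UnifJet.matrix_mul {E : Type*} [NormedAddCommGroup E] [NormedSpace ℝ E] {k : ℕ}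
    {M N : ι → E → Matrix (Fin n) (Fin n) ℝ} {x : ι → E}
    (hM : ∀ a b, UnifJet k (fun i y => M i y a b) x)
    (hN : ∀ a b, UnifJet k (fun i y => N i y a b) x) (a b : Fin n) :
    UnifJet k (fun i y => (M i y * N i y) a b) x := by
  simp only [Matrix.mul_apply]
  exact UnifJet.sum Finset.univ fun c _ => (hM a c).mul (hN c b)

/-- Families of metrics with bounded `C³` jets at bounded points, and of bounded orthonormal frames
there. -/
structure UnifFrames (G : ι → EuclideanSpace ℝ (Fin n) → Matrix (Fin n) (Fin n) ℝ)
    (x : ι → EuclideanSpace ℝ (Fin n)) (P : ι → Matrix (Fin n) (Fin n) ℝ) : Prop where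
  metric : ∀ a b, UnifJet 3 (fun i y => G i y a b) x
  symm : ∀ i, ∀ᶠ y in 𝓝 (x i), (G i y)ᵀ = G i y
  point_bdd : x =O[⊤] fun _ => (1 : ℝ)
  frame_bdd : ∀ a b, (fun i => P i a b) =O[⊤] fun _ => (1 : ℝ)
  orthonormal : ∀ i, (P i)ᵀ * G i (x i) * P i = 1

namespace UnifFrames

variable {G : ι → EuclideanSpace ℝ (Fin n) → Matrix (Fin n) (Fin n) ℝ}
  {x : ι → EuclideanSpace ℝ (Fin n)} {P : ι → Matrix (Fin n) (Fin n) ℝ}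

theorem frame_jet (H : UnifFrames G x P) {k : ℕ} {z : ι → EuclideanSpace ℝ (Fin n)} (a b : Fin n) :
    UnifJet k (fun i _ => P i a b) z := UnifJet.const (H.frame_bdd a b)

/-- The inverse metric has bounded jets, since in the frames `P i` the metrics are the identity at
the points `x i`. -/
theorem metric_inv (H : UnifFrames G x P) (a b : Fin n) :
    UnifJet 3 (fun i y => (G i y)⁻¹ a b) x := by
  have hPT : ∀ a b, UnifJet 3 (fun i (_ : EuclideanSpace ℝ (Fin n)) => (P i)ᵀ a b) x :=
    fun a b => H.frame_jet b a
  have h1 := UnifJet.matrix_mul (UnifJet.matrix_mul (M := fun i _ => (P i)ᵀ) hPT H.metric)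
    (N := fun i _ => P i) fun a b => H.frame_jet a b
  have h2 : UnifJet 3 (fun i y a b => ((P i)ᵀ * G i y * P i) a b) x :=
    UnifJet.pi fun a => UnifJet.pi fun b => h1 a b
  have h3 : ∀ a b, UnifJet 3 (fun i y => ((P i)ᵀ * G i y * P i)⁻¹ a b) x := by
    intro a b
    refine UnifJet.comp_fixed (g := fun A : Fin n → Fin n → ℝ => (Matrix.of A)⁻¹ a b)
      (z := idArr n) ?_ h2 fun i => ?_
    · refine contDiffAt_matrix_inv (A := Matrix.of) (fun c d => ?_) ?_ a b
      · exact (contDiff_apply_apply ℝ ℝ c d).contDiffAt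
      · rw [of_idArr]; simp
    · change (fun a b => ((P i)ᵀ * G i (x i) * P i) a b) = idArr n
      rw [H.orthonormal i, ← of_idArr]; rfl
  have h4 := UnifJet.matrix_mul (UnifJet.matrix_mul (M := fun i _ => P i)
    (fun a b => H.frame_jet a b) h3) (N := fun i _ => (P i)ᵀ) hPT a b
  refine h4.congr fun i => Eventually.of_forall fun y => ?_
  have hu : (P i) * (P i)⁻¹ = 1 := by
    refine Matrix.mul_nonsing_inv _ ?_
    rw [← Matrix.isUnit_iff_isUnit_det]
    exact IsUnit.of_mul_eq_one _ (frame_mul (H.orthonormal i))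
  have hu' : (P i)ᵀ⁻¹ * (P i)ᵀ = 1 := by
    rw [← Matrix.transpose_nonsing_inv, ← Matrix.transpose_mul, hu, Matrix.transpose_one]
  have : (G i y)⁻¹ = P i * ((P i)ᵀ * G i y * P i)⁻¹ * (P i)ᵀ := by
    rw [Matrix.mul_inv_rev, Matrix.mul_inv_rev, ← Matrix.mul_assoc, hu, Matrix.one_mul,
      Matrix.mul_assoc, hu', Matrix.mul_one]
  exact congrFun (congrFun this a) b

theorem christoffel (H : UnifFrames G x P) (l a b : Fin n) :
    UnifJet 2 (fun i y => christoffel (G i) y l a b) x := by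
  have hd : ∀ m a b, UnifJet 2 (fun i y => pderivAt m (fun z => G i z a b) y) x := fun m a b =>
    UnifJet.fderiv_apply (k := 2) (H.metric a b) (stdE m)
  refine (UnifJet.const (isBigO_refl _ _) : UnifJet 2 (fun _ _ => (1 : ℝ)) x).mul
    (UnifJet.const (c := fun _ => (1 / 2 : ℝ)) (isBigO_const_const _ one_ne_zero _)) |>.mul
    (UnifJet.sum Finset.univ fun m _ => ((H.metric_inv l m).mono (by norm_num)).mul
      (((hd a b m).add (hd b a m)).sub (hd m a b))) |>.congr fun i => ?_
  exact Eventually.of_forall fun y => by rw [one_mul]; rfl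

theorem mul_frameChr (H : UnifFrames G x P) (k a b : Fin n) :
    (fun i => (P i * frameChr (G i) (x i) (P i) k) a b) =O[⊤] fun _ => (1 : ℝ) := by
  have hJ : ∀ p a b, UnifJet 0 (fun i (_ : EuclideanSpace ℝ (Fin n)) =>
      chrMat (G i) (x i) p a b) x := fun p a b =>
    UnifJet.const (H.christoffel a p b).isBigO_apply
  have hC : ∀ a b, UnifJet 0 (fun i (_ : EuclideanSpace ℝ (Fin n)) =>
      (∑ p, P i p k • chrMat (G i) (x i) p : Matrix (Fin n) (Fin n) ℝ) a b) x := by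
    intro a b
    simp only [Matrix.sum_apply, Matrix.smul_apply, smul_eq_mul]
    exact UnifJet.sum Finset.univ fun p _ => (H.frame_jet p k).mul (hJ p a b)
  have hP : ∀ a b, UnifJet 0 (fun i (_ : EuclideanSpace ℝ (Fin n)) => P i a b) x :=
    fun a b => H.frame_jet a b
  have := (UnifJet.matrix_mul (M := fun i _ => _) hC (N := fun i _ => P i) hP a b).isBigO_apply
  refine this.congr_left fun i => ?_
  rw [frameChr, Matrix.mul_assoc (_ * G i _), ← Matrix.mul_assoc (P i),
    frame_mul (H.orthonormal i), Matrix.one_mul]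

theorem coord_jet {k : ℕ} (j : Fin n) :
    UnifJet k (fun (_ : ι) (y : EuclideanSpace ℝ (Fin n)) => y j) (fun _ => 0) :=
  UnifJet.clm (EuclideanSpace.proj (𝕜 := ℝ) j) (isBigO_const_const _ one_ne_zero _)

theorem chartJac (H : UnifFrames G x P) {k : ℕ} (a b : Fin n) :
    UnifJet k (fun i y => chartJac (G i) (x i) (P i) y a b) (fun _ => 0) :=
  (H.frame_jet a b).sub (UnifJet.sum Finset.univ fun c _ => (coord_jet c).mul
    (UnifJet.const (H.mul_frameChr c a b)))

theorem normalChart (H : UnifFrames G x P) {k : ℕ} :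
    UnifJet k (fun i y => normalChart (G i) (x i) (P i) y) (fun _ => 0) := by
  have hx : ∀ p, (fun i => x i p) =O[⊤] fun _ => (1 : ℝ) := by
    intro p
    obtain ⟨C, hC⟩ := isBigO_one_iff.1 H.point_bdd
    exact isBigO_one_iff.2 ⟨C, fun i => (PiLp.norm_apply_le (x i) p).trans (hC i)⟩
  have h1 : ∀ p, UnifJet k (fun i (y : EuclideanSpace ℝ (Fin n)) => x i p + (∑ c, P i p c * y c
      - 1 / 2 * ∑ c, ∑ d, y c * y d * (P i * frameChr (G i) (x i) (P i) c) p d))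
      (fun _ => 0) := fun p =>
    (UnifJet.const (hx p)).add ((UnifJet.sum Finset.univ fun c _ =>
      (H.frame_jet p c).mul (coord_jet c)).sub
      ((UnifJet.const (c := fun _ => (1 / 2 : ℝ)) (isBigO_const_const _ one_ne_zero _)).mul
        (UnifJet.sum Finset.univ fun c _ => UnifJet.sum Finset.univ fun d _ =>
          ((coord_jet c).mul (coord_jet d)).mul (UnifJet.const (H.mul_frameChr c p d)))))
  exact (UnifJet.pi h1).clm_comp
    ((PiLp.continuousLinearEquiv 2 ℝ (fun _ : Fin n => ℝ)).symm :
      (Fin n → ℝ) →L[ℝ] EuclideanSpace ℝ (Fin n))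

theorem comp_normalChart (H : UnifFrames G x P) {k : ℕ} {F' : Type*} [NormedAddCommGroup F']
    [NormedSpace ℝ F'] {h : ι → EuclideanSpace ℝ (Fin n) → F'} (hh : UnifJet k h x) :
    UnifJet k (fun i y => h i (_root_.normalChart (G i) (x i) (P i) y)) (fun _ => 0) := by
  refine UnifJet.comp ?_ H.normalChart
  simp only [normalChart_zero]
  exact hh

theorem chartMetric (H : UnifFrames G x P) (a b : Fin n) :
    UnifJet 2 (fun i y => chartMetric (G i) (x i) (P i) y a b) (fun _ => 0) :=
  UnifJet.matrix_mul (UnifJet.matrix_mul (M := fun i y => (_root_.chartJac (G i) (x i) (P i) y)ᵀ)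
    (fun a b => H.chartJac b a)
    (N := fun i y => G i (_root_.normalChart (G i) (x i) (P i) y))
    fun a b => H.comp_normalChart ((H.metric a b).mono (by norm_num))) H.chartJac a b

theorem gramFactor (H : UnifFrames G x P) (a b : Fin n) :
    UnifJet 2 (fun i y => gramFactor (G i) (x i) (P i) y a b) (fun _ => 0) := by
  have h1 : UnifJet 2 (fun i y => chartMetricArr (G i) (x i) (P i) y) (fun _ => 0) :=
    UnifJet.pi fun a => UnifJet.pi fun b => H.chartMetric a b
  have h2 : ContDiffAt ℝ 2 (fun M => invSqrt n M a b) (idArr n) :=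
    contDiffAt_pi.1 (contDiffAt_pi.1 (exists_inv_sqrt n).choose_spec.1 a) b
  exact UnifJet.comp_fixed h2 h1 fun i => chartMetricArr_zero (H.orthonormal i)

theorem chartFrame (H : UnifFrames G x P) (a b : Fin n) :
    UnifJet 2 (fun i y => chartFrame (G i) (x i) (P i) y a b) (fun _ => 0) :=
  UnifJet.matrix_mul H.chartJac H.gramFactor a b

theorem chartOmega (H : UnifFrames G x P) (l a b : Fin n) :
    UnifJet 2 (fun i y => chartOmega (G i) (x i) (P i) l a b y) (fun _ => 0) := by
  have hE : ∀ a b, UnifJet 2 (fun i y => (_root_.chartFrame (G i) (x i) (P i) y)ᵀ a b)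
      (fun _ => 0) := fun a b => H.chartFrame b a
  have hJ : ∀ a b, UnifJet 2 (fun i y => (_root_.chartJac (G i) (x i) (P i) y)ᵀ a b)
      (fun _ => 0) := fun a b => H.chartJac b a
  have hinv : ∀ a b, UnifJet 2 (fun i y => chartJacInv (G i) (x i) (P i) y a b) (fun _ => 0) :=
    UnifJet.matrix_mul H.gramFactor (UnifJet.matrix_mul hE
      (N := fun i y => G i (_root_.normalChart (G i) (x i) (P i) y))
      fun a b => H.comp_normalChart ((H.metric a b).mono (by norm_num)))
  exact UnifJet.sum Finset.univ fun k _ => (hinv l k).mul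
    ((UnifJet.const (H.mul_frameChr a k b)).sub (UnifJet.matrix_mul (UnifJet.matrix_mul hJ
      (N := fun i y => chrUpper (G i) (_root_.normalChart (G i) (x i) (P i) y) k)
      fun c d => H.comp_normalChart (H.christoffel k c d)) H.chartJac a b))

variable {X : ι → EuclideanSpace ℝ (Fin n)}

theorem gramFactor_mulVec (H : UnifFrames G x P) (hX : ∀ a, (fun i => X i a) =O[⊤] fun _ => (1 : ℝ))
    (a : Fin n) : UnifJet 2 (fun i y => ∑ k, _root_.gramFactor (G i) (x i) (P i) y a k * X i k)
      (fun _ => 0) :=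
  UnifJet.sum Finset.univ fun k _ => (H.gramFactor a k).mul (UnifJet.const (hX k))

theorem chartKappa (H : UnifFrames G x P) (hX : ∀ a, (fun i => X i a) =O[⊤] fun _ => (1 : ℝ))
    (a b : Fin n) :
    UnifJet 2 (fun i y => chartKappa (G i) (x i) (P i) (X i) a b y) (fun _ => 0) :=
  ((H.gramFactor_mulVec hX a).mul (H.gramFactor_mulVec hX b)).sub
    ((UnifJet.const (hX a)).mul (UnifJet.const (hX b)))

theorem chartDrift (H : UnifFrames G x P) (hX : ∀ a, (fun i => X i a) =O[⊤] fun _ => (1 : ℝ))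
    (l : Fin n) :
    UnifJet 2 (fun i y => chartDrift (G i) (x i) (P i) (X i) l y) (fun _ => 0) :=
  UnifJet.sum Finset.univ fun a _ => UnifJet.sum Finset.univ fun b _ =>
    ((H.gramFactor_mulVec hX a).mul (H.gramFactor_mulVec hX b)).mul (H.chartOmega l a b)

end UnifFrames

end UniformFrames

/-! ### Jets from partial derivatives -/

section PartialDerivatives

variable {ι κ : Type*} [Fintype κ] {E : Type*} [NormedAddCommGroup E] [NormedSpace ℝ E]
  {e : κ → E} {L : κ → E →L[ℝ] ℝ}

theorem fderiv_eq_sum_dirD (heL : ∀ w, w = ∑ j, L j w • e j) (h : E → ℝ) (y : E) :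
    fderiv ℝ h y = ∑ j, dirD (e j) h y • L j := by
  ext w
  conv_lhs => rw [heL w, map_sum]
  simp only [map_smul, smul_eq_mul, sum_apply, smul_apply, dirD]
  exact Finset.sum_congr rfl fun j _ => mul_comm _ _

/-- A family has bounded `(k + 1)`-jets if its values are bounded and its partial derivatives have
bounded `k`-jets. -/
theorem UnifJet.of_dirD {k : ℕ} {h : ι → E → ℝ} {x : ι → E} (heL : ∀ w, w = ∑ j, L j w • e j)
    (hc : ∀ i, ContDiffAt ℝ (k + 1 : ℕ) (h i) (x i))
    (h0 : (fun i => h i (x i)) =O[⊤] fun _ => (1 : ℝ))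
    (h1 : ∀ j, UnifJet k (fun i => dirD (e j) (h i)) x) : UnifJet (k + 1) h x := by
  have hd : UnifJet k (fun i => _root_.fderiv ℝ (h i)) x := by
    have := UnifJet.sum Finset.univ fun j _ => (h1 j).clm_comp
      ((1 : ℝ →L[ℝ] ℝ).smulRight (L j))
    refine this.congr fun i => Eventually.of_forall fun y => ?_
    rw [fderiv_eq_sum_dirD heL]; simp
  obtain ⟨C, hC0, hC⟩ := hd.exists_bound
  obtain ⟨C', hC'⟩ := isBigO_one_iff.1 h0
  refine UnifJet.of_bound hc (C + |C'|) fun i m hm => ?_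
  match m with
  | 0 =>
    rw [norm_iteratedFDeriv_zero]
    exact (hC' i).trans ((le_abs_self _).trans (by linarith))
  | m + 1 =>
    rw [← norm_iteratedFDeriv_fderiv]
    exact (hC i m (by omega)).trans (by linarith [abs_nonneg C'])

theorem UnifJet.zero_of_isBigO {F : Type*} [NormedAddCommGroup F] [NormedSpace ℝ F]
    {h : ι → E → F} {x : ι → E} (hc : ∀ i, ContDiffAt ℝ 0 (h i) (x i))
    (h0 : (fun i => h i (x i)) =O[⊤] fun _ => (1 : ℝ)) : UnifJet 0 h x := by
  obtain ⟨C', hC'⟩ := isBigO_one_iff.1 h0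
  refine UnifJet.of_bound hc C' fun i m hm => ?_
  obtain rfl : m = 0 := by omega
  rw [norm_iteratedFDeriv_zero]; exact hC' i

theorem norm_fderiv_le_sum (heL : ∀ w, w = ∑ j, L j w • e j) (h : E → ℝ) (y : E) :
    ‖fderiv ℝ h y‖ ≤ ∑ j, |dirD (e j) h y| * ‖L j‖ := by
  rw [fderiv_eq_sum_dirD heL]
  refine (norm_sum_le _ _).trans (Finset.sum_le_sum fun j _ => ?_)
  rw [norm_smul, Real.norm_eq_abs]

theorem norm_iteratedFDeriv_two_le_sum (heL : ∀ w, w = ∑ j, L j w • e j) {h : E → ℝ} {y : E}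
    (hh : ContDiffAt ℝ 2 h y) :
    ‖iteratedFDeriv ℝ 2 h y‖
      ≤ ∑ j, (∑ l, |dirD (e l) (dirD (e j) h) y| * ‖L l‖) * ‖L j‖ := by
  rw [← norm_iteratedFDeriv_fderiv, norm_iteratedFDeriv_one]
  have e1 : fderiv ℝ h = fun z => ∑ j, dirD (e j) h z • L j :=
    funext fun z => fderiv_eq_sum_dirD heL h z
  have hd : ∀ j, DifferentiableAt ℝ (dirD (e j) h) y := fun j =>
    (ContDiffAt.dirD (k := 1) hh (e j)).differentiableAt (by norm_num)
  have h2 := (HasFDerivAt.fun_sum (u := Finset.univ) fun j _ =>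
    (hd j).hasFDerivAt.smul_const (L j)).fderiv
  rw [e1, h2]
  refine (norm_sum_le _ _).trans (Finset.sum_le_sum fun j _ => ?_)
  rw [ContinuousLinearMap.norm_smulRight_apply]
  exact mul_le_mul_of_nonneg_right (norm_fderiv_le_sum heL _ _) (norm_nonneg _)

end PartialDerivatives

/-! ### Covariant bounds and coordinate bounds -/

section CovariantBounds

variable {n : ℕ}

theorem eq_sum_proj_smul (w : EuclideanSpace ℝ (Fin n)) :
    w = ∑ j, EuclideanSpace.proj (𝕜 := ℝ) j w • stdE j := eq_sum_stdE w

/-- The components of a tensor in the frame given by the columns of `P`. -/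
def frameComp {k : ℕ} (P : Matrix (Fin n) (Fin n) ℝ) (T : (Fin k → Fin n) → ℝ)
    (μ : Fin k → Fin n) : ℝ :=
  ∑ κ, (∏ s, P (κ s) (μ s)) * T κ

theorem tensorNormSq_eq_sum {k : ℕ} {G : EuclideanSpace ℝ (Fin n) → Matrix (Fin n) (Fin n) ℝ}
    {x : EuclideanSpace ℝ (Fin n)} {P : Matrix (Fin n) (Fin n) ℝ} (hP : Pᵀ * G x * P = 1)
    (T : TensorComponents n k) :
    tensorNormSq G T x = ∑ μ, frameComp P (T x) μ ^ 2 := by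
  have h1 : ∀ κ κ' : Fin k → Fin n, ∏ s, (G x)⁻¹ (κ s) (κ' s)
      = ∑ μ : Fin k → Fin n, (∏ s, P (κ s) (μ s)) * ∏ s, P (κ' s) (μ s) := by
    intro κ κ'
    have : ∀ s, (G x)⁻¹ (κ s) (κ' s) = ∑ m, P (κ s) m * P (κ' s) m := by
      intro s; rw [frame_inv hP]; simp [Matrix.mul_apply]
    simp only [this, Finset.prod_univ_sum, Fintype.piFinset_univ, Finset.prod_mul_distrib]
  simp only [tensorNormSq, h1, frameComp, sq, Finset.sum_mul, Finset.mul_sum]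
  rw [Finset.sum_congr rfl fun κ _ => Finset.sum_comm, Finset.sum_comm]
  refine Finset.sum_congr rfl fun μ _ => ?_
  rw [Finset.sum_comm]
  exact Finset.sum_congr rfl fun κ _ => Finset.sum_congr rfl fun κ' _ => by ring

theorem tensorNorm_sq {k : ℕ} {G : EuclideanSpace ℝ (Fin n) → Matrix (Fin n) (Fin n) ℝ}
    {x : EuclideanSpace ℝ (Fin n)} {P : Matrix (Fin n) (Fin n) ℝ} (hP : Pᵀ * G x * P = 1)
    (T : TensorComponents n k) : tensorNorm G T x ^ 2 = ∑ μ, frameComp P (T x) μ ^ 2 := by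
  have h : 0 ≤ tensorNormSq G T x := by
    rw [tensorNormSq_eq_sum hP]; exact Finset.sum_nonneg fun _ _ => sq_nonneg _
  rw [tensorNorm, Real.sq_sqrt h, tensorNormSq_eq_sum hP]

theorem abs_frameComp_le {k : ℕ} {G : EuclideanSpace ℝ (Fin n) → Matrix (Fin n) (Fin n) ℝ}
    {x : EuclideanSpace ℝ (Fin n)} {P : Matrix (Fin n) (Fin n) ℝ} (hP : Pᵀ * G x * P = 1)
    (T : TensorComponents n k) (μ : Fin k → Fin n) :
    |frameComp P (T x) μ| ≤ tensorNorm G T x := by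
  refine abs_le_of_sq_le_sq ?_ (Real.sqrt_nonneg _)
  rw [tensorNorm_sq hP]
  exact Finset.single_le_sum (f := fun μ => frameComp P (T x) μ ^ 2) (fun _ _ => sq_nonneg _)
    (Finset.mem_univ μ)

/-- The components of a tensor in coordinates in terms of those in a frame. -/
theorem eq_sum_frameComp {k : ℕ} {P Q : Matrix (Fin n) (Fin n) ℝ} (hPQ : P * Q = 1)
    (T : (Fin k → Fin n) → ℝ) (κ : Fin k → Fin n) :
    T κ = ∑ μ, (∏ s, Q (μ s) (κ s)) * frameComp P T μ := by
  have h1 : ∀ κ', ∑ μ : Fin k → Fin n, (∏ s, Q (μ s) (κ s)) * ∏ s, P (κ' s) (μ s)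
      = if κ' = κ then 1 else 0 := by
    intro κ'
    have : ∀ s, ∑ m, Q m (κ s) * P (κ' s) m = if κ' s = κ s then 1 else 0 := by
      intro s
      have h := congrFun (congrFun hPQ (κ' s)) (κ s)
      rw [Matrix.mul_apply, Matrix.one_apply] at h
      rw [← h]; exact Finset.sum_congr rfl fun m _ => mul_comm _ _
    simp only [← Finset.prod_mul_distrib]
    rw [← Fintype.piFinset_univ, ← Finset.prod_univ_sum (t := fun _ => Finset.univ)
      (f := fun s m => Q m (κ s) * P (κ' s) m)]
    simp only [this, funext_iff, Finset.prod_ite_zero, Finset.prod_const_one, Finset.mem_univ,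
      true_imp_iff]
  simp only [frameComp, Finset.mul_sum]
  rw [Finset.sum_comm]
  simp only [← mul_assoc, ← Finset.sum_mul, h1, ite_mul, one_mul, zero_mul, Finset.sum_ite_eq',
    Finset.mem_univ, if_true]

end CovariantBounds

/-! ### Coordinate bounds for tensor fields and right-hand sides -/

namespace UnifFrames

variable {n : ℕ} {ι : Type*} {G : ι → EuclideanSpace ℝ (Fin n) → Matrix (Fin n) (Fin n) ℝ}
  {x : ι → EuclideanSpace ℝ (Fin n)} {P : ι → Matrix (Fin n) (Fin n) ℝ}

theorem isBigO_component (H : UnifFrames G x P) {k : ℕ} {T : ι → TensorComponents n k}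
    (hT : (fun i => tensorNorm (G i) (T i) (x i)) =O[⊤] fun _ => (1 : ℝ)) (κ : Fin k → Fin n) :
    (fun i => T i (x i) κ) =O[⊤] fun _ => (1 : ℝ) := by
  have hQ : ∀ a b, UnifJet 0 (fun i (_ : EuclideanSpace ℝ (Fin n)) =>
      ((P i)ᵀ * G i (x i)) a b) x := fun a b =>
    UnifJet.matrix_mul (M := fun i _ => (P i)ᵀ) (fun a b => H.frame_jet b a)
      (N := fun i _ => G i (x i)) (fun a b => UnifJet.const (H.metric a b).isBigO_apply) a b
  have hF : ∀ μ, (fun i => frameComp (P i) (T i (x i)) μ) =O[⊤] fun _ => (1 : ℝ) := by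
    intro μ
    obtain ⟨C, hC⟩ := isBigO_one_iff.1 hT
    exact isBigO_one_iff.2 ⟨C, fun i => (abs_frameComp_le (H.orthonormal i) (T i) μ).trans
      ((le_abs_self _).trans (hC i))⟩
  have := (UnifJet.sum Finset.univ fun (μ : Fin k → Fin n) _ =>
    (UnifJet.prod Finset.univ fun s _ => hQ (μ s) (κ s)).mul
      (UnifJet.const (hF μ))).isBigO_apply
  refine this.congr_left fun i => ?_
  exact (eq_sum_frameComp (frame_mul (H.orthonormal i)) (T i (x i)) κ).symm

theorem contDiffAt_covDeriv (H : UnifFrames G x P) {k j : ℕ} (hj : j ≤ 2)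
    {T : ι → TensorComponents n k}
    (hT : ∀ i κ, ContDiffAt ℝ (j + 1 : ℕ) (fun y => T i y κ) (x i)) (i : ι)
    (κ : Fin (k + 1) → Fin n) : ContDiffAt ℝ j (fun y => covDeriv (G i) (T i) y κ) (x i) := by
  refine ContDiffAt.sub (ContDiffAt.dirD (k := j) (hT i (Fin.tail κ)) (stdE (κ 0)))
    (ContDiffAt.sum fun s _ => ContDiffAt.sum fun l _ => ContDiffAt.mul ?_ ?_)
  · exact ((H.christoffel l (κ 0) (κ s.succ)).contDiffAt i).of_le (by exact_mod_cast hj)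
  · exact (hT i _).of_le (by exact_mod_cast Nat.le_succ j)

theorem unifJet_succ (H : UnifFrames G x P) {k j : ℕ} (hj : j ≤ 2) {T : ι → TensorComponents n k}
    (hc : ∀ i κ, ContDiffAt ℝ (j + 1 : ℕ) (fun y => T i y κ) (x i))
    (hT : ∀ κ, UnifJet j (fun i y => T i y κ) x)
    (hT' : ∀ κ, UnifJet j (fun i y => covDeriv (G i) (T i) y κ) x) (κ : Fin k → Fin n) :
    UnifJet (j + 1) (fun i y => T i y κ) x := by
  refine UnifJet.of_dirD eq_sum_proj_smul (fun i => hc i κ) (hT κ).isBigO_apply fun m => ?_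
  have := (hT' (Fin.cons m κ)).add (UnifJet.sum Finset.univ fun (s : Fin k) _ =>
    UnifJet.sum Finset.univ fun (l : Fin n) _ =>
      ((H.christoffel l m (κ s)).mono hj).mul (hT (Function.update κ s l)))
  refine this.congr fun i => Eventually.of_forall fun y => ?_
  simp only [covDeriv, Fin.cons_zero, Fin.tail_cons, Fin.cons_succ, sub_add_cancel]
  rfl

/-- Bounds of a tensor field in terms of covariant derivatives give bounds of its components. -/
theorem unifJet_two (H : UnifFrames G x P) {k : ℕ} {T : ι → TensorComponents n k}
    (hc : ∀ i κ, ContDiffAt ℝ 2 (fun y => T i y κ) (x i))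
    (h0 : (fun i => tensorNorm (G i) (T i) (x i)) =O[⊤] fun _ => (1 : ℝ))
    (h1 : (fun i => tensorNorm (G i) (covDeriv (G i) (T i)) (x i)) =O[⊤] fun _ => (1 : ℝ))
    (h2 : (fun i => tensorNorm (G i) (covDeriv (G i) (covDeriv (G i) (T i))) (x i))
      =O[⊤] fun _ => (1 : ℝ)) (κ : Fin k → Fin n) : UnifJet 2 (fun i y => T i y κ) x := by
  have c1 := H.contDiffAt_covDeriv (j := 1) (by norm_num) (T := T) hc
  have c2 := H.contDiffAt_covDeriv (j := 0) (by norm_num) (T := fun i => covDeriv (G i) (T i)) c1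
  have j0 : ∀ κ, UnifJet 0 (fun i y => T i y κ) x := fun κ =>
    UnifJet.zero_of_isBigO (fun i => (hc i κ).of_le (by norm_num)) (H.isBigO_component h0 κ)
  have j1 : ∀ κ, UnifJet 0 (fun i y => covDeriv (G i) (T i) y κ) x := fun κ =>
    UnifJet.zero_of_isBigO (fun i => (c1 i κ).of_le (by norm_num)) (H.isBigO_component h1 κ)
  have j2 : ∀ κ, UnifJet 0 (fun i y => covDeriv (G i) (covDeriv (G i) (T i)) y κ) x := fun κ =>
    UnifJet.zero_of_isBigO (fun i => c2 i κ) (H.isBigO_component h2 κ)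
  have k1 := H.unifJet_succ (j := 0) (by norm_num) (T := fun i => covDeriv (G i) (T i)) c1 j1 j2
  have k0 := H.unifJet_succ (j := 0) (by norm_num) (T := T)
    (fun i κ => (hc i κ).of_le (by norm_num)) j0 j1
  exact H.unifJet_succ (j := 1) (by norm_num) (T := T) hc k0 k1 κ

/-- Bounds for a function of the point and of a real variable. -/
theorem unifJet_function (H : UnifFrames G x P) {f : ι → EuclideanSpace ℝ (Fin n) → ℝ → ℝ}
    {z : ι → ℝ} (hc : ∀ i, ContDiffAt ℝ 2 (fun p : EuclideanSpace ℝ (Fin n) × ℝ => f i p.1 p.2)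
      (x i, z i))
    (h0 : (fun i => f i (x i) (z i)) =O[⊤] fun _ => (1 : ℝ))
    (h1 : (fun i => tensorNorm (G i) (gradTensor (G i) fun y => f i y (z i)) (x i))
      =O[⊤] fun _ => (1 : ℝ))
    (h2 : (fun i => deriv (f i (x i)) (z i)) =O[⊤] fun _ => (1 : ℝ))
    (h3 : (fun i => tensorNorm (G i) (hessTensor (G i) fun y => f i y (z i)) (x i))
      =O[⊤] fun _ => (1 : ℝ))
    (h4 : (fun i => tensorNorm (G i) (gradTensor (G i) fun y => deriv (f i y) (z i)) (x i))
      =O[⊤] fun _ => (1 : ℝ))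
    (h5 : (fun i => deriv (deriv (f i (x i))) (z i)) =O[⊤] fun _ => (1 : ℝ)) :
    UnifJet 2 (fun i (p : EuclideanSpace ℝ (Fin n) × ℝ) => f i p.1 p.2) (fun i => (x i, z i)) := by
  set fh : ι → EuclideanSpace ℝ (Fin n) × ℝ → ℝ := fun i p => f i p.1 p.2 with hfh
  -- partial derivatives in the directions of the factors
  have hl : ∀ (g : EuclideanSpace ℝ (Fin n) × ℝ → ℝ) (p : EuclideanSpace ℝ (Fin n) × ℝ)
      (Y : EuclideanSpace ℝ (Fin n)), DifferentiableAt ℝ g p →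
      dirD ((Y, 0) : EuclideanSpace ℝ (Fin n) × ℝ) g p = dirD Y (fun y => g (y, p.2)) p.1 := by
    intro g p Y hg
    have := (hg.hasFDerivAt.comp p.1 (hasFDerivAt_prodMk_left (𝕜 := ℝ) p.1 p.2)).fderiv
    exact (congrArg (fun L => L Y) this).symm
  have hr : ∀ (g : EuclideanSpace ℝ (Fin n) × ℝ → ℝ) (p : EuclideanSpace ℝ (Fin n) × ℝ),
      DifferentiableAt ℝ g p →
      dirD ((0, 1) : EuclideanSpace ℝ (Fin n) × ℝ) g p = deriv (fun s => g (p.1, s)) p.2 := by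
    intro g p hg
    have := (hg.hasFDerivAt.comp p.2 (hasFDerivAt_prodMk_right (𝕜 := ℝ) p.1 p.2)).fderiv
    rw [← fderiv_apply_one_eq_deriv]
    exact (congrArg (fun L => L 1) this).symm
  have hd : ∀ i, ∀ᶠ p in 𝓝 (x i, z i), DifferentiableAt ℝ (fh i) p := fun i =>
    eventually_differentiableAt ((hc i).of_le (m := 1) (by norm_num))
  have hdd : ∀ i, DifferentiableAt ℝ (fh i) (x i, z i) := fun i => (hd i).self_of_nhds
  have hcd : ∀ i Y, ContDiffAt ℝ 1 (dirD Y (fh i)) (x i, z i) := fun i Y =>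
    ContDiffAt.dirD (k := 1) (hc i) Y
  have hcd' : ∀ i Y, DifferentiableAt ℝ (dirD Y (fh i)) (x i, z i) := fun i Y =>
    (hcd i Y).differentiableAt (by norm_num)
  have tl : ∀ i, Tendsto (fun y => (y, z i)) (𝓝 (x i)) (𝓝 (x i, z i)) := fun i =>
    (Continuous.prodMk_left (z i)).tendsto _
  have tr : ∀ i, Tendsto (fun s => (x i, s)) (𝓝 (z i)) (𝓝 (x i, z i)) := fun i =>
    (Continuous.prodMk_right (x i)).tendsto _
  have a1 : ∀ j, (fun i => dirD ((stdE j, 0) : EuclideanSpace ℝ (Fin n) × ℝ) (fh i) (x i, z i))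
      =O[⊤] fun _ => (1 : ℝ) := by
    intro j
    refine (H.isBigO_component h1 ![j]).congr_left fun i => ?_
    rw [gradTensor_eq, hl _ _ _ (hdd i)]
    rfl
  have a2 : (fun i => dirD ((0, 1) : EuclideanSpace ℝ (Fin n) × ℝ) (fh i) (x i, z i))
      =O[⊤] fun _ => (1 : ℝ) :=
    h2.congr_left fun i => (hr _ _ (hdd i)).symm
  have b1 : ∀ j l, (fun i => dirD ((stdE j, 0) : EuclideanSpace ℝ (Fin n) × ℝ)
      (dirD ((stdE l, 0) : EuclideanSpace ℝ (Fin n) × ℝ) (fh i))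
      (x i, z i)) =O[⊤] fun _ => (1 : ℝ) := by
    intro j l
    have hΓ : ∀ m, UnifJet 0 (fun i (_ : EuclideanSpace ℝ (Fin n)) =>
      _root_.christoffel (G i) (x i) m j l) x := fun m =>
      UnifJet.const (H.christoffel m j l).isBigO_apply
    have := ((UnifJet.const (k := 0) (x := x) (H.isBigO_component h3 ![j, l])).add
      (UnifJet.sum Finset.univ fun m _ => (hΓ m).mul (UnifJet.const (a1 m)))).isBigO_apply
    refine this.congr_left fun i => ?_
    rw [hl _ _ _ (hcd' i _), hessTensor_eq]
    have e1 : ∀ m, dirD ((stdE m, 0) : EuclideanSpace ℝ (Fin n) × ℝ) (fh i) (x i, z i)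
        = dirD (stdE m) (fun y => f i y (z i)) (x i) := fun m => hl _ _ _ (hdd i)
    have e2 : (fun y => dirD ((stdE l, 0) : EuclideanSpace ℝ (Fin n) × ℝ) (fh i) (y, z i)) =ᶠ[𝓝 (x i)]
        dirD (stdE l) (fun y => f i y (z i)) := by
      filter_upwards [(tl i).eventually (hd i)] with y hy
      exact hl _ _ _ hy
    rw [(e2.dirD (stdE j)).eq_of_nhds]
    simp only [e1]
    exact sub_add_cancel _ _
  have b2 : ∀ j, (fun i => dirD ((stdE j, 0) : EuclideanSpace ℝ (Fin n) × ℝ)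
      (dirD ((0, 1) : EuclideanSpace ℝ (Fin n) × ℝ) (fh i))
      (x i, z i)) =O[⊤] fun _ => (1 : ℝ) := by
    intro j
    refine (H.isBigO_component h4 ![j]).congr_left fun i => ?_
    rw [gradTensor_eq, hl _ _ _ (hcd' i _)]
    have e2 : (fun y => dirD ((0, 1) : EuclideanSpace ℝ (Fin n) × ℝ) (fh i) (y, z i)) =ᶠ[𝓝 (x i)]
        fun y => deriv (f i y) (z i) := by
      filter_upwards [(tl i).eventually (hd i)] with y hy
      exact hr _ _ hy
    exact ((e2.dirD (stdE j)).eq_of_nhds).symm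
  have b3 : ∀ j, (fun i => dirD ((0, 1) : EuclideanSpace ℝ (Fin n) × ℝ)
      (dirD ((stdE j, 0) : EuclideanSpace ℝ (Fin n) × ℝ) (fh i))
      (x i, z i)) =O[⊤] fun _ => (1 : ℝ) := fun j =>
    (b2 j).congr_left fun i => (dirD_comm (hc i) _ _).eq_of_nhds
  have b4 : (fun i => dirD ((0, 1) : EuclideanSpace ℝ (Fin n) × ℝ)
      (dirD ((0, 1) : EuclideanSpace ℝ (Fin n) × ℝ) (fh i))
      (x i, z i)) =O[⊤] fun _ => (1 : ℝ) := by
    refine h5.congr_left fun i => ?_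
    rw [hr _ _ (hcd' i _)]
    have e2 : (fun s => dirD ((0, 1) : EuclideanSpace ℝ (Fin n) × ℝ) (fh i) (x i, s)) =ᶠ[𝓝 (z i)]
        deriv (f i (x i)) := by
      filter_upwards [(tr i).eventually (hd i)] with y hy
      exact hr _ _ hy
    exact e2.deriv_eq.symm
  -- a basis of the product
  set e : Fin n ⊕ Unit → EuclideanSpace ℝ (Fin n) × ℝ :=
      Sum.elim (fun j => (stdE j, 0)) (fun _ => (0, 1)) with he
  set L : Fin n ⊕ Unit → EuclideanSpace ℝ (Fin n) × ℝ →L[ℝ] ℝ := Sum.elim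
    (fun j => (EuclideanSpace.proj (𝕜 := ℝ) j).comp
      (ContinuousLinearMap.fst ℝ (EuclideanSpace ℝ (Fin n)) ℝ))
    (fun _ => ContinuousLinearMap.snd ℝ (EuclideanSpace ℝ (Fin n)) ℝ) with hL
  have heL : ∀ w, w = ∑ j, L j w • e j := by
    rintro ⟨w, s⟩
    rw [Fintype.sum_sum_type]
    simp only [hL, he, Sum.elim_inl, Sum.elim_inr, Finset.univ_unique, Finset.sum_singleton]
    refine Prod.ext ?_ ?_
    · simp only [Prod.fst_add, Prod.fst_sum, Prod.smul_fst, smul_zero, add_zero]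
      exact eq_sum_stdE w
    · simp [Prod.snd_sum]
  refine UnifJet.of_dirD (k := 1) heL hc h0 fun j => ?_
  refine UnifJet.of_dirD (k := 0) heL (fun i => hcd i _) ?_ fun l => ?_
  · rcases j with j | j
    · exact a1 j
    · exact a2
  · refine UnifJet.zero_of_isBigO (fun i => ContDiffAt.dirD (k := 0) (hcd i _) _) ?_
    rcases j with j | j <;> rcases l with l | l
    · exact b1 l j
    · exact b3 j
    · exact b2 l
    · exact b4

end UnifFrames

/-! ### The equation in an orthonormal frame -/

section FrameEquation

variable {n : ℕ} {G : EuclideanSpace ℝ (Fin n) → Matrix (Fin n) (Fin n) ℝ}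
  {z : EuclideanSpace ℝ (Fin n)} {Q : Matrix (Fin n) (Fin n) ℝ}

theorem sum_fin_one_arrow (f : (Fin 1 → Fin n) → ℝ) : ∑ κ, f κ = ∑ i, f ![i] := by
  refine Fintype.sum_equiv (Equiv.funUnique (Fin 1) (Fin n)) _ _ fun κ => congrArg f ?_
  funext s; fin_cases s; rfl

theorem sum_fin_two_arrow (f : (Fin 2 → Fin n) → ℝ) : ∑ κ, f κ = ∑ i, ∑ j, f ![i, j] := by
  rw [← Fintype.sum_prod_type']
  refine Fintype.sum_equiv (finTwoArrowEquiv (Fin n)) _ _ fun κ => congrArg f ?_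
  funext s; fin_cases s <;> rfl

/-- The components of `du` in the frame given by the columns of `Q`. -/
def frameGrad (u : EuclideanSpace ℝ (Fin n) → ℝ) (z : EuclideanSpace ℝ (Fin n))
    (Q : Matrix (Fin n) (Fin n) ℝ) (m : Fin n) : ℝ :=
  ∑ i, Q i m * dirD (stdE i) u z

/-- The components of `∇²u` in the frame given by the columns of `Q`. -/
def frameHess (G : EuclideanSpace ℝ (Fin n) → Matrix (Fin n) (Fin n) ℝ)
    (u : EuclideanSpace ℝ (Fin n) → ℝ) (z : EuclideanSpace ℝ (Fin n))
    (Q : Matrix (Fin n) (Fin n) ℝ) : Matrix (Fin n) (Fin n) ℝ :=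
  Qᵀ * hessMat G u z * Q

theorem frame_mul_apply (M : Matrix (Fin n) (Fin n) ℝ) (m m' : Fin n) :
    (Qᵀ * M * Q) m m' = ∑ i, ∑ j, Q i m * Q j m' * M i j := by
  simp only [Matrix.mul_apply, Matrix.transpose_apply, Finset.sum_mul]
  rw [Finset.sum_comm]
  exact Finset.sum_congr rfl fun p _ => Finset.sum_congr rfl fun q _ => by ring

theorem tensorNorm_grad_sq (hQ : Qᵀ * G z * Q = 1) (u : EuclideanSpace ℝ (Fin n) → ℝ) :
    tensorNorm G (gradTensor G u) z ^ 2 = ∑ m, frameGrad u z Q m ^ 2 := by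
  rw [tensorNorm_sq hQ, sum_fin_one_arrow]
  refine Finset.sum_congr rfl fun m _ => ?_
  rw [frameComp, sum_fin_one_arrow]
  simp [gradTensor_eq, frameGrad]

theorem tensorNormSq_grad (hQ : Qᵀ * G z * Q = 1) (u : EuclideanSpace ℝ (Fin n) → ℝ) :
    tensorNormSq G (gradTensor G u) z = ∑ m, frameGrad u z Q m ^ 2 := by
  rw [tensorNormSq_eq_sum hQ, ← tensorNorm_sq hQ, tensorNorm_grad_sq hQ]

theorem tensorNorm_hess_sq (hQ : Qᵀ * G z * Q = 1) (u : EuclideanSpace ℝ (Fin n) → ℝ) :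
    tensorNorm G (hessTensor G u) z ^ 2 = ∑ m, ∑ m', frameHess G u z Q m m' ^ 2 := by
  rw [tensorNorm_sq hQ, sum_fin_two_arrow]
  refine Finset.sum_congr rfl fun m _ => Finset.sum_congr rfl fun m' _ => ?_
  rw [frameComp, sum_fin_two_arrow, frameHess, frame_mul_apply]
  simp [hessMat, Fin.prod_univ_two]

theorem laplacianOf_eq (hQ : Qᵀ * G z * Q = 1) (u : EuclideanSpace ℝ (Fin n) → ℝ) :
    laplacianOf G u z = ∑ l, frameHess G u z Q l l := by
  simp only [frameHess, frame_mul_apply]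
  rw [Finset.sum_comm, laplacianOf]
  refine Finset.sum_congr rfl fun i _ => ?_
  rw [Finset.sum_comm]
  refine Finset.sum_congr rfl fun j _ => ?_
  rw [frame_inv hQ, Matrix.mul_apply, Finset.sum_mul]
  exact Finset.sum_congr rfl fun l _ => by simp [hessMat]

theorem frame_tensorW (hQ : Qᵀ * G z * Q = 1) (t : ℝ) (a b : EuclideanSpace ℝ (Fin n) → ℝ)
    (S : EuclideanSpace ℝ (Fin n) → Matrix (Fin n) (Fin n) ℝ)
    (u : EuclideanSpace ℝ (Fin n) → ℝ) (m m' : Fin n) :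
    (Qᵀ * tensorW G t a b S u z * Q) m m' = frameHess G u z Q m m'
      + (1 - t) / ((n : ℝ) - 2) * (∑ l, frameHess G u z Q l l) * (1 : Matrix _ _ ℝ) m m'
      + a z * frameGrad u z Q m * frameGrad u z Q m'
      + b z * (∑ l, frameGrad u z Q l ^ 2) * (1 : Matrix _ _ ℝ) m m'
      + (Qᵀ * S z * Q) m m' := by
  have e : tensorW G t a b S u z = hessMat G u z
      + ((1 - t) / ((n : ℝ) - 2) * ∑ l, frameHess G u z Q l l) • G z
      + a z • Matrix.of (fun i j => dirD (stdE i) u z * dirD (stdE j) u z)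
      + (b z * ∑ l, frameGrad u z Q l ^ 2) • G z + S z := by
    ext i j
    simp only [tensorW, Matrix.of_apply, Matrix.add_apply, Matrix.smul_apply, smul_eq_mul,
      gradTensor_eq, laplacianOf_eq hQ, tensorNormSq_grad hQ, hessMat, Matrix.cons_val_zero]
    ring
  have e2 : (Qᵀ * Matrix.of (fun i j => dirD (stdE i) u z * dirD (stdE j) u z) * Q) m m'
      = frameGrad u z Q m * frameGrad u z Q m' := by
    rw [frame_mul_apply, frameGrad, frameGrad, Finset.sum_mul_sum]
    exact Finset.sum_congr rfl fun p _ => Finset.sum_congr rfl fun q _ => by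
      rw [Matrix.of_apply]; ring
  rw [e]
  simp only [Matrix.mul_add, Matrix.add_mul, Matrix.mul_smul, Matrix.smul_mul, hQ,
    Matrix.add_apply, Matrix.smul_apply, smul_eq_mul, e2]
  rw [frameHess]
  ring

theorem isDiagonalized_of_frame (hQ : Qᵀ * G z * Q = 1) {t : ℝ}
    {a b : EuclideanSpace ℝ (Fin n) → ℝ}
    {S : EuclideanSpace ℝ (Fin n) → Matrix (Fin n) (Fin n) ℝ}
    {u : EuclideanSpace ℝ (Fin n) → ℝ} {lam : Fin n → ℝ}
    (hlam : Qᵀ * tensorW G t a b S u z * Q = Matrix.diagonal lam) :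
    IsDiagonalized ((1 - t) / ((n : ℝ) - 2)) (a z) (b z) (frameGrad u z Q)
      (frameHess G u z Q) (Qᵀ * S z * Q) lam := by
  refine ⟨fun m => ?_, fun m l hml => ?_⟩
  · have := frame_tensorW hQ t a b S u m m
    rw [hlam, Matrix.diagonal_apply_eq, Matrix.one_apply_eq] at this
    rw [this]; ring
  · have := frame_tensorW hQ t a b S u m l
    rw [hlam, Matrix.diagonal_apply_ne _ hml, Matrix.one_apply_ne hml] at this
    rw [this]; ring

theorem frameHess_mul (O : Matrix (Fin n) (Fin n) ℝ) (u : EuclideanSpace ℝ (Fin n) → ℝ) :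
    frameHess G u z (Q * O) = Oᵀ * frameHess G u z Q * O := by
  simp only [frameHess, Matrix.transpose_mul, Matrix.mul_assoc]

theorem frame_mul_orthogonal {g O : Matrix (Fin n) (Fin n) ℝ} (hQ : Qᵀ * g * Q = 1)
    (hO : Oᵀ * O = 1) : (Q * O)ᵀ * g * (Q * O) = 1 := by
  have : (Q * O)ᵀ * g * (Q * O) = Oᵀ * (Qᵀ * g * Q) * O := by
    simp only [Matrix.transpose_mul, Matrix.mul_assoc]
  rw [this, hQ, Matrix.mul_one, hO]

theorem sum_frameGrad_mul {O : Matrix (Fin n) (Fin n) ℝ} (hO : Oᵀ * O = 1)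
    (hQ : Qᵀ * G z * Q = 1) (u : EuclideanSpace ℝ (Fin n) → ℝ) :
    ∑ l, frameGrad u z (Q * O) l ^ 2 = ∑ l, frameGrad u z Q l ^ 2 := by
  rw [← tensorNormSq_grad (frame_mul_orthogonal hQ hO), tensorNormSq_grad hQ]

theorem frameHess_symm (hG : ∀ᶠ y in 𝓝 z, (G y)ᵀ = G y) {u : EuclideanSpace ℝ (Fin n) → ℝ}
    (hu : ContDiffAt ℝ 2 u z) (m l : Fin n) :
    frameHess G u z Q m l = frameHess G u z Q l m := by
  have h : ∀ i j, hessMat G u z i j = hessMat G u z j i := by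
    intro i j
    simp only [hessMat, Matrix.of_apply, hessTensor_eq, Matrix.cons_val_zero, Matrix.cons_val_one]
    rw [(dirD_comm hu _ _).eq_of_nhds]
    simp only [christoffel_symm hG _ i j]
  rw [frameHess, frame_mul_apply, frame_mul_apply, Finset.sum_comm]
  exact Finset.sum_congr rfl fun p _ => Finset.sum_congr rfl fun q _ => by rw [h]; ring

/-- A unit vector is a column of an orthogonal matrix. -/
theorem exists_orthogonal_column (k₀ : Fin n) {v : Fin n → ℝ} (hv : ∑ m, v m ^ 2 = 1) :
    ∃ O : Matrix (Fin n) (Fin n) ℝ, Oᵀ * O = 1 ∧ ∀ m, O m k₀ = v m := by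
  have hn : ‖(WithLp.toLp 2 v : EuclideanSpace ℝ (Fin n))‖ = 1 := by
    rw [EuclideanSpace.norm_eq]; simp [hv]
  obtain ⟨b, hb⟩ := Orthonormal.exists_orthonormalBasis_extension_of_card_eq (𝕜 := ℝ)
    (E := EuclideanSpace ℝ (Fin n)) (ι := Fin n) (by simp) (v := fun _ => WithLp.toLp 2 v)
    (s := {k₀}) (by
      constructor
      · intro i; exact hn
      · intro i j hij; exact absurd (Subsingleton.elim i j) hij)
  refine ⟨Matrix.of fun m k => b k m, ?_, fun m => ?_⟩
  · ext k l
    have := orthonormal_iff_ite.1 b.orthonormal k l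
    simp only [PiLp.inner_apply, RCLike.inner_apply, conj_trivial] at this
    rw [Matrix.mul_apply, Matrix.one_apply, ← this]
    exact Finset.sum_congr rfl fun m _ => mul_comm _ _
  · rw [Matrix.of_apply, hb k₀ rfl]

end FrameEquation

/-! ### Remainder terms in the adapted frame -/

section Remainders

variable {n : ℕ}

/-- The function `u` in the coordinates `normalChart`. -/
def chartFun (G : EuclideanSpace ℝ (Fin n) → Matrix (Fin n) (Fin n) ℝ)
    (x : EuclideanSpace ℝ (Fin n)) (P : Matrix (Fin n) (Fin n) ℝ)
    (u : EuclideanSpace ℝ (Fin n) → ℝ) : EuclideanSpace ℝ (Fin n) → ℝ :=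
  fun y => u (normalChart G x P y)

/-- The covariant Hessian in direction `chartFrame *ᵥ X`, minus the coordinate one in
direction `X`. -/
def hessRem (G : EuclideanSpace ℝ (Fin n) → Matrix (Fin n) (Fin n) ℝ)
    (x : EuclideanSpace ℝ (Fin n)) (P : Matrix (Fin n) (Fin n) ℝ)
    (u : EuclideanSpace ℝ (Fin n) → ℝ) (X y : EuclideanSpace ℝ (Fin n)) : ℝ :=
  ∑ i, ∑ j, chartKappa G x P X i j y * dirD (stdE i) (dirD (stdE j) (chartFun G x P u)) y
    + ∑ l, chartDrift G x P X l y * dirD (stdE l) (chartFun G x P u) y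

/-- The square of the `m`-th component of the gradient in the frame `chartFrame`, minus that of the
`m`-th partial derivative. -/
def gradRem (G : EuclideanSpace ℝ (Fin n) → Matrix (Fin n) (Fin n) ℝ)
    (x : EuclideanSpace ℝ (Fin n)) (P : Matrix (Fin n) (Fin n) ℝ)
    (u : EuclideanSpace ℝ (Fin n) → ℝ) (m : Fin n) (y : EuclideanSpace ℝ (Fin n)) : ℝ :=
  ∑ i, ∑ j, chartKappa G x P (stdE m) i j y
    * (dirD (stdE i) (chartFun G x P u) y * dirD (stdE j) (chartFun G x P u) y)

section

variable {G : EuclideanSpace ℝ (Fin n) → Matrix (Fin n) (Fin n) ℝ}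
  {x : EuclideanSpace ℝ (Fin n)} {P : Matrix (Fin n) (Fin n) ℝ}
  {u : EuclideanSpace ℝ (Fin n) → ℝ} {y : EuclideanSpace ℝ (Fin n)}

theorem sum_frameHess_chartFrame (hG : ∀ᶠ y in 𝓝 x, (G y)ᵀ = G y)
    (hu : ContDiffAt ℝ 2 u (normalChart G x P y))
    (hy : (chartFrame G x P y)ᵀ * G (normalChart G x P y) * chartFrame G x P y = 1)
    (X : EuclideanSpace ℝ (Fin n)) :
    ∑ m, ∑ m', X m * X m' * frameHess G u (normalChart G x P y) (chartFrame G x P y) m m'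
      = dirD X (dirD X (chartFun G x P u)) y + hessRem G x P u X y := by
  rw [hessRem, ← add_assoc]; exact chartFrame_hess hG hu hy X

theorem frameHess_chartFrame_diag (hG : ∀ᶠ y in 𝓝 x, (G y)ᵀ = G y)
    (hu : ContDiffAt ℝ 2 u (normalChart G x P y))
    (hy : (chartFrame G x P y)ᵀ * G (normalChart G x P y) * chartFrame G x P y = 1) (m : Fin n) :
    frameHess G u (normalChart G x P y) (chartFrame G x P y) m m
      = dirD (stdE m) (dirD (stdE m) (chartFun G x P u)) y + hessRem G x P u (stdE m) y := by
  rw [← sum_frameHess_chartFrame hG hu hy]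
  simp [PiLp.single_apply]

theorem frameGrad_chartFrame_sq (hG : ∀ᶠ y in 𝓝 x, (G y)ᵀ = G y)
    (hu : DifferentiableAt ℝ u (normalChart G x P y)) (m : Fin n) :
    frameGrad u (normalChart G x P y) (chartFrame G x P y) m ^ 2
      = dirD (stdE m) (chartFun G x P u) y ^ 2 + gradRem G x P u m y := by
  have h1 : frameGrad u (normalChart G x P y) (chartFrame G x P y) m
      = ∑ i, gramFactor G x P y i m * dirD (stdE i) (chartFun G x P u) y :=
    chartFrame_grad hG hu m
  have h2 : dirD (stdE m) (chartFun G x P u) y ^ 2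
      = ∑ i, ∑ j, (stdE m) i * (stdE m) j
        * (dirD (stdE i) (chartFun G x P u) y * dirD (stdE j) (chartFun G x P u) y) := by
    simp [PiLp.single_apply, sq]
  have h3 : ∀ i, ∑ k, gramFactor G x P y i k * (stdE m) k = gramFactor G x P y i m := by
    intro i; simp [PiLp.single_apply]
  rw [h1, h2, gradRem, sq, Finset.sum_mul_sum, ← Finset.sum_add_distrib]
  refine Finset.sum_congr rfl fun i _ => ?_
  rw [← Finset.sum_add_distrib]
  refine Finset.sum_congr rfl fun j _ => ?_
  rw [chartKappa, h3, h3]; ring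

theorem dirD_chartFun_zero (hG : ∀ᶠ y in 𝓝 x, (G y)ᵀ = G y) (hu : DifferentiableAt ℝ u x)
    (m : Fin n) : dirD (stdE m) (chartFun G x P u) 0 = frameGrad u x P m := by
  have := dirD_comp_normalChart (u := u) (y := 0) (P := P) hG (by rwa [normalChart_zero]) m
  rwa [chartJac_zero, normalChart_zero] at this

theorem dirD_dirD_chartFun_zero (hG : ∀ᶠ y in 𝓝 x, (G y)ᵀ = G y) (hP : Pᵀ * G x * P = 1)
    (hu : ContDiffAt ℝ 2 u x) (m l : Fin n) :
    dirD (stdE m) (dirD (stdE l) (chartFun G x P u)) 0 = frameHess G u x P m l := by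
  have := chartJac_hess (u := u) (y := 0) (P := P) hG (by rwa [normalChart_zero])
    (by rw [chartFrame_zero hP, normalChart_zero, hP]) m l
  rw [chartJac_zero, normalChart_zero] at this
  simp only [chartOmega_zero hP, zero_mul, Finset.sum_const_zero, add_zero] at this
  exact this.symm

end

variable {ι : Type*} {G : ι → EuclideanSpace ℝ (Fin n) → Matrix (Fin n) (Fin n) ℝ}
  {x : ι → EuclideanSpace ℝ (Fin n)} {P : ι → Matrix (Fin n) (Fin n) ℝ}
  {u : ι → EuclideanSpace ℝ (Fin n) → ℝ} {q : ι → ℝ}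

/-- Families of functions whose gradients and Hessians at the points `x i` have sizes at most `q`
and `q ^ 2`. -/
structure WeightedFun (G : ι → EuclideanSpace ℝ (Fin n) → Matrix (Fin n) (Fin n) ℝ)
    (x : ι → EuclideanSpace ℝ (Fin n)) (P : ι → Matrix (Fin n) (Fin n) ℝ)
    (u : ι → EuclideanSpace ℝ (Fin n) → ℝ) (q : ι → ℝ) : Prop where
  contDiffAt : ∀ i, ContDiffAt ℝ 4 (u i) (x i)
  one_le : ∀ i, 1 ≤ q i
  grad_le : ∀ i m, |frameGrad (u i) (x i) (P i) m| ≤ q i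
  hess_le : ∀ i m l, |frameHess (G i) (u i) (x i) (P i) m l| ≤ q i ^ 2

theorem isBigO_coord_of_norm_le {X : ι → EuclideanSpace ℝ (Fin n)} (hX : ∀ i, ‖X i‖ ≤ 1)
    (a : Fin n) : (fun i => X i a) =O[⊤] fun _ => (1 : ℝ) :=
  isBigO_one_iff.2 ⟨1, fun i => (PiLp.norm_apply_le (X i) a).trans (hX i)⟩

namespace WeightedFun

theorem contDiffAt_chartFun (h : WeightedFun G x P u q) (i : ι) :
    ContDiffAt ℝ 4 (chartFun (G i) (x i) (P i) (u i)) 0 :=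
  ContDiffAt.comp (g := u i) 0 (by rw [normalChart_zero]; exact h.contDiffAt i)
    (contDiff_normalChart (G i) (x i) (P i)).contDiffAt

theorem abs_dirD_le (H : UnifFrames G x P) (h : WeightedFun G x P u q) (i : ι) (m : Fin n) :
    |dirD (stdE m) (chartFun (G i) (x i) (P i) (u i)) 0| ≤ q i := by
  rw [dirD_chartFun_zero (H.symm i) ((h.contDiffAt i).differentiableAt (by norm_num))]
  exact h.grad_le i m

theorem abs_dirD_dirD_le (H : UnifFrames G x P) (h : WeightedFun G x P u q) (i : ι) (m l : Fin n) :
    |dirD (stdE m) (dirD (stdE l) (chartFun (G i) (x i) (P i) (u i))) 0| ≤ q i ^ 2 := by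
  rw [dirD_dirD_chartFun_zero (H.symm i) (H.orthonormal i)
    ((h.contDiffAt i).of_le (by norm_num))]
  exact h.hess_le i m l

theorem bigW_one (H : UnifFrames G x P) (h : WeightedFun G x P u q) (m : Fin n) :
    BigW q 1 fun i => dirD (stdE m) (chartFun (G i) (x i) (P i) (u i)) 0 :=
  BigW.of_bound 1 fun i => by
    rw [pow_one, one_mul]; exact (h.abs_dirD_le H i m).trans (le_abs_self _)

theorem bigW_two (H : UnifFrames G x P) (h : WeightedFun G x P u q) (m l : Fin n) :
    BigW q 2 fun i => dirD (stdE m) (dirD (stdE l) (chartFun (G i) (x i) (P i) (u i))) 0 :=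
  BigW.of_bound 1 fun i => by
    rw [one_mul]; exact (h.abs_dirD_dirD_le H i m l).trans (le_abs_self _)

theorem bigW_dirD (H : UnifFrames G x P) (h : WeightedFun G x P u q)
    {X : ι → EuclideanSpace ℝ (Fin n)} (hX : ∀ i, ‖X i‖ ≤ 1) (l : Fin n) :
    BigW q 2 fun i => dirD (X i) (dirD (stdE l) (chartFun (G i) (x i) (P i) (u i))) 0 := by
  have e : ∀ i, dirD (X i) (dirD (stdE l) (chartFun (G i) (x i) (P i) (u i))) 0
      = ∑ m, X i m * dirD (stdE m) (dirD (stdE l) (chartFun (G i) (x i) (P i) (u i))) 0 :=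
    fun i => dirD_eq_sum _ (X i) 0
  simp only [e]
  refine BigW.sum _ fun m _ => ?_
  have := (BigW.of_isBigO_one (q := q) (isBigO_coord_of_norm_le hX m)).mul (h.bigW_two H m l)
  simpa using this

theorem bigW_dirD_dirD (H : UnifFrames G x P) (h : WeightedFun G x P u q)
    {X : ι → EuclideanSpace ℝ (Fin n)} (hX : ∀ i, ‖X i‖ ≤ 1) :
    BigW q 2 fun i => dirD (X i) (dirD (X i) (chartFun (G i) (x i) (P i) (u i))) 0 := by
  have : ∀ i, dirD (X i) (dirD (X i) (chartFun (G i) (x i) (P i) (u i))) 0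
      = ∑ l, ∑ m, X i l * X i m
        * dirD (stdE m) (dirD (stdE l) (chartFun (G i) (x i) (P i) (u i))) 0 := fun i =>
    dirD_dirD_eq_sum ((h.contDiffAt_chartFun i).of_le (by norm_num)) (X i)
  simp only [this]
  refine BigW.sum _ fun l _ => BigW.sum _ fun m _ => ?_
  have hc := fun m => BigW.of_isBigO_one (q := q) (isBigO_coord_of_norm_le hX m)
  have := ((hc l).mul (hc m)).mul (h.bigW_two H m l)
  simpa using this

/-- Second derivatives in `hessRem` come with coefficients that vanish to second order and first
derivatives with coefficients that vanish, so that no third derivative of `u` survives in its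
`2`-jet. -/
theorem jetW_hessRem (H : UnifFrames G x P) (h : WeightedFun G x P u q)
    {X : ι → EuclideanSpace ℝ (Fin n)} (hX : ∀ i, ‖X i‖ ≤ 1) :
    JetW q 2 2 3 fun i => hessRem (G i) (x i) (P i) (u i) (X i) := by
  have hX' := isBigO_coord_of_norm_le hX
  refine JetW.add (JetW.sum _ fun a _ => JetW.sum _ fun b _ => ?_) (JetW.sum _ fun l _ => ?_)
  · refine JetW.vanish_two_mul h.one_le ((H.chartKappa hX' a b).jetW h.one_le)
      (fun i => chartKappa_zero (H.orthonormal i) (X i) a b) (fun i Y => ?_) (fun i => ?_)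
      (h.bigW_two H a b)
    · exact dirD_chartKappa_zero (H.symm i)
        (fun a b => ((H.metric a b).contDiffAt i).of_le (by norm_num)) (H.orthonormal i) (X i) Y a b
    · exact ContDiffAt.dirD (k := 2) (ContDiffAt.dirD (k := 3) (h.contDiffAt_chartFun i) _) _
  · refine JetW.vanish_mul h.one_le ((H.chartDrift hX' l).jetW h.one_le)
      (fun i => chartDrift_zero (H.orthonormal i) (X i) l) (fun i => ?_)
      ((h.bigW_one H l).mono h.one_le (by norm_num)) fun Y hY =>
        (h.bigW_dirD H hY l).mono h.one_le (by norm_num)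
    exact (ContDiffAt.dirD (k := 3) (h.contDiffAt_chartFun i) _).of_le (by norm_num)

theorem contDiffAt_dirD_two (h : WeightedFun G x P u q) (i : ι) (m : Fin n) :
    ContDiffAt ℝ 2 (dirD (stdE m) (chartFun (G i) (x i) (P i) (u i))) 0 :=
  (ContDiffAt.dirD (k := 3) (h.contDiffAt_chartFun i) _).of_le (by norm_num)

theorem jetW_gradRem (H : UnifFrames G x P) (h : WeightedFun G x P u q)
    (m : Fin n) : JetW q 2 2 3 fun i => gradRem (G i) (x i) (P i) (u i) m := by
  have hX : ∀ _ : ι, ‖stdE m‖ ≤ 1 := fun _ => by simp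
  have hX' := isBigO_coord_of_norm_le hX
  refine JetW.sum _ fun a _ => JetW.sum _ fun b _ => ?_
  refine JetW.vanish_two_mul h.one_le ((H.chartKappa hX' a b).jetW h.one_le)
    (fun i => chartKappa_zero (H.orthonormal i) _ a b) (fun i Y => ?_) (fun i => ?_)
    ((h.bigW_one H a).mul (h.bigW_one H b))
  · exact dirD_chartKappa_zero (H.symm i)
      (fun a b => ((H.metric a b).contDiffAt i).of_le (by norm_num)) (H.orthonormal i) _ Y a b
  · exact (h.contDiffAt_dirD_two i a).mul (h.contDiffAt_dirD_two i b)

/-- Freezing a coefficient of the quadratic gradient terms. -/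
theorem jetW_coeff_sq (H : UnifFrames G x P) (h : WeightedFun G x P u q)
    {a : ι → EuclideanSpace ℝ (Fin n) → ℝ} (ha : UnifJet 2 a x) (m : Fin n) :
    JetW q 2 2 3 fun i y => (a i (normalChart (G i) (x i) (P i) y) - a i (x i))
      * dirD (stdE m) (chartFun (G i) (x i) (P i) (u i)) y ^ 2 := by
  have h1 : JetW q 0 0 0 fun i y => a i (normalChart (G i) (x i) (P i) y) - a i (x i) :=
    ((H.comp_normalChart ha).sub (UnifJet.const ha.isBigO_apply)).jetW h.one_le
  refine JetW.vanish_mul h.one_le h1 (fun i => ?_) (fun i => ?_) ?_ fun Y hY => ?_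
  · rw [normalChart_zero, sub_self]
  · exact (h.contDiffAt_dirD_two i m).pow 2
  · simpa only [sq] using (h.bigW_one H m).mul (h.bigW_one H m)
  · have := ((h.bigW_one H m).mul (h.bigW_dirD H hY m)).const_mul 2
    have e : ∀ i, dirD (Y i) (fun y => dirD (stdE m) (chartFun (G i) (x i) (P i) (u i)) y ^ 2) 0
        = 2 * (dirD (stdE m) (chartFun (G i) (x i) (P i) (u i)) 0
          * dirD (Y i) (dirD (stdE m) (chartFun (G i) (x i) (P i) (u i))) 0) := fun i =>
      ((HasJet.self (X := Y i) (h.contDiffAt_dirD_two i m)).sq).d1.trans (by ring)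
    simp only [e]
    exact this

theorem jetW_coeff_mul (H : UnifFrames G x P) (h : WeightedFun G x P u q)
    {a : ι → EuclideanSpace ℝ (Fin n) → ℝ} (ha : UnifJet 2 a x)
    {w : ι → EuclideanSpace ℝ (Fin n) → ℝ} (hw : JetW q 2 2 3 w) :
    JetW q 2 2 3 fun i y => a i (normalChart (G i) (x i) (P i) y) * w i y :=
  JetW.bdd_mul h.one_le ((H.comp_normalChart ha).jetW h.one_le) hw

/-- A function of the point and of `u`: each derivative costs a factor `q`. -/
theorem jetW_function (H : UnifFrames G x P) (h : WeightedFun G x P u q)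
    {f : ι → EuclideanSpace ℝ (Fin n) → ℝ → ℝ}
    (hf : UnifJet 2 (fun i (p : EuclideanSpace ℝ (Fin n) × ℝ) => f i p.1 p.2)
      (fun i => (x i, u i (x i)))) :
    JetW q 2 2 3 fun i y => f i (normalChart (G i) (x i) (P i) y)
      (chartFun (G i) (x i) (P i) (u i) y) := by
  set w : ι → EuclideanSpace ℝ (Fin n) → EuclideanSpace ℝ (Fin n) × ℝ := fun i y =>
    (normalChart (G i) (x i) (P i) y, chartFun (G i) (x i) (P i) (u i) y) with hw
  have hw0 : (fun i => w i 0) = fun i => (x i, u i (x i)) := by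
    funext i; simp [hw, chartFun, normalChart_zero]
  obtain ⟨C, hC0, hC⟩ := (H.normalChart (k := 2)).exists_bound
  have hv2 : ∀ i, ContDiffAt ℝ 2 (chartFun (G i) (x i) (P i) (u i)) 0 := fun i =>
    (h.contDiffAt_chartFun i).of_le (by norm_num)
  set A : ℝ := ∑ j : Fin n, ‖(EuclideanSpace.proj j : EuclideanSpace ℝ (Fin n) →L[ℝ] ℝ)‖ with hA
  have hA0 : 0 ≤ A := Finset.sum_nonneg fun _ _ => norm_nonneg _
  have hv1' : ∀ i, ‖iteratedFDeriv ℝ 1 (chartFun (G i) (x i) (P i) (u i)) 0‖ ≤ A * q i := by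
    intro i
    rw [norm_iteratedFDeriv_one]
    refine (norm_fderiv_le_sum eq_sum_proj_smul _ _).trans ?_
    rw [hA, Finset.sum_mul]
    refine Finset.sum_le_sum fun j _ => ?_
    rw [mul_comm]
    exact mul_le_mul_of_nonneg_left (h.abs_dirD_le H i j) (norm_nonneg _)
  have hv2' : ∀ i, ‖iteratedFDeriv ℝ 2 (chartFun (G i) (x i) (P i) (u i)) 0‖
      ≤ (A * q i) ^ 2 := by
    intro i
    refine (norm_iteratedFDeriv_two_le_sum eq_sum_proj_smul (hv2 i)).trans ?_
    have e : (A * q i) ^ 2 = ∑ j : Fin n, (∑ l : Fin n, q i ^ 2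
        * ‖(EuclideanSpace.proj l : EuclideanSpace ℝ (Fin n) →L[ℝ] ℝ)‖)
        * ‖(EuclideanSpace.proj j : EuclideanSpace ℝ (Fin n) →L[ℝ] ℝ)‖ := by
      rw [← Finset.mul_sum, ← Finset.mul_sum, ← hA]; ring
    rw [e]
    refine Finset.sum_le_sum fun j _ => mul_le_mul_of_nonneg_right
      (Finset.sum_le_sum fun l _ => mul_le_mul_of_nonneg_right (h.abs_dirD_dirD_le H i l j)
        (norm_nonneg _)) (norm_nonneg _)
  have hwc : ∀ i, ContDiffAt ℝ 2 (w i) 0 := fun i =>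
    (contDiff_normalChart (G i) (x i) (P i)).contDiffAt.prodMk (hv2 i)
  have hpair : ∀ m ≤ 2, ∀ i, ‖iteratedFDeriv ℝ m (w i) 0‖
      ≤ max ‖iteratedFDeriv ℝ m (normalChart (G i) (x i) (P i)) 0‖
        ‖iteratedFDeriv ℝ m (chartFun (G i) (x i) (P i) (u i)) 0‖ := by
    intro m hm i
    rw [iteratedFDeriv_prodMk (n := 2) (contDiff_normalChart (G i) (x i) (P i)).contDiffAt (hv2 i)
      (by exact_mod_cast hm)]
    exact (ContinuousMultilinearMap.opNorm_prod _ _).le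
  have hq0 : ∀ i, 0 ≤ q i := fun i => zero_le_one.trans (h.one_le i)
  have hCA : ∀ i, C ≤ (1 + C + A) * q i ∧ A * q i ≤ (1 + C + A) * q i ∧
      1 ≤ (1 + C + A) * q i := by
    intro i
    have := h.one_le i
    refine ⟨?_, ?_, ?_⟩ <;> nlinarith [mul_nonneg hC0 (hq0 i), mul_nonneg hA0 (hq0 i)]
  obtain ⟨hc, B, hB0, hB⟩ := UnifJet.comp_weighted (k := 2)
    (g := fun i (p : EuclideanSpace ℝ (Fin n) × ℝ) => f i p.1 p.2) (h := w) (x := fun _ => 0)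
    (by rw [hw0]; exact hf) hwc (fun i => (1 + C + A) * q i) (by
      intro m hm1 hm2 i
      refine (hpair m hm2 i).trans (max_le ?_ ?_)
      · refine (hC i m hm2).trans ((hCA i).1.trans (le_self_pow₀ (hCA i).2.2 (by omega)))
      · interval_cases m
        · rw [pow_one]; exact (hv1' i).trans (hCA i).2.1
        · exact (hv2' i).trans (pow_le_pow_left₀ (mul_nonneg hA0 (hq0 i)) (hCA i).2.1 2))
  refine (JetW.of_norm_bound (d₀ := 0) (d₁ := 1) (d₂ := 2) (C := B * (1 + C + A) ^ 2) h.one_le hc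
    ?_ ?_ ?_).mono h.one_le (by norm_num) (by norm_num) (by norm_num)
  · intro i
    refine (hB 0 (by norm_num) i).trans ?_
    rw [pow_zero, pow_zero, mul_one, mul_one]
    exact le_mul_of_one_le_right hB0 (one_le_pow₀ (by linarith))
  · intro i
    refine (hB 1 (by norm_num) i).trans ?_
    rw [pow_one, pow_one, mul_assoc]
    refine mul_le_mul_of_nonneg_left (mul_le_mul_of_nonneg_right ?_ (hq0 i)) hB0
    exact le_self_pow₀ (by linarith) (by norm_num)
  · intro i
    refine (hB 2 (by norm_num) i).trans (le_of_eq (by ring))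

end WeightedFun

end Remainders

/-! ### Solutions in coordinates -/

section Solutions

/-- A solution of the equation on the ball of radius `r` in coordinates, for which all the data are
bounded by `N`. -/
structure SolData (n : ℕ) (r t δ₁ N : ℝ) where
  /-- the metric -/
  G : EuclideanSpace ℝ (Fin n) → Matrix (Fin n) (Fin n) ℝ
  /-- the coefficient of `du ⊗ du` -/
  a : EuclideanSpace ℝ (Fin n) → ℝ
  /-- the coefficient of `|∇u|² g` -/
  b : EuclideanSpace ℝ (Fin n) → ℝ
  /-- the term of order zero -/
  S : EuclideanSpace ℝ (Fin n) → Matrix (Fin n) (Fin n) ℝ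
  /-- the right-hand side -/
  f : EuclideanSpace ℝ (Fin n) → ℝ → ℝ
  /-- the solution -/
  u : EuclideanSpace ℝ (Fin n) → ℝ
  /-- the cone -/
  Γ : Set (Fin n → ℝ)
  /-- the operator -/
  F : (Fin n → ℝ) → ℝ
  /-- the ellipticity constant -/
  ε : ℝ
  structureConditions : StructureConditions Γ F ε
  G_contDiffOn : ∀ i j, ContDiffOn ℝ 3 (fun x => G x i j) (ball 0 r)
  a_contDiffOn : ContDiffOn ℝ 2 a (ball 0 r)
  b_contDiffOn : ContDiffOn ℝ 2 b (ball 0 r)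
  S_contDiffOn : ∀ i j, ContDiffOn ℝ 2 (fun x => S x i j) (ball 0 r)
  f_contDiffOn : ContDiffOn ℝ 2 (fun p : EuclideanSpace ℝ (Fin n) × ℝ => f p.1 p.2)
    (ball 0 r ×ˢ univ)
  u_contDiffOn : ContDiffOn ℝ 4 u (ball 0 r)
  equation : ∀ x ∈ ball (0 : EuclideanSpace ℝ (Fin n)) r, ∃ lam : Fin n → ℝ,
    IsEigenvaluesWrt (G x) (tensorW G t a b S u x) lam ∧ lam ∈ Γ ∧ F lam = f x (u x)
  G_bound : MetricCThreeNormLE G r N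
  a_bound : CTwoNormLE G (scalarTensor a) r N
  b_bound : CTwoNormLE G (scalarTensor b) r N
  S_bound : CTwoNormLE G (matrixTensor S) r N
  f_bound : ∀ x ∈ ball (0 : EuclideanSpace ℝ (Fin n)) r, cSupIntegrand G f u x ≤ N
  le_coeff : ∀ x ∈ ball (0 : EuclideanSpace ℝ (Fin n)) r,
    δ₁ ≤ (1 - t) / ((n : ℝ) - 2) * a x - b x

namespace SolData

variable {n : ℕ} {r t δ₁ N : ℝ}

theorem f_pos (D : SolData n r t δ₁ N) {x : EuclideanSpace ℝ (Fin n)} (hx : x ∈ ball 0 r) :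
    0 < D.f x (D.u x) := by
  obtain ⟨lam, -, hl, h⟩ := D.equation x hx
  rw [← h]; exact D.structureConditions.positive lam hl

theorem f_le (D : SolData n r t δ₁ N) {x : EuclideanSpace ℝ (Fin n)} (hx : x ∈ ball 0 r) :
    D.f x (D.u x) ≤ N := by
  refine le_trans ?_ (D.f_bound x hx)
  unfold cSupIntegrand tensorNorm
  have := Real.sqrt_nonneg
  linarith [abs_nonneg (deriv (D.f x) (D.u x)), abs_nonneg (deriv (deriv (D.f x)) (D.u x)),
    this (tensorNormSq D.G (gradTensor D.G fun y => D.f y (D.u x)) x),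
    this (tensorNormSq D.G (hessTensor D.G fun y => D.f y (D.u x)) x),
    this (tensorNormSq D.G (gradTensor D.G fun y => deriv (D.f y) (D.u x)) x)]

theorem metric_symm (D : SolData n r t δ₁ N) {x : EuclideanSpace ℝ (Fin n)} (hx : x ∈ ball 0 r) :
    ∀ᶠ y in 𝓝 x, (D.G y)ᵀ = D.G y := by
  filter_upwards [isOpen_ball.mem_nhds hx] with y hy
  obtain ⟨lam, ⟨P, hP, -⟩, -⟩ := D.equation y hy
  exact frame_symm hP

theorem frame_sq_le (D : SolData n r t δ₁ N) {x : EuclideanSpace ℝ (Fin n)} (hx : x ∈ ball 0 r)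
    {Q : Matrix (Fin n) (Fin n) ℝ} (hQ : Qᵀ * D.G x * Q = 1) (i j : Fin n) : Q i j ^ 2 ≤ N := by
  have h1 := (D.G_bound x hx i i).2
  have h2 : (D.G x)⁻¹ i i = ∑ k, Q i k ^ 2 := by
    rw [frame_inv hQ, Matrix.mul_apply]
    exact Finset.sum_congr rfl fun k _ => (sq _).symm
  have h3 := Finset.single_le_sum (f := fun k => Q i k ^ 2) (fun k _ => sq_nonneg _)
    (Finset.mem_univ j)
  exact h3.trans (h2 ▸ (le_abs_self _).trans h1)

section Family

variable {ι : Type*} {D : ι → SolData n r t δ₁ N} {x : ι → EuclideanSpace ℝ (Fin n)}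
  {P : ι → Matrix (Fin n) (Fin n) ℝ}

theorem unifFrames (hx : ∀ i, x i ∈ ball 0 r) (hP : ∀ i, (P i)ᵀ * (D i).G (x i) * P i = 1) :
    UnifFrames (fun i => (D i).G) x P where
  metric a b := by
    refine UnifJet.of_bound (fun i => ((D i).G_contDiffOn a b).contDiffAt
      (isOpen_ball.mem_nhds (hx i))) N fun i m hm => ?_
    exact ((D i).G_bound (x i) (hx i) a b).1 m hm
  symm i := (D i).metric_symm (hx i)
  point_bdd := isBigO_one_iff.2 ⟨r, fun i => (mem_ball_zero_iff.1 (hx i)).le⟩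
  frame_bdd a b := isBigO_one_iff.2 ⟨Real.sqrt N, fun i =>
    Real.abs_le_sqrt ((D i).frame_sq_le (hx i) (hP i) a b)⟩
  orthonormal := hP

/-- The bound of a `C²` norm controls each of its terms. -/
theorem unifJet_tensor (hx : ∀ i, x i ∈ ball 0 r) (hP : ∀ i, (P i)ᵀ * (D i).G (x i) * P i = 1)
    {k : ℕ} {T : ι → TensorComponents n k}
    (hc : ∀ i κ, ContDiffOn ℝ 2 (fun y => T i y κ) (ball 0 r))
    (hT : ∀ i, CTwoNormLE (D i).G (T i) r N) (κ : Fin k → Fin n) :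
    UnifJet 2 (fun i y => T i y κ) x := by
  have h : ∀ i, tensorNorm (D i).G (T i) (x i) ≤ N ∧
      tensorNorm (D i).G (covDeriv (D i).G (T i)) (x i) ≤ N ∧
      tensorNorm (D i).G (covDeriv (D i).G (covDeriv (D i).G (T i))) (x i) ≤ N := by
    intro i
    have h1 := hT i (x i) (hx i)
    unfold tensorNorm at h1 ⊢
    have h2 := Real.sqrt_nonneg (tensorNormSq (D i).G (T i) (x i))
    have h3 := Real.sqrt_nonneg (tensorNormSq (D i).G (covDeriv (D i).G (T i)) (x i))
    have h4 := Real.sqrt_nonneg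
      (tensorNormSq (D i).G (covDeriv (D i).G (covDeriv (D i).G (T i))) (x i))
    exact ⟨by linarith, by linarith, by linarith⟩
  have hb : ∀ w : ι → ℝ, (∀ i, 0 ≤ w i) → (∀ i, w i ≤ N) → w =O[⊤] fun _ => (1 : ℝ) :=
    fun w h0 h1 => isBigO_one_iff.2 ⟨N, fun i => by
      rw [Real.norm_eq_abs, abs_of_nonneg (h0 i)]; exact h1 i⟩
  exact (unifFrames hx hP).unifJet_two
    (fun i κ => (hc i κ).contDiffAt (isOpen_ball.mem_nhds (hx i)))
    (hb _ (fun i => Real.sqrt_nonneg _) fun i => (h i).1)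
    (hb _ (fun i => Real.sqrt_nonneg _) fun i => (h i).2.1)
    (hb _ (fun i => Real.sqrt_nonneg _) fun i => (h i).2.2) κ

theorem unifJet_a (hx : ∀ i, x i ∈ ball 0 r) (hP : ∀ i, (P i)ᵀ * (D i).G (x i) * P i = 1) :
    UnifJet 2 (fun i => (D i).a) x :=
  unifJet_tensor hx hP (T := fun i => scalarTensor (D i).a) (fun i _ => (D i).a_contDiffOn)
    (fun i => (D i).a_bound) ![]

theorem unifJet_b (hx : ∀ i, x i ∈ ball 0 r) (hP : ∀ i, (P i)ᵀ * (D i).G (x i) * P i = 1) :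
    UnifJet 2 (fun i => (D i).b) x :=
  unifJet_tensor hx hP (T := fun i => scalarTensor (D i).b) (fun i _ => (D i).b_contDiffOn)
    (fun i => (D i).b_bound) ![]

theorem unifJet_S (hx : ∀ i, x i ∈ ball 0 r) (hP : ∀ i, (P i)ᵀ * (D i).G (x i) * P i = 1)
    (j k : Fin n) : UnifJet 2 (fun i y => (D i).S y j k) x :=
  unifJet_tensor hx hP (T := fun i => matrixTensor (D i).S)
    (fun i κ => (D i).S_contDiffOn (κ 0) (κ 1)) (fun i => (D i).S_bound) ![j, k]

theorem unifJet_f (hx : ∀ i, x i ∈ ball 0 r) (hP : ∀ i, (P i)ᵀ * (D i).G (x i) * P i = 1) :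
    UnifJet 2 (fun i (p : EuclideanSpace ℝ (Fin n) × ℝ) => (D i).f p.1 p.2)
      (fun i => (x i, (D i).u (x i))) := by
  have h : ∀ i, |(D i).f (x i) ((D i).u (x i))| ≤ N ∧
      |tensorNorm (D i).G (gradTensor (D i).G fun y => (D i).f y ((D i).u (x i))) (x i)| ≤ N ∧
      |deriv ((D i).f (x i)) ((D i).u (x i))| ≤ N ∧
      |tensorNorm (D i).G (hessTensor (D i).G fun y => (D i).f y ((D i).u (x i))) (x i)| ≤ N ∧
      |tensorNorm (D i).G
        (gradTensor (D i).G fun y => deriv ((D i).f y) ((D i).u (x i))) (x i)| ≤ N ∧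
      |deriv (deriv ((D i).f (x i))) ((D i).u (x i))| ≤ N := by
    intro i
    have h0 := (D i).f_pos (hx i)
    have h1 := (D i).f_bound (x i) (hx i)
    unfold cSupIntegrand at h1
    unfold tensorNorm at h1 ⊢
    have h2 := Real.sqrt_nonneg (tensorNormSq (D i).G
      (gradTensor (D i).G fun y => (D i).f y ((D i).u (x i))) (x i))
    have h3 := Real.sqrt_nonneg (tensorNormSq (D i).G
      (hessTensor (D i).G fun y => (D i).f y ((D i).u (x i))) (x i))
    have h4 := Real.sqrt_nonneg (tensorNormSq (D i).G
      (gradTensor (D i).G fun y => deriv ((D i).f y) ((D i).u (x i))) (x i))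
    have h5 := abs_nonneg (deriv ((D i).f (x i)) ((D i).u (x i)))
    have h6 := abs_nonneg (deriv (deriv ((D i).f (x i))) ((D i).u (x i)))
    rw [abs_of_nonneg h2, abs_of_nonneg h3, abs_of_nonneg h4, abs_of_pos h0]
    exact ⟨by linarith, by linarith, by linarith, by linarith, by linarith, by linarith⟩
  refine (unifFrames hx hP).unifJet_function (f := fun i => (D i).f) (z := fun i => (D i).u (x i))
    (fun i => (D i).f_contDiffOn.contDiffAt ((isOpen_ball.prod isOpen_univ).mem_nhds
      ⟨hx i, mem_univ _⟩)) ?_ ?_ ?_ ?_ ?_ ?_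
  · exact isBigO_one_iff.2 ⟨N, fun i => (h i).1⟩
  · exact isBigO_one_iff.2 ⟨N, fun i => (h i).2.1⟩
  · exact isBigO_one_iff.2 ⟨N, fun i => (h i).2.2.1⟩
  · exact isBigO_one_iff.2 ⟨N, fun i => (h i).2.2.2.1⟩
  · exact isBigO_one_iff.2 ⟨N, fun i => (h i).2.2.2.2.1⟩
  · exact isBigO_one_iff.2 ⟨N, fun i => (h i).2.2.2.2.2⟩

end Family

/-- The cutoff function, supported in the ball of radius `ρ`. -/
def _root_.cutoff (ρ : ℝ) (z : EuclideanSpace ℝ (Fin n)) : ℝ := 1 - ‖z‖ ^ 2 / ρ ^ 2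

/-- The quantity that is estimated: `∑ ∇²u(Q_k, Q_k) + a |∇u|²`, where `k` ranges over `s` and `Q` is
an orthonormal frame. -/
def testFun (D : SolData n r t δ₁ N) (s : Finset (Fin n)) (z : EuclideanSpace ℝ (Fin n))
    (Q : Matrix (Fin n) (Fin n) ℝ) : ℝ :=
  ∑ k ∈ s, frameHess D.G D.u z Q k k + D.a z * ∑ l, frameGrad D.u z Q l ^ 2

/-- The remainder terms of the equation in the adapted frame. -/
def eqRem (D : SolData n r t δ₁ N) (x : EuclideanSpace ℝ (Fin n)) (P : Matrix (Fin n) (Fin n) ℝ)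
    (m : Fin n) (y : EuclideanSpace ℝ (Fin n)) : ℝ :=
  hessRem D.G x P D.u (stdE m) y
    + (1 - t) / ((n : ℝ) - 2) * ∑ l, hessRem D.G x P D.u (stdE l) y
    + D.a (normalChart D.G x P y) * gradRem D.G x P D.u m y
    + ∑ l, D.b (normalChart D.G x P y) * gradRem D.G x P D.u l y
    + (D.a (normalChart D.G x P y) - D.a x) * dirD (stdE m) (chartFun D.G x P D.u) y ^ 2
    + ∑ l, (D.b (normalChart D.G x P y) - D.b x) * dirD (stdE l) (chartFun D.G x P D.u) y ^ 2
    + ((chartFrame D.G x P y)ᵀ * D.S (normalChart D.G x P y) * chartFrame D.G x P y) m m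

/-- The remainder terms of `testFun` in the adapted frame. -/
def testRem (D : SolData n r t δ₁ N) (s : Finset (Fin n)) (x : EuclideanSpace ℝ (Fin n))
    (P : Matrix (Fin n) (Fin n) ℝ) (X : Fin n → EuclideanSpace ℝ (Fin n))
    (y : EuclideanSpace ℝ (Fin n)) : ℝ :=
  ∑ k ∈ s, hessRem D.G x P D.u (X k) y
    + ∑ l, D.a (normalChart D.G x P y) * gradRem D.G x P D.u l y
    + ∑ l, (D.a (normalChart D.G x P y) - D.a x) * dirD (stdE l) (chartFun D.G x P D.u) y ^ 2

section Pointwise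

variable (D : SolData n r t δ₁ N) {x : EuclideanSpace ℝ (Fin n)} {P : Matrix (Fin n) (Fin n) ℝ}

theorem u_contDiffAt {z : EuclideanSpace ℝ (Fin n)} (hz : z ∈ ball 0 r) :
    ContDiffAt ℝ 4 D.u z := D.u_contDiffOn.contDiffAt (isOpen_ball.mem_nhds hz)

theorem eventually_chartFrame (hx : x ∈ ball 0 r) (hP : Pᵀ * D.G x * P = 1) :
    ∀ᶠ y in 𝓝 0, normalChart D.G x P y ∈ ball 0 r ∧
    (chartFrame D.G x P y)ᵀ * D.G (normalChart D.G x P y) * chartFrame D.G x P y = 1 := by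
  have h2 : Tendsto (normalChart D.G x P) (𝓝 0) (𝓝 x) := by
    have := (contDiff_normalChart D.G x P (m := 2)).continuous.tendsto 0
    rwa [normalChart_zero] at this
  exact (h2.eventually (isOpen_ball.mem_nhds hx)).and (_root_.eventually_chartFrame
    (D.metric_symm hx) (fun a b => ((D.G_contDiffOn a b).contDiffAt
      (isOpen_ball.mem_nhds hx)).of_le (by norm_num)) hP)

/-- The diagonal entries of `W` in the adapted frame. -/
theorem tensorW_chartFrame (hx : x ∈ ball 0 r) {y : EuclideanSpace ℝ (Fin n)}
    (hy : normalChart D.G x P y ∈ ball 0 r)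
    (hy' : (chartFrame D.G x P y)ᵀ * D.G (normalChart D.G x P y) * chartFrame D.G x P y = 1)
    (m : Fin n) :
    ((chartFrame D.G x P y)ᵀ * tensorW D.G t D.a D.b D.S D.u (normalChart D.G x P y)
      * chartFrame D.G x P y) m m
      = dirD (stdE m) (dirD (stdE m) (chartFun D.G x P D.u)) y
        + (1 - t) / ((n : ℝ) - 2) * ∑ l, dirD (stdE l) (dirD (stdE l) (chartFun D.G x P D.u)) y
        + D.a x * dirD (stdE m) (chartFun D.G x P D.u) y ^ 2
        + D.b x * ∑ l, dirD (stdE l) (chartFun D.G x P D.u) y ^ 2 + D.eqRem x P m y := by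
  have hG := D.metric_symm hx
  have hu := D.u_contDiffAt hy
  have h1 := frameHess_chartFrame_diag hG (hu.of_le (by norm_num)) hy'
  have h2 := frameGrad_chartFrame_sq (P := P) hG (hu.differentiableAt (by norm_num))
  rw [frame_tensorW hy', mul_assoc (D.a _), ← sq]
  simp only [h1, h2, Matrix.one_apply_eq, mul_one, eqRem, Finset.sum_add_distrib,
    ← Finset.mul_sum]
  ring

/-- The test function in the adapted frame, rotated by `O`. -/
theorem testFun_chartFrame (hx : x ∈ ball 0 r) {y : EuclideanSpace ℝ (Fin n)}
    (hy : normalChart D.G x P y ∈ ball 0 r)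
    (hy' : (chartFrame D.G x P y)ᵀ * D.G (normalChart D.G x P y) * chartFrame D.G x P y = 1)
    (s : Finset (Fin n)) {O : Matrix (Fin n) (Fin n) ℝ} (hO : Oᵀ * O = 1) :
    D.testFun s (normalChart D.G x P y) (chartFrame D.G x P y * O)
      = ∑ k ∈ s, dirD (WithLp.toLp 2 fun m => O m k)
          (dirD (WithLp.toLp 2 fun m => O m k) (chartFun D.G x P D.u)) y
        + D.a x * ∑ l, dirD (stdE l) (chartFun D.G x P D.u) y ^ 2
        + D.testRem s x P (fun k => WithLp.toLp 2 fun m => O m k) y := by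
  have hG := D.metric_symm hx
  have hu := D.u_contDiffAt hy
  have h1 := fun k => sum_frameHess_chartFrame hG (hu.of_le (by norm_num)) hy'
    (WithLp.toLp 2 fun m => O m k)
  have h2 := frameGrad_chartFrame_sq (P := P) hG (hu.differentiableAt (by norm_num))
  rw [testFun, sum_frameGrad_mul hO hy']
  simp only [frameHess_mul, frame_mul_apply, h1, h2, testRem, Finset.sum_add_distrib,
    ← Finset.mul_sum]
  ring

end Pointwise

end SolData

end Solutions

/-! ### Solutions at a maximum point -/

section MaximumPoint

namespace SolData

variable {n : ℕ} {r t δ₁ N : ℝ} {ι : Type*} {D : ι → SolData n r t δ₁ N}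
  {x : ι → EuclideanSpace ℝ (Fin n)} {P : ι → Matrix (Fin n) (Fin n) ℝ} {q : ι → ℝ}

theorem jetW_eqRem (hx : ∀ i, x i ∈ ball 0 r) (hP : ∀ i, (P i)ᵀ * (D i).G (x i) * P i = 1)
    (h : WeightedFun (fun i => (D i).G) x P (fun i => (D i).u) q) (m : Fin n) :
    JetW q 2 2 3 fun i => (D i).eqRem (x i) (P i) m := by
  have H := unifFrames hx hP
  have hE : ∀ m : Fin n, ∀ _ : ι, ‖stdE m‖ ≤ 1 := fun m _ => by simp
  have hS : JetW q 0 0 0 fun i y => ((chartFrame (D i).G (x i) (P i) y)ᵀ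
      * (D i).S (normalChart (D i).G (x i) (P i) y) * chartFrame (D i).G (x i) (P i) y) m m :=
    (UnifJet.matrix_mul (UnifJet.matrix_mul
      (M := fun i y => (chartFrame (D i).G (x i) (P i) y)ᵀ) (fun a b => H.chartFrame b a)
      (N := fun i y => (D i).S (normalChart (D i).G (x i) (P i) y))
      fun a b => H.comp_normalChart (unifJet_S hx hP a b)) H.chartFrame m m).jetW h.one_le
  have ha := unifJet_a hx hP
  have hb := unifJet_b hx hP
  exact (((((h.jetW_hessRem H (hE m)).add ((JetW.sum _ fun l _ =>
    h.jetW_hessRem H (hE l)).const_mul _)).add (h.jetW_coeff_mul H ha (h.jetW_gradRem H m))).add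
    (JetW.sum _ fun l _ => h.jetW_coeff_mul H hb (h.jetW_gradRem H l))).add
    (h.jetW_coeff_sq H ha m)).add (JetW.sum _ fun l _ => h.jetW_coeff_sq H hb l) |>.add
    (hS.mono h.one_le (by norm_num) (by norm_num) (by norm_num))

theorem jetW_testRem (hx : ∀ i, x i ∈ ball 0 r) (hP : ∀ i, (P i)ᵀ * (D i).G (x i) * P i = 1)
    (h : WeightedFun (fun i => (D i).G) x P (fun i => (D i).u) q) (s : Finset (Fin n))
    {X : ι → Fin n → EuclideanSpace ℝ (Fin n)} (hX : ∀ i k, ‖X i k‖ ≤ 1) :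
    JetW q 2 2 3 fun i => (D i).testRem s (x i) (P i) (X i) := by
  have H := unifFrames hx hP
  have ha := unifJet_a hx hP
  exact ((JetW.sum _ fun k _ => h.jetW_hessRem H fun i => hX i k).add
    (JetW.sum _ fun l _ => h.jetW_coeff_mul H ha (h.jetW_gradRem H l))).add
    (JetW.sum _ fun l _ => h.jetW_coeff_sq H ha l)

theorem unifJet_cutoff (hx : ∀ i, x i ∈ ball 0 r) (ρ : ℝ) :
    UnifJet 2 (fun _ => cutoff ρ) x := by
  have hb : x =O[⊤] fun _ => (1 : ℝ) :=
    isBigO_one_iff.2 ⟨r, fun i => (mem_ball_zero_iff.1 (hx i)).le⟩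
  have hc : ∀ p, UnifJet 2 (fun (_ : ι) (y : EuclideanSpace ℝ (Fin n)) => y p) x := fun p =>
    UnifJet.clm (EuclideanSpace.proj (𝕜 := ℝ) p) hb
  have h1 := (UnifJet.const (k := 2) (x := x) (c := fun _ => (1 : ℝ)) (isBigO_refl _ _)).sub
    ((UnifJet.sum Finset.univ fun p _ => (hc p).mul (hc p)).mul
      (UnifJet.const (c := fun _ => (ρ ^ 2)⁻¹) (isBigO_const_const _ one_ne_zero _)))
  refine h1.congr fun i => Eventually.of_forall fun y => ?_
  rw [cutoff, EuclideanSpace.real_norm_sq_eq, div_eq_mul_inv]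
  simp only [sq]

/-- The differential inequality at maximum points of the cut off test function. -/
theorem exists_estimate_at_max (s : Finset (Fin n)) {ρ : ℝ} (hρ : 0 < ρ) (hρr : ρ < r)
    (hc : 0 ≤ (1 - t) / ((n : ℝ) - 2)) (hx : ∀ i, ‖x i‖ < ρ)
    (hP : ∀ i, (P i)ᵀ * (D i).G (x i) * P i = 1) {lam : ι → Fin n → ℝ}
    (hlam : ∀ i, (P i)ᵀ * tensorW (D i).G t (D i).a (D i).b (D i).S (D i).u (x i) * P i
      = Matrix.diagonal (lam i)) (hlamΓ : ∀ i, lam i ∈ (D i).Γ)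
    (hlamF : ∀ i, (D i).F (lam i) = (D i).f (x i) ((D i).u (x i)))
    {O : ι → Matrix (Fin n) (Fin n) ℝ} (hO : ∀ i, (O i)ᵀ * O i = 1)
    (h : WeightedFun (fun i => (D i).G) x P (fun i => (D i).u) q)
    (hs : ∀ i, 0 ≤ (D i).a (x i) ∨ s = Finset.univ)
    (hmax : ∀ i z Q, ‖z‖ ≤ ρ → Qᵀ * (D i).G z * Q = 1 →
      cutoff ρ z ^ 2 * (D i).testFun s z Q
        ≤ cutoff ρ (x i) ^ 2 * (D i).testFun s (x i) (P i * O i)) :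
    ∃ C, 0 ≤ C ∧ ∀ i, cutoff ρ (x i) ^ 2 * (2 * (δ₁ * ∑ k ∈ s, ∑ l,
        (∑ j, O i j k * frameHess (D i).G (D i).u (x i) (P i) j l) ^ 2))
      ≤ C * (cutoff ρ (x i) ^ 2 * q i ^ 3 + cutoff ρ (x i) * q i ^ 3 + q i ^ 2) := by
  have hxr : ∀ i, x i ∈ ball 0 r := fun i => mem_ball_zero_iff.2 ((hx i).trans hρr)
  have H := unifFrames hxr hP
  have ha := unifJet_a hxr hP
  have hb := unifJet_b hxr hP
  set v : ι → EuclideanSpace ℝ (Fin n) → ℝ := fun i =>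
    chartFun (D i).G (x i) (P i) (D i).u with hv
  set X : ι → Fin n → EuclideanSpace ℝ (Fin n) := fun i k => WithLp.toLp 2 fun m => O i m k with hX
  have hX1 : ∀ i k, ‖X i k‖ ≤ 1 := by
    intro i k
    have h1 := congrFun (congrFun (hO i) k) k
    rw [Matrix.mul_apply, Matrix.one_apply_eq] at h1
    rw [EuclideanSpace.norm_eq, Real.sqrt_le_one]
    refine le_of_eq ?_
    rw [← h1]
    refine Finset.sum_congr rfl fun m _ => ?_
    simp [hX, sq]
  set Fd : ι → Fin n → ℝ := fun i m => fderiv ℝ (D i).F (lam i) (Pi.single m 1) with hFd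
  have hF0 : ∀ i m, 0 ≤ Fd i m := fun i m =>
    ((D i).structureConditions.monotone _ (hlamΓ i) m).le
  have hF1 : ∀ i, 1 ≤ ∑ m, Fd i m := fun i => (D i).structureConditions.one_le_sum (hlamΓ i)
  have hnear := fun i => (D i).eventually_chartFrame (hxr i) (hP i)
  -- the linearized operator: by concavity it lies above `F`, with equality at the origin
  have hΦ : ∀ i, IsLocalMin (fun y => ∑ m, Fd i m * (dirD (stdE m) (dirD (stdE m) (v i)) y
      + (1 - t) / ((n : ℝ) - 2) * ∑ l, dirD (stdE l) (dirD (stdE l) (v i)) y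
      + (D i).a (x i) * dirD (stdE m) (v i) y ^ 2
      + (D i).b (x i) * ∑ l, dirD (stdE l) (v i) y ^ 2 + (D i).eqRem (x i) (P i) m y)
      - (D i).f (normalChart (D i).G (x i) (P i) y) (v i y)) 0 := by
    intro i
    have key : ∀ y, normalChart (D i).G (x i) (P i) y ∈ ball 0 r →
        (chartFrame (D i).G (x i) (P i) y)ᵀ * (D i).G (normalChart (D i).G (x i) (P i) y)
          * chartFrame (D i).G (x i) (P i) y = 1 → _ := fun y h1 h2 =>
      (D i).tensorW_chartFrame (hxr i) h1 h2
    have h0 : ∑ m, Fd i m * (dirD (stdE m) (dirD (stdE m) (v i)) 0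
        + (1 - t) / ((n : ℝ) - 2) * ∑ l, dirD (stdE l) (dirD (stdE l) (v i)) 0
        + (D i).a (x i) * dirD (stdE m) (v i) 0 ^ 2
        + (D i).b (x i) * ∑ l, dirD (stdE l) (v i) 0 ^ 2 + (D i).eqRem (x i) (P i) m 0)
        - (D i).f (normalChart (D i).G (x i) (P i) 0) (v i 0) = 0 := by
      obtain ⟨h1, h2⟩ := (hnear i).self_of_nhds
      simp only [hv]
      simp only [← key 0 h1 h2]
      rw [chartFrame_zero (hP i), chartFun, normalChart_zero, hlam i]
      simp only [Matrix.diagonal_apply_eq]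
      rw [(D i).structureConditions.euler (hlamΓ i), hlamF i, sub_self]
    filter_upwards [hnear i] with y ⟨h1, h2⟩
    rw [h0, sub_nonneg]
    obtain ⟨mu, hmu, hmuΓ, hmuF⟩ := (D i).equation _ h1
    have := (D i).structureConditions.le_frame (hlamΓ i) hmuΓ h2 hmu
    rw [hmuF] at this
    simp only [hv]
    simp only [← key y h1 h2]
    exact this
  -- the cut off test function
  have hζx : ∀ i, 0 < cutoff ρ (x i) := by
    intro i
    rw [cutoff, sub_pos, div_lt_one (by positivity)]
    exact pow_lt_pow_left₀ (hx i) (norm_nonneg _) (by norm_num)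
  have hζ1 : ∀ i, cutoff ρ (x i) ≤ 1 := by
    intro i
    rw [cutoff]
    have : 0 ≤ ‖x i‖ ^ 2 / ρ ^ 2 := by positivity
    linarith
  have hΨ : ∀ i, IsLocalMax (fun y => cutoff ρ (normalChart (D i).G (x i) (P i) y) ^ 2
      * (∑ k ∈ s, dirD (X i k) (dirD (X i k) (v i)) y
        + (D i).a (x i) * ∑ l, dirD (stdE l) (v i) y ^ 2
        + (D i).testRem s (x i) (P i) (X i) y)) 0 := by
    intro i
    have hball : ∀ᶠ y in 𝓝 0, ‖normalChart (D i).G (x i) (P i) y‖ < ρ := by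
      have h2 := (contDiff_normalChart (D i).G (x i) (P i) (m := 2)).continuous.norm.tendsto 0
      rw [normalChart_zero] at h2
      exact h2.eventually (gt_mem_nhds (hx i))
    obtain ⟨h01, h02⟩ := (hnear i).self_of_nhds
    filter_upwards [hnear i, hball] with y ⟨h1, h2⟩ hy
    have e1 := (D i).testFun_chartFrame (hxr i) h1 h2 s (hO i)
    have e0 := (D i).testFun_chartFrame (hxr i) h01 h02 s (hO i)
    simp only [hv, hX]
    rw [← e1, ← e0, chartFrame_zero (hP i), normalChart_zero]
    exact hmax i _ _ hy.le (frame_mul_orthogonal h2 (hO i))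
  have hζ : JetW q 0 0 0 fun i y => cutoff ρ (normalChart (D i).G (x i) (P i) y) :=
    (H.comp_normalChart (unifJet_cutoff hxr ρ)).jetW h.one_le
  have hζ0 : ∀ i, cutoff ρ (normalChart (D i).G (x i) (P i) 0) = cutoff ρ (x i) := fun i => by
    rw [normalChart_zero]
  obtain ⟨C, hC0, hC⟩ := exists_bound_at_maximum s hc (e := stdE) (fun m => by simp) hX1
    (v := v) h.contDiffAt_chartFun h.one_le (h.abs_dirD_le H)
    (fun k => h.bigW_dirD_dirD H fun i => hX1 i k)
    (BigW.of_isBigO_one ha.isBigO_apply) (BigW.of_isBigO_one hb.isBigO_apply) hF0 hF1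
    (jetW_eqRem hxr hP h) (h.jetW_function H (unifJet_f hxr hP)) hΦ
    (jetW_testRem hxr hP h s hX1) hζ (fun i => by rw [hζ0]; exact hζx i)
    (fun i => by rw [hζ0]; exact hζ1 i) hΨ
  refine ⟨C, hC0, fun i => ?_⟩
  have h1 := hC i
  rw [hζ0 i] at h1
  have e2 : ∀ m l, dirD (stdE l) (dirD (stdE m) (v i)) 0
      = frameHess (D i).G (D i).u (x i) (P i) l m := fun m l =>
    dirD_dirD_chartFun_zero (H.symm i) (hP i) ((h.contDiffAt i).of_le (by norm_num)) l m
  have e3 : ∀ k m, dirD (X i k) (dirD (stdE m) (v i)) 0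
      = ∑ j, O i j k * frameHess (D i).G (D i).u (x i) (P i) j m := by
    intro k m
    rw [dirD_eq_sum]
    simp only [e2, hX]
  simp only [e2, e3] at h1
  have h2 := leading_terms_ge s (hO i)
    (h := fun m l => frameHess (D i).G (D i).u (x i) (P i) l m)
    (hE := fun k m => ∑ j, O i j k * frameHess (D i).G (D i).u (x i) (P i) j m)
    (fun k m => rfl) (hF0 i) hc ((D i).le_coeff (x i) (hxr i)) (hs i)
  have hFpos : 0 < ∑ m, Fd i m := zero_lt_one.trans_le (hF1 i)
  refine le_of_mul_le_mul_left ?_ hFpos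
  refine le_trans ?_ h1
  have h3 := mul_le_mul_of_nonneg_left h2
    (mul_nonneg (sq_nonneg (cutoff ρ (x i))) (by norm_num : (0 : ℝ) ≤ 2))
  refine le_trans (le_of_eq ?_) (h3.trans (le_of_eq ?_)) <;> ring

end SolData

end MaximumPoint

/-! ### The maximum of the test function -/

section Maximum

namespace SolData

variable {n : ℕ} {r t δ₁ N : ℝ}

theorem continuousAt_christoffel (D : SolData n r t δ₁ N) {z : EuclideanSpace ℝ (Fin n)}
    (hz : z ∈ ball 0 r) (l i j : Fin n) : ContinuousAt (fun y => christoffel D.G y l i j) z := by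
  obtain ⟨lam, ⟨P, hP, -⟩, -⟩ := D.equation z hz
  have H := unifFrames (D := fun _ : Unit => D) (x := fun _ => z) (P := fun _ => P)
    (fun _ => hz) fun _ => hP
  exact ((H.christoffel l i j).contDiffAt ()).continuousAt

theorem continuousAt_dirD (D : SolData n r t δ₁ N) {z : EuclideanSpace ℝ (Fin n)}
    (hz : z ∈ ball 0 r) (i : Fin n) : ContinuousAt (dirD (stdE i) D.u) z :=
  (ContDiffAt.dirD (k := 3) (D.u_contDiffAt hz) _).continuousAt

theorem continuousAt_hessMat (D : SolData n r t δ₁ N) {z : EuclideanSpace ℝ (Fin n)}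
    (hz : z ∈ ball 0 r) (i j : Fin n) : ContinuousAt (fun y => hessMat D.G D.u y i j) z := by
  simp only [hessMat, Matrix.of_apply, hessTensor_eq, Matrix.cons_val_zero, Matrix.cons_val_one]
  refine ContinuousAt.sub ?_ ?_
  · exact (ContDiffAt.dirD (k := 2) (ContDiffAt.dirD (k := 3) (D.u_contDiffAt hz) _) _).continuousAt
  · exact tendsto_finsetSum _ fun l _ =>
      (D.continuousAt_christoffel hz l i j).mul (D.continuousAt_dirD hz l)

/-- The cut off test function attains its maximum over the orthonormal frames at points of the closed
ball of radius `ρ`. -/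
theorem exists_max (D : SolData n r t δ₁ N) (s : Finset (Fin n)) {ρ : ℝ} (hρ : 0 < ρ)
    (hρr : ρ < r) : ∃ x Q, ‖x‖ ≤ ρ ∧ Qᵀ * D.G x * Q = 1 ∧ ∀ z Q', ‖z‖ ≤ ρ → Q'ᵀ * D.G z * Q' = 1 →
      cutoff ρ z ^ 2 * D.testFun s z Q' ≤ cutoff ρ x ^ 2 * D.testFun s x Q := by
  set A : Set (EuclideanSpace ℝ (Fin n) × (Fin n → Fin n → ℝ)) :=
    closedBall 0 ρ ×ˢ closedBall 0 (Real.sqrt N) with hA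
  have hAc : IsCompact A := (isCompact_closedBall _ _).prod (isCompact_closedBall _ _)
  have hAr : ∀ p ∈ A, p.1 ∈ ball 0 r := fun p hp => closedBall_subset_ball hρr hp.1
  have c1 : ∀ {w : EuclideanSpace ℝ (Fin n) → ℝ}, (∀ z ∈ ball 0 r, ContinuousAt w z) →
      ContinuousOn (fun p : EuclideanSpace ℝ (Fin n) × (Fin n → Fin n → ℝ) => w p.1) A := by
    intro w hw p hp
    exact (ContinuousAt.comp (f := Prod.fst) (hw p.1 (hAr p hp))
      continuous_fst.continuousAt).continuousWithinAt
  have c2 : ∀ i j, ContinuousOn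
      (fun p : EuclideanSpace ℝ (Fin n) × (Fin n → Fin n → ℝ) => p.2 i j) A := fun i j =>
    ((continuous_apply_apply i j).comp continuous_snd).continuousOn
  set gram : EuclideanSpace ℝ (Fin n) × (Fin n → Fin n → ℝ) → Fin n → Fin n → ℝ := fun p i j =>
    ((Matrix.of p.2)ᵀ * D.G p.1 * Matrix.of p.2) i j with hgram
  have hgc : ContinuousOn gram A := by
    refine continuousOn_pi.2 fun i => continuousOn_pi.2 fun j => ?_
    simp only [hgram, frame_mul_apply, Matrix.of_apply]
    exact continuousOn_finsetSum _ fun a _ => continuousOn_finsetSum _ fun b _ =>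
      ((c2 a i).mul (c2 b j)).mul (c1 fun z hz => ((D.G_contDiffOn a b).contDiffAt
        (isOpen_ball.mem_nhds hz)).continuousAt)
  -- the bundle of orthonormal frames over the closed ball is compact
  set K := A ∩ gram ⁻¹' {idArr n} with hK
  have hKc : IsCompact K := hAc.of_isClosed_subset
    (hgc.preimage_isClosed_of_isClosed hAc.isClosed isClosed_singleton) inter_subset_left
  have hmem : ∀ z Q, ‖z‖ ≤ ρ → Qᵀ * D.G z * Q = 1 → (z, fun i j => Q i j) ∈ K := by
    intro z Q hz hQ
    have hz' : z ∈ ball 0 r := mem_ball_zero_iff.2 (hz.trans_lt hρr)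
    refine ⟨⟨mem_closedBall_zero_iff.2 hz, mem_closedBall_zero_iff.2 ?_⟩, ?_⟩
    · refine (pi_norm_le_iff_of_nonneg (Real.sqrt_nonneg _)).2 fun i =>
        (pi_norm_le_iff_of_nonneg (Real.sqrt_nonneg _)).2 fun j =>
          Real.abs_le_sqrt (D.frame_sq_le hz' hQ i j)
    · change gram (z, fun i j => Q i j) = idArr n
      funext i j
      exact (congrFun (congrFun hQ i) j).trans (congrFun (congrFun of_idArr i) j).symm
  have hne : K.Nonempty := by
    obtain ⟨lam, ⟨P, hP, -⟩, -⟩ := D.equation 0 (mem_ball_self (hρ.trans hρr))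
    exact ⟨_, hmem 0 P (by simpa using hρ.le) hP⟩
  have hcont : ContinuousOn (fun p : EuclideanSpace ℝ (Fin n) × (Fin n → Fin n → ℝ) =>
      cutoff ρ p.1 ^ 2 * D.testFun s p.1 (Matrix.of p.2)) A := by
    refine ContinuousOn.mul ?_ (ContinuousOn.add ?_ (ContinuousOn.mul ?_ ?_))
    · refine (c1 fun z _ => ?_).pow 2
      exact (continuous_const.sub ((continuous_norm.pow 2).div_const _)).continuousAt
    · refine continuousOn_finsetSum _ fun k _ => ?_
      simp only [frameHess, frame_mul_apply, Matrix.of_apply]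
      exact continuousOn_finsetSum _ fun a _ => continuousOn_finsetSum _ fun b _ =>
        ((c2 a k).mul (c2 b k)).mul (c1 fun z hz => D.continuousAt_hessMat hz a b)
    · exact c1 fun z hz => (D.a_contDiffOn.contDiffAt (isOpen_ball.mem_nhds hz)).continuousAt
    · simp only [frameGrad, Matrix.of_apply]
      exact continuousOn_finsetSum _ fun l _ => (continuousOn_finsetSum _ fun i _ =>
        (c2 i l).mul (c1 fun z hz => D.continuousAt_dirD hz i)).pow 2
  obtain ⟨⟨x, Q⟩, hxQ, hmax⟩ := hKc.exists_isMaxOn hne (hcont.mono inter_subset_left)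
  obtain ⟨⟨hx, -⟩, hg⟩ := hxQ
  have hQ : (Matrix.of Q)ᵀ * D.G x * Matrix.of Q = 1 := by
    ext i j
    exact (congrFun (congrFun hg i) j).trans (congrFun (congrFun of_idArr i) j)
  refine ⟨x, Matrix.of Q, mem_closedBall_zero_iff.1 hx, hQ, fun z Q' hz hQ' => ?_⟩
  have h1 := isMaxOn_iff.1 hmax _ (hmem z Q' hz hQ')
  have h2 : Matrix.of (fun i j => Q' i j) = Q' := rfl
  simp only [h2] at h1
  exact h1

theorem abs_a_le (D : SolData n r t δ₁ N) {z : EuclideanSpace ℝ (Fin n)} (hz : z ∈ ball 0 r) :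
    |D.a z| ≤ N := by
  have h1 := D.a_bound z hz
  have e : tensorNorm D.G (scalarTensor D.a) z = |D.a z| := by
    simp [tensorNorm, tensorNormSq, scalarTensor, Real.sqrt_mul_self_eq_abs]
  rw [e] at h1
  unfold tensorNorm at h1
  linarith [Real.sqrt_nonneg (tensorNormSq D.G (covDeriv D.G (scalarTensor D.a)) z),
    Real.sqrt_nonneg (tensorNormSq D.G (covDeriv D.G (covDeriv D.G (scalarTensor D.a))) z)]

theorem abs_b_le (D : SolData n r t δ₁ N) {z : EuclideanSpace ℝ (Fin n)} (hz : z ∈ ball 0 r) :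
    |D.b z| ≤ N := by
  have h1 := D.b_bound z hz
  have e : tensorNorm D.G (scalarTensor D.b) z = |D.b z| := by
    simp [tensorNorm, tensorNormSq, scalarTensor, Real.sqrt_mul_self_eq_abs]
  rw [e] at h1
  unfold tensorNorm at h1
  linarith [Real.sqrt_nonneg (tensorNormSq D.G (covDeriv D.G (scalarTensor D.b)) z),
    Real.sqrt_nonneg (tensorNormSq D.G (covDeriv D.G (covDeriv D.G (scalarTensor D.b))) z)]

theorem abs_frame_S_le (D : SolData n r t δ₁ N) {z : EuclideanSpace ℝ (Fin n)}
    (hz : z ∈ ball 0 r) {Q : Matrix (Fin n) (Fin n) ℝ} (hQ : Qᵀ * D.G z * Q = 1) (m l : Fin n) :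
    |(Qᵀ * D.S z * Q) m l| ≤ N := by
  have h1 := D.S_bound z hz
  have e : frameComp Q (matrixTensor D.S z) ![m, l] = (Qᵀ * D.S z * Q) m l := by
    rw [frameComp, sum_fin_two_arrow, frame_mul_apply]
    simp [matrixTensor, Fin.prod_univ_two]
  have h2 := abs_frameComp_le hQ (matrixTensor D.S) ![m, l]
  rw [e] at h2
  refine h2.trans ?_
  unfold tensorNorm at h1 ⊢
  linarith [Real.sqrt_nonneg (tensorNormSq D.G (covDeriv D.G (matrixTensor D.S)) z),
    Real.sqrt_nonneg (tensorNormSq D.G (covDeriv D.G (covDeriv D.G (matrixTensor D.S))) z)]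

/-- The common size of the Hessian and of the square of the gradient. -/
def size (D : SolData n r t δ₁ N) (x : EuclideanSpace ℝ (Fin n)) (P : Matrix (Fin n) (Fin n) ℝ) :
    ℝ :=
  1 + ∑ l, frameGrad D.u x P l ^ 2 + ∑ m, ∑ l, |frameHess D.G D.u x P m l|

theorem le_size (D : SolData n r t δ₁ N) (x : EuclideanSpace ℝ (Fin n))
    (P : Matrix (Fin n) (Fin n) ℝ) : 1 ≤ D.size x P ∧ ∑ l, frameGrad D.u x P l ^ 2 ≤ D.size x P ∧
      ∑ m, ∑ l, |frameHess D.G D.u x P m l| ≤ D.size x P := by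
  have h1 : 0 ≤ ∑ l, frameGrad D.u x P l ^ 2 := Finset.sum_nonneg fun _ _ => sq_nonneg _
  have h2 : 0 ≤ ∑ m, ∑ l, |frameHess D.G D.u x P m l| :=
    Finset.sum_nonneg fun _ _ => Finset.sum_nonneg fun _ _ => abs_nonneg _
  unfold size
  exact ⟨by linarith, by linarith, by linarith⟩

theorem abs_frameHess_le_size (D : SolData n r t δ₁ N) (x : EuclideanSpace ℝ (Fin n))
    (P : Matrix (Fin n) (Fin n) ℝ) (m l : Fin n) : |frameHess D.G D.u x P m l| ≤ D.size x P := by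
  refine le_trans ?_ (D.le_size x P).2.2
  exact (Finset.single_le_sum (f := fun l => |frameHess D.G D.u x P m l|)
    (fun _ _ => abs_nonneg _) (Finset.mem_univ l)).trans
    (Finset.single_le_sum (f := fun m => ∑ l, |frameHess D.G D.u x P m l|)
      (fun _ _ => Finset.sum_nonneg fun _ _ => abs_nonneg _) (Finset.mem_univ m))

/-- The test function is at most of weight two. -/
theorem testFun_mul_le (D : SolData n r t δ₁ N) (s : Finset (Fin n))
    {x : EuclideanSpace ℝ (Fin n)} (hx : x ∈ ball 0 r) {P O : Matrix (Fin n) (Fin n) ℝ}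
    (hP : Pᵀ * D.G x * P = 1) (hO : Oᵀ * O = 1) :
    D.testFun s x (P * O) ≤ (n + N) * D.size x P := by
  obtain ⟨h1, h2, h3⟩ := D.le_size x P
  have hO1 : ∀ i j, |O i j| ≤ 1 := by
    intro i j
    have e := congrFun (congrFun hO j) j
    rw [Matrix.mul_apply, Matrix.one_apply_eq] at e
    have := Finset.single_le_sum (f := fun i => Oᵀ j i * O i j)
      (fun i _ => mul_self_nonneg (O i j)) (Finset.mem_univ i)
    rw [e] at this
    exact abs_le_one_iff_mul_self_le_one.2 this
  have hk : ∀ k, frameHess D.G D.u x (P * O) k k ≤ D.size x P := by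
    intro k
    rw [frameHess_mul, frame_mul_apply]
    refine le_trans (Finset.sum_le_sum fun i _ => Finset.sum_le_sum fun j _ => ?_) h3
    refine (le_abs_self _).trans ?_
    rw [abs_mul, abs_mul]
    exact mul_le_of_le_one_left (abs_nonneg _) (mul_le_one₀ (hO1 i k) (abs_nonneg _) (hO1 j k))
  have hs : ∑ k ∈ s, frameHess D.G D.u x (P * O) k k ≤ n * D.size x P := by
    refine (Finset.sum_le_card_nsmul _ _ _ fun k _ => hk k).trans ?_
    rw [nsmul_eq_mul]
    refine mul_le_mul_of_nonneg_right ?_ (by linarith)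
    exact_mod_cast (Finset.card_le_univ s).trans (by simp)
  have ha : D.a x * ∑ l, frameGrad D.u x (P * O) l ^ 2 ≤ N * D.size x P := by
    rw [sum_frameGrad_mul hO hP]
    have h4 := D.abs_a_le hx
    exact mul_le_mul ((le_abs_self _).trans h4) h2 (Finset.sum_nonneg fun _ _ => sq_nonneg _)
      ((abs_nonneg _).trans h4)
  rw [testFun, add_mul]
  exact add_le_add hs ha

/-- The interior estimate of the test function, provided that at maximum points the second
derivatives that are controlled dominate the size of the solution. -/
theorem exists_testFun_le (s : Finset (Fin n)) {ρ : ℝ} (hρ : 0 < ρ) (hρr : ρ < r)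
    (hc : 0 ≤ (1 - t) / ((n : ℝ) - 2)) (hδ₁ : 0 < δ₁) (p : SolData n r t δ₁ N → Prop)
    (hs : ∀ D, p D → (∀ x ∈ ball 0 r, 0 ≤ D.a x) ∨ s = Finset.univ) {C' : ℝ} (hC' : 0 ≤ C')
    (hsize : ∀ D, p D → ∀ x ∈ ball 0 r, ∀ P lam O, Pᵀ * D.G x * P = 1 →
      Pᵀ * tensorW D.G t D.a D.b D.S D.u x * P = Matrix.diagonal lam → lam ∈ D.Γ →
      D.F lam = D.f x (D.u x) → Oᵀ * O = 1 →
      (∀ Q, Qᵀ * D.G x * Q = 1 → D.testFun s x Q ≤ D.testFun s x (P * O)) →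
      D.size x P ^ 2 ≤ C' * (1 + ∑ k ∈ s, ∑ l, (∑ j, O j k * frameHess D.G D.u x P j l) ^ 2)) :
    ∃ K, 0 ≤ K ∧ ∀ D, p D → ∀ z Q, ‖z‖ ≤ ρ → Qᵀ * D.G z * Q = 1 →
      cutoff ρ z ^ 2 * D.testFun s z Q ≤ K := by
  -- all solutions together with their interior maximum points
  set ι := {i : SolData n r t δ₁ N × EuclideanSpace ℝ (Fin n) × Matrix (Fin n) (Fin n) ℝ
      × (Fin n → ℝ) × Matrix (Fin n) (Fin n) ℝ //
    (p i.1 ∧ ‖i.2.1‖ < ρ) ∧ ((i.2.2.1)ᵀ * i.1.G i.2.1 * i.2.2.1 = 1 ∧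
    (i.2.2.1)ᵀ * tensorW i.1.G t i.1.a i.1.b i.1.S i.1.u i.2.1 * i.2.2.1
      = Matrix.diagonal i.2.2.2.1 ∧ i.2.2.2.1 ∈ i.1.Γ ∧
    i.1.F i.2.2.2.1 = i.1.f i.2.1 (i.1.u i.2.1)) ∧ (i.2.2.2.2)ᵀ * i.2.2.2.2 = 1 ∧
    ∀ z Q, ‖z‖ ≤ ρ → Qᵀ * i.1.G z * Q = 1 → cutoff ρ z ^ 2 * i.1.testFun s z Q
      ≤ cutoff ρ i.2.1 ^ 2 * i.1.testFun s i.2.1 (i.2.2.1 * i.2.2.2.2)} with hι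
  have hxr : ∀ i : ι, i.1.2.1 ∈ ball 0 r := fun i =>
    mem_ball_zero_iff.2 (i.2.1.2.trans hρr)
  set q : ι → ℝ := fun i => Real.sqrt (i.1.1.size i.1.2.1 i.1.2.2.1) with hq
  have hq2 : ∀ i, q i ^ 2 = i.1.1.size i.1.2.1 i.1.2.2.1 := fun i =>
    Real.sq_sqrt (zero_le_one.trans (le_size _ _ _).1)
  have hW : WeightedFun (fun i : ι => i.1.1.G) (fun i => i.1.2.1) (fun i => i.1.2.2.1)
      (fun i => i.1.1.u) q := by
    refine ⟨fun i => i.1.1.u_contDiffAt (hxr i), fun i => ?_, fun i m => ?_, fun i m l => ?_⟩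
    · exact Real.one_le_sqrt.2 (le_size _ _ _).1
    · refine Real.abs_le_sqrt (le_trans ?_ (le_size _ _ _).2.1)
      exact Finset.single_le_sum (f := fun l => frameGrad i.1.1.u i.1.2.1 i.1.2.2.1 l ^ 2)
        (fun _ _ => sq_nonneg _) (Finset.mem_univ m)
    · rw [hq2]; exact abs_frameHess_le_size _ _ _ _ _
  obtain ⟨C, hC0, hC⟩ := exists_estimate_at_max s hρ hρr hc (D := fun i : ι => i.1.1)
    (fun i => i.2.1.2) (fun i => i.2.2.1.1) (lam := fun i => i.1.2.2.2.1)
    (fun i => i.2.2.1.2.1) (fun i => i.2.2.1.2.2.1) (fun i => i.2.2.1.2.2.2)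
    (O := fun i => i.1.2.2.2.2) (fun i => i.2.2.2.1) hW
    (fun i => (hs _ i.2.1.1).imp (fun h => h _ (hxr i)) id) (fun i => i.2.2.2.2)
  obtain ⟨B, hB0, hB⟩ := exists_cutoff_bound C C' δ₁ hC0 hC' hδ₁
  refine ⟨(n + |N|) * B, by positivity, fun D hD z Q hz hQ => ?_⟩
  obtain ⟨x, Q₀, hx, hQ₀, hmax⟩ := D.exists_max s hρ hρr
  refine (hmax z Q hz hQ).trans ?_
  -- where the maximum is attained on the boundary, it is zero
  rcases hx.lt_or_eq with hx' | hx'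
  swap
  · have : cutoff ρ x = 0 := by rw [cutoff, hx', div_self (by positivity), sub_self]
    rw [this]
    have : 0 ≤ (n + |N|) * B := by positivity
    simpa using this
  have hxb : x ∈ ball 0 r := mem_ball_zero_iff.2 (hx'.trans hρr)
  obtain ⟨lam, ⟨P, hP, hW'⟩, hlam, hF⟩ := D.equation x hxb
  obtain ⟨hPO, hO⟩ := frame_orthogonal hP hQ₀
  set O := Pᵀ * D.G x * Q₀ with hOdef
  have hζ : 0 < cutoff ρ x := by
    rw [cutoff, sub_pos, div_lt_one (by positivity)]
    exact pow_lt_pow_left₀ hx' (norm_nonneg _) (by norm_num)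
  have hζ1 : cutoff ρ x ≤ 1 := by
    rw [cutoff]
    have : 0 ≤ ‖x‖ ^ 2 / ρ ^ 2 := by positivity
    linarith
  have hmax' : ∀ z Q, ‖z‖ ≤ ρ → Qᵀ * D.G z * Q = 1 → cutoff ρ z ^ 2 * D.testFun s z Q
      ≤ cutoff ρ x ^ 2 * D.testFun s x (P * O) := by rw [hPO]; exact hmax
  set i : ι := ⟨(D, x, P, lam, O), ⟨hD, hx'⟩, ⟨hP, hW', hlam, hF⟩, hO, hmax'⟩ with hi
  have h1 := hC i
  have hqi : q i ^ 2 = D.size x P := hq2 i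
  have h2 := hsize D hD x hxb P lam O hP hW' hlam hF hO fun Q' hQ' =>
    le_of_mul_le_mul_left (hmax' x Q' hx hQ') (by positivity)
  have h3 := hB (cutoff ρ x) (q i) _ hζ hζ1 (hW.one_le i) h1 (by
    have : q i ^ 4 = D.size x P ^ 2 := by rw [← hqi]; ring
    rw [this]; exact h2)
  rw [hqi] at h3
  have h4 := D.testFun_mul_le s hxb hP hO
  rw [hPO] at h4
  have hN : N ≤ |N| := le_abs_self N
  have hs0 : 0 ≤ D.size x P := zero_le_one.trans (D.le_size x P).1
  calc cutoff ρ x ^ 2 * D.testFun s x Q₀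
      ≤ cutoff ρ x ^ 2 * ((n + |N|) * D.size x P) := by
        refine mul_le_mul_of_nonneg_left (h4.trans ?_) (sq_nonneg _)
        exact mul_le_mul_of_nonneg_right (by linarith) hs0
    _ = (n + |N|) * (cutoff ρ x ^ 2 * D.size x P) := by ring
    _ ≤ (n + |N|) * B := mul_le_mul_of_nonneg_left h3 (by positivity)

end SolData

end Maximum

/-! ### The estimate in coordinates -/

section Estimate

namespace SolData

variable {n : ℕ} {r t δ₁ N : ℝ}

theorem sum_lam_pos (D : SolData n r t δ₁ N) {lam : Fin n → ℝ} (h : lam ∈ D.Γ) :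
    0 < ∑ m, lam m :=
  sum_pos_of_mem_gammaCone le_rfl (D.structureConditions.cone.subset_gamma_one h)

/-- Bounds in a frame give the invariant bounds. -/
theorem tensorNorm_le (D : SolData n r t δ₁ N) {z : EuclideanSpace ℝ (Fin n)}
    {P : Matrix (Fin n) (Fin n) ℝ} (hP : Pᵀ * D.G z * P = 1) {C : ℝ} (hC : 0 ≤ C)
    (h1 : ∑ l, frameGrad D.u z P l ^ 2 ≤ C) (h2 : ∀ m l, |frameHess D.G D.u z P m l| ≤ C) :
    tensorNorm D.G (hessTensor D.G D.u) z + tensorNorm D.G (gradTensor D.G D.u) z ^ 2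
      ≤ n * C + C := by
  refine add_le_add ?_ (by rwa [tensorNorm_grad_sq hP])
  refine abs_le_of_sq_le_sq' ?_ (by positivity) |>.2
  rw [tensorNorm_hess_sq hP]
  calc ∑ m, ∑ l, frameHess D.G D.u z P m l ^ 2 ≤ ∑ _m : Fin n, ∑ _l : Fin n, C ^ 2 :=
        Finset.sum_le_sum fun m _ => Finset.sum_le_sum fun l _ =>
          sq_le_sq' (abs_le.1 (h2 m l)).1 (abs_le.1 (h2 m l)).2
    _ = (n * C) ^ 2 := by simp; ring

/-- With `ρ = 3r/4`, the cutoff function is at least `1 - (2/3)² = 5/9` on the ball of radius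
`r/2`. -/
theorem le_cutoff_sq {z : EuclideanSpace ℝ (Fin n)} (hz : z ∈ ball 0 (r / 2)) :
    25 / 81 ≤ cutoff (3 / 4 * r) z ^ 2 := by
  have h1 := mem_ball_zero_iff.1 hz
  have hr : 0 < r := by linarith [norm_nonneg z]
  have h2 : 5 / 9 ≤ cutoff (3 / 4 * r) z := by
    have h3 : ‖z‖ ^ 2 / (3 / 4 * r) ^ 2 ≤ 4 / 9 := by
      rw [div_le_iff₀ (by positivity)]
      have := pow_le_pow_left₀ (norm_nonneg z) h1.le 2
      linarith
    rw [cutoff]; linarith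
  calc (25 / 81 : ℝ) = (5 / 9) ^ 2 := by norm_num
    _ ≤ _ := pow_le_pow_left₀ (by norm_num) h2 2

/-- Case (a): the test function is the trace of the Hessian plus `a |∇u|²`. -/
theorem exists_estimate_trace (hn : 3 ≤ n) (hr : 0 < r) (ht : t ≤ 1) (hδ₁ : 0 < δ₁) {δ₂ : ℝ}
    (hδ₂ : 0 < δ₂) : ∃ C, ∀ D : SolData n r t δ₁ N, D.Γ ⊆ gammaCone n 2 →
      (∀ x ∈ ball 0 r, δ₂ ≤ min (2 * D.a x * D.b x + D.b x ^ 2) (D.b x ^ 2)) →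
      ∀ z ∈ ball 0 (r / 2), tensorNorm D.G (hessTensor D.G D.u) z
        + tensorNorm D.G (gradTensor D.G D.u) z ^ 2 ≤ C := by
  have hn' : (3 : ℝ) ≤ n := by exact_mod_cast hn
  set c := (1 - t) / ((n : ℝ) - 2) with hcdef
  have hc : 0 ≤ c := div_nonneg (by linarith) (by linarith)
  obtain ⟨C₁, hC₁, h₁⟩ := exists_gradient_le_hessian n c δ₁ δ₂ N hc hδ₁ hδ₂
  set M : ℝ := 1 + C₁ + n ^ 2 with hM
  have hM0 : 0 ≤ M := by positivity
  obtain ⟨K, hK0, hK⟩ := exists_testFun_le (n := n) (r := r) (t := t) (δ₁ := δ₁) (N := N)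
    Finset.univ (ρ := 3 / 4 * r) (by positivity) (by linarith) hc hδ₁
    (fun D => D.Γ ⊆ gammaCone n 2 ∧
      ∀ x ∈ ball 0 r, δ₂ ≤ min (2 * D.a x * D.b x + D.b x ^ 2) (D.b x ^ 2))
    (fun D _ => Or.inr rfl) (C' := 2 * M ^ 2) (by positivity) (by
      rintro D ⟨hΓ, hab⟩ x hx P lam O hP hW hlam hF hO -
      set h := frameHess D.G D.u x P with hh
      have hO' : O * Oᵀ = 1 := mul_eq_one_comm.1 hO
      -- all directions are controlled, so the frame does not matter
      have parseval : ∑ k, ∑ l, (∑ j, O j k * h j l) ^ 2 = ∑ m, ∑ l, h m l ^ 2 := by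
        have e : ∀ A : Matrix (Fin n) (Fin n) ℝ, ∑ k, ∑ l, A k l ^ 2 = (Aᵀ * A).trace := by
          intro A
          rw [Finset.sum_comm]
          simp [Matrix.trace, Matrix.mul_apply, sq]
        have e1 : ∑ k, ∑ l, (∑ j, O j k * h j l) ^ 2 = ∑ k, ∑ l, (Oᵀ * h) k l ^ 2 := by
          simp only [Matrix.mul_apply, Matrix.transpose_apply]
        rw [e1, e, e, Matrix.transpose_mul, Matrix.transpose_transpose, Matrix.mul_assoc,
          ← Matrix.mul_assoc O, hO', Matrix.one_mul]
      set Y := ∑ m, ∑ l, h m l ^ 2 with hY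
      have hY0 : 0 ≤ Y := Finset.sum_nonneg fun _ _ => Finset.sum_nonneg fun _ _ => sq_nonneg _
      have hle : ∀ m l, |h m l| ≤ Real.sqrt Y := by
        intro m l
        refine Real.abs_le_sqrt ?_
        exact (Finset.single_le_sum (f := fun l => h m l ^ 2) (fun _ _ => sq_nonneg _)
          (Finset.mem_univ l)).trans (Finset.single_le_sum (f := fun m => ∑ l, h m l ^ 2)
          (fun _ _ => Finset.sum_nonneg fun _ _ => sq_nonneg _) (Finset.mem_univ m))
      have hgrad := h₁ (D.a x) (D.b x) (frameGrad D.u x P) h (Pᵀ * D.S x * P) lam (Real.sqrt Y)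
        (isDiagonalized_of_frame hP hW) (Real.sqrt_nonneg _)
        (fun m l => D.abs_frame_S_le hx hP m l) hle (D.sum_lam_pos hlam)
        (fun μ hμ0 hμ => (D.structureConditions.le_of_forall_le hlam hμ0 hμ).trans
          (hF ▸ D.f_le hx)) (D.le_coeff x hx) (hab x hx)
      have hsum : ∑ m, ∑ l, |h m l| ≤ n ^ 2 * Real.sqrt Y := by
        calc ∑ m, ∑ l, |h m l| ≤ ∑ _m : Fin n, ∑ _l : Fin n, Real.sqrt Y :=
              Finset.sum_le_sum fun m _ => Finset.sum_le_sum fun l _ => hle m l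
          _ = n ^ 2 * Real.sqrt Y := by simp; ring
      have hsz : D.size x P ≤ M * (1 + Real.sqrt Y) := by
        rw [size, hM]
        have := Real.sqrt_nonneg Y
        nlinarith [mul_nonneg hC₁ this, sq_nonneg (n : ℝ)]
      rw [parseval]
      have h0 := (zero_le_one.trans (D.le_size x P).1)
      calc D.size x P ^ 2 ≤ (M * (1 + Real.sqrt Y)) ^ 2 := pow_le_pow_left₀ h0 hsz 2
        _ = M ^ 2 * (1 + Real.sqrt Y) ^ 2 := by ring
        _ ≤ M ^ 2 * (2 * (1 + Y)) := by
            refine mul_le_mul_of_nonneg_left ?_ (sq_nonneg _)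
            nlinarith [Real.sq_sqrt hY0, sq_nonneg (1 - Real.sqrt Y)]
        _ = 2 * M ^ 2 * (1 + Y) := by ring)
  obtain ⟨C₂, hC₂, h₂⟩ := exists_bound_of_trace_le n c δ₁ N (81 / 25 * K) hc hδ₁
  refine ⟨n * C₂ + C₂, fun D hΓ hab z hz => ?_⟩
  have hzr : z ∈ ball 0 r := ball_subset_ball (by linarith) hz
  have hzρ : ‖z‖ ≤ 3 / 4 * r := by have := mem_ball_zero_iff.1 hz; linarith
  obtain ⟨lam, ⟨P, hP, hW⟩, hlam, hF⟩ := D.equation z hzr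
  have hT := hK D ⟨hΓ, hab⟩ z P hzρ hP
  have hT' : D.testFun Finset.univ z P ≤ 81 / 25 * K := by
    by_contra hcon
    push Not at hcon
    have h3 := le_cutoff_sq hz
    have h4 : 0 ≤ D.testFun Finset.univ z P := le_trans (by positivity) hcon.le
    nlinarith [mul_le_mul_of_nonneg_right h3 h4]
  obtain ⟨h5, h6⟩ := h₂ (D.a z) (D.b z) (frameGrad D.u z P) (frameHess D.G D.u z P)
    (Pᵀ * D.S z * P) lam (isDiagonalized_of_frame hP hW) (D.abs_a_le hzr) (D.abs_b_le hzr)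
    (fun m l => D.abs_frame_S_le hzr hP m l) (hΓ hlam) (D.le_coeff z hzr) hT'
  exact D.tensorNorm_le hP hC₂ h5 h6

/-- Case (b): the test function is `∇²u(e, e) + a |∇u|²`, maximized over unit vectors `e`. -/
theorem exists_estimate_eigenvalue (hn : 3 ≤ n) (hr : 0 < r) (ht : t ≤ 1) (hδ₁ : 0 < δ₁) {δ₃ : ℝ}
    (hδ₃ : 0 < δ₃) : ∃ C, ∀ D : SolData n r t δ₁ N, (∀ x ∈ ball 0 r, D.a x + n * D.b x ≤ -δ₃) →
      (∀ x ∈ ball 0 r, 0 ≤ D.a x) →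
      ∀ z ∈ ball 0 (r / 2), tensorNorm D.G (hessTensor D.G D.u) z
        + tensorNorm D.G (gradTensor D.G D.u) z ^ 2 ≤ C := by
  have hn' : (3 : ℝ) ≤ n := by exact_mod_cast hn
  set c := (1 - t) / ((n : ℝ) - 2) with hcdef
  have hc : 0 ≤ c := div_nonneg (by linarith) (by linarith)
  obtain ⟨C₁, hC₁, h₁⟩ := exists_bound_of_eigenvalue_le n c δ₃ N hc hδ₃
  set k₀ : Fin n := ⟨0, by omega⟩ with hk₀
  -- a bound in all orthonormal frames bounds the quadratic form
  have hform : ∀ (D : SolData n r t δ₁ N) (x : EuclideanSpace ℝ (Fin n)),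
      ∀ P : Matrix (Fin n) (Fin n) ℝ, Pᵀ * D.G x * P = 1 → ∀ κ : ℝ,
      (∀ Q, Qᵀ * D.G x * Q = 1 → frameHess D.G D.u x Q k₀ k₀ ≤ κ) → ∀ w : Fin n → ℝ,
      ∑ m, ∑ l, w m * w l * frameHess D.G D.u x P m l ≤ κ * ∑ m, w m ^ 2 := by
    intro D x P hP κ hκ w
    set R := ∑ m, w m ^ 2 with hR
    have hR0 : 0 ≤ R := Finset.sum_nonneg fun _ _ => sq_nonneg _
    rcases hR0.eq_or_lt with hR1 | hR1
    · have hw : ∀ m, w m = 0 := fun m => by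
        have := (Finset.sum_eq_zero_iff_of_nonneg fun m _ => sq_nonneg (w m)).1 hR1.symm m
          (Finset.mem_univ m)
        exact pow_eq_zero_iff (two_ne_zero) |>.1 this
      rw [← hR1]; simp [hw]
    · set σ := Real.sqrt R with hσ
      have hσ0 : 0 < σ := Real.sqrt_pos.2 hR1
      have hσ2 : σ ^ 2 = R := Real.sq_sqrt hR0
      obtain ⟨O, hO, hOv⟩ := exists_orthogonal_column k₀ (v := fun m => w m / σ) (by
        simp only [div_pow, ← Finset.sum_div, hσ2]
        exact div_self hR1.ne')
      have h2 := hκ (P * O) (frame_mul_orthogonal hP hO)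
      rw [frameHess_mul, frame_mul_apply] at h2
      simp only [hOv] at h2
      have e : ∑ m, ∑ l, w m / σ * (w l / σ) * frameHess D.G D.u x P m l
          = (∑ m, ∑ l, w m * w l * frameHess D.G D.u x P m l) / R := by
        rw [Finset.sum_div]
        refine Finset.sum_congr rfl fun m _ => ?_
        rw [Finset.sum_div]
        refine Finset.sum_congr rfl fun l _ => ?_
        rw [← hσ2]; field_simp
      rw [e, div_le_iff₀ hR1] at h2
      exact h2
  set M : ℝ := 1 + (1 + n ^ 2) * C₁ with hM
  have hM0 : 0 ≤ M := by positivity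
  obtain ⟨K, hK0, hK⟩ := exists_testFun_le (n := n) (r := r) (t := t) (δ₁ := δ₁) (N := N)
    {k₀} (ρ := 3 / 4 * r) (by positivity) (by linarith) hc hδ₁
    (fun D => (∀ x ∈ ball 0 r, D.a x + n * D.b x ≤ -δ₃) ∧ ∀ x ∈ ball 0 r, 0 ≤ D.a x)
    (fun D hD => Or.inl hD.2) (C' := 2 * M ^ 2) (by positivity) (by
      rintro D ⟨hab, ha⟩ x hx P lam O hP hW hlam hF hO hmax
      set h := frameHess D.G D.u x P with hh
      set κ := frameHess D.G D.u x (P * O) k₀ k₀ with hκ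
      -- `a |∇u|²` does not depend on the frame, so the frame maximizes `∇²u(Q_k₀, Q_k₀)`
      have hκle : ∀ Q, Qᵀ * D.G x * Q = 1 → frameHess D.G D.u x Q k₀ k₀ ≤ κ := by
        intro Q hQ
        have h2 := hmax Q hQ
        simp only [testFun, Finset.sum_singleton] at h2
        rw [← tensorNormSq_grad hQ, ← tensorNormSq_grad (frame_mul_orthogonal hP hO)] at h2
        linarith
      obtain ⟨h3, h4⟩ := h₁ (D.a x) (D.b x) (frameGrad D.u x P) h (Pᵀ * D.S x * P) lam κ
        (isDiagonalized_of_frame hP hW)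
        (frameHess_symm (D.metric_symm hx) ((D.u_contDiffAt hx).of_le (by norm_num)))
        (fun m l => D.abs_frame_S_le hx hP m l) (D.sum_lam_pos hlam) (hab x hx)
        (hform D x P hP κ hκle)
      have hsum : ∑ m, ∑ l, |h m l| ≤ n ^ 2 * (C₁ * (1 + |κ|)) := by
        calc ∑ m, ∑ l, |h m l| ≤ ∑ _m : Fin n, ∑ _l : Fin n, C₁ * (1 + |κ|) :=
              Finset.sum_le_sum fun m _ => Finset.sum_le_sum fun l _ => h4 m l
          _ = n ^ 2 * (C₁ * (1 + |κ|)) := by simp; ring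
      have hsz : D.size x P ≤ M * (1 + |κ|) := by
        rw [size, hM]
        nlinarith [abs_nonneg κ]
      have hκ2 : κ ^ 2 ≤ ∑ l, (∑ j, O j k₀ * h j l) ^ 2 := by
        have e1 : κ = ∑ l, O l k₀ * ∑ j, O j k₀ * h j l := by
          rw [hκ, frameHess_mul, frame_mul_apply, Finset.sum_comm]
          refine Finset.sum_congr rfl fun l _ => ?_
          rw [Finset.mul_sum]
          exact Finset.sum_congr rfl fun j _ => by rw [hh]; ring
        have e2 : ∑ l, O l k₀ ^ 2 = 1 := by
          have := congrFun (congrFun hO k₀) k₀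
          rw [Matrix.mul_apply, Matrix.one_apply_eq] at this
          rw [← this]; exact Finset.sum_congr rfl fun l _ => sq _
        have e3 := Finset.sum_mul_sq_le_sq_mul_sq Finset.univ (fun l => O l k₀)
          (fun l => ∑ j, O j k₀ * h j l)
        rw [e2, one_mul, ← e1] at e3
        exact e3
      rw [Finset.sum_singleton]
      have h0 := (zero_le_one.trans (D.le_size x P).1)
      calc D.size x P ^ 2 ≤ (M * (1 + |κ|)) ^ 2 := pow_le_pow_left₀ h0 hsz 2
        _ = M ^ 2 * (1 + |κ|) ^ 2 := by ring
        _ ≤ M ^ 2 * (2 * (1 + κ ^ 2)) := by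
            refine mul_le_mul_of_nonneg_left ?_ (sq_nonneg _)
            nlinarith [sq_abs κ, sq_nonneg (1 - |κ|)]
        _ = 2 * M ^ 2 * (1 + κ ^ 2) := by ring
        _ ≤ _ := mul_le_mul_of_nonneg_left (by linarith) (by positivity))
  set K' := 81 / 25 * K with hK'
  refine ⟨n * (C₁ * (1 + |K'|)) + C₁ * (1 + |K'|), fun D hab ha z hz => ?_⟩
  have hzr : z ∈ ball 0 r := ball_subset_ball (by linarith) hz
  have hzρ : ‖z‖ ≤ 3 / 4 * r := by have := mem_ball_zero_iff.1 hz; linarith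
  obtain ⟨lam, ⟨P, hP, hW⟩, hlam, hF⟩ := D.equation z hzr
  have hT' : ∀ Q, Qᵀ * D.G z * Q = 1 → frameHess D.G D.u z Q k₀ k₀ ≤ K' := by
    intro Q hQ
    have hT := hK D ⟨hab, ha⟩ z Q hzρ hQ
    -- the gradient term of the test function is nonnegative since `a ≥ 0`
    have h5 : frameHess D.G D.u z Q k₀ k₀ ≤ D.testFun {k₀} z Q := by
      rw [testFun, Finset.sum_singleton]
      have := mul_nonneg (ha z hzr) (Finset.sum_nonneg fun l (_ : l ∈ Finset.univ) =>
        sq_nonneg (frameGrad D.u z Q l))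
      linarith
    refine h5.trans ?_
    by_contra hcon
    push Not at hcon
    have h3 := le_cutoff_sq hz
    have h4 : 0 ≤ D.testFun {k₀} z Q := le_trans (by positivity) hcon.le
    nlinarith [mul_le_mul_of_nonneg_right h3 h4]
  obtain ⟨h5, h6⟩ := h₁ (D.a z) (D.b z) (frameGrad D.u z P) (frameHess D.G D.u z P)
    (Pᵀ * D.S z * P) lam K' (isDiagonalized_of_frame hP hW)
    (frameHess_symm (D.metric_symm hzr) ((D.u_contDiffAt hzr).of_le (by norm_num)))
    (fun m l => D.abs_frame_S_le hzr hP m l) (D.sum_lam_pos hlam) (hab z hzr)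
    (hform D z P hP K' hT')
  exact D.tensorNorm_le hP (by positivity) h5 h6

end SolData

end Estimate

/-! ### Geodesic balls in coordinates -/

section GeodesicBalls

variable {n : ℕ} {H : Type*} [TopologicalSpace H]
  {I : ModelWithCorners ℝ (EuclideanSpace ℝ (Fin n)) H}
  {M : Type*} [TopologicalSpace M] [ChartedSpace H M]
  {φ : EuclideanSpace ℝ (Fin n) → M} {r : ℝ}

/-- The coordinate vector fields of a smooth parametrization are smooth along it. -/
theorem contMDiffOn_mfderiv_const [IsManifold I ∞ M] {k : ℕ∞}
    (hφ : ContMDiffOn 𝓘(ℝ, EuclideanSpace ℝ (Fin n)) I ∞ φ (ball 0 r))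
    (e : EuclideanSpace ℝ (Fin n)) :
    ContMDiffOn 𝓘(ℝ, EuclideanSpace ℝ (Fin n)) (I.prod 𝓘(ℝ, EuclideanSpace ℝ (Fin n))) k
      (fun x => Bundle.TotalSpace.mk' (EuclideanSpace ℝ (Fin n))
        (E := fun p : M => TangentSpace I p) (φ x)
        (mfderiv 𝓘(ℝ, EuclideanSpace ℝ (Fin n)) I φ x e)) (ball 0 r) := by
  have : IsManifold I 1 M := IsManifold.of_le (n := ∞) (by simp)
  have h1 := hφ.contMDiffOn_tangentMapWithin (m := k) (by
    exact_mod_cast le_top) isOpen_ball.uniqueMDiffOn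
  have h2 : ContMDiffOn 𝓘(ℝ, EuclideanSpace ℝ (Fin n))
      (𝓘(ℝ, EuclideanSpace ℝ (Fin n)).prod 𝓘(ℝ, EuclideanSpace ℝ (Fin n))) k
      (fun x => (⟨x, e⟩ : TangentBundle 𝓘(ℝ, EuclideanSpace ℝ (Fin n))
        (EuclideanSpace ℝ (Fin n)))) (ball (0 : EuclideanSpace ℝ (Fin n)) r) :=
    contMDiffOn_vectorSpace_iff_contDiffOn.2 contDiffOn_const
  refine (h1.comp h2 fun x hx => hx).congr fun x hx => ?_
  simp only [Function.comp, tangentMapWithin, mfderivWithin_of_isOpen isOpen_ball hx]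

/-- The components of a `C^k` field of bilinear forms in a smooth parametrization are `C^k`. -/
theorem contDiffOn_pullbackComponents [IsManifold I ∞ M] {k : ℕ∞}
    {T : (p : M) → TangentSpace I p →L[ℝ] TangentSpace I p →L[ℝ] ℝ}
    (hφ : ContMDiffOn 𝓘(ℝ, EuclideanSpace ℝ (Fin n)) I ∞ φ (ball 0 r))
    (hT : ContMDiffOn I
      (I.prod 𝓘(ℝ, EuclideanSpace ℝ (Fin n) →L[ℝ] EuclideanSpace ℝ (Fin n) →L[ℝ] ℝ)) k
      (fun p => Bundle.TotalSpace.mk'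
        (EuclideanSpace ℝ (Fin n) →L[ℝ] EuclideanSpace ℝ (Fin n) →L[ℝ] ℝ)
        (E := fun p : M => TangentSpace I p →L[ℝ] TangentSpace I p →L[ℝ] ℝ) p (T p))
      (φ '' ball 0 r)) (i j : Fin n) :
    ContDiffOn ℝ k (fun x => pullbackComponents I T φ x i j) (ball 0 r) := by
  have : IsManifold I 1 M := IsManifold.of_le (n := ∞) (by simp)
  rw [← contMDiffOn_iff_contDiffOn]
  have h1 := hT.comp (hφ.of_le (by exact_mod_cast le_top)) (subset_preimage_image φ _)
  intro x hx
  have h2 := ContMDiffWithinAt.clm_bundle_apply₂ (F₁ := EuclideanSpace ℝ (Fin n))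
    (F₂ := EuclideanSpace ℝ (Fin n)) (F₃ := ℝ) (E₃ := fun _ : M => ℝ) (h1 x hx)
    (contMDiffOn_mfderiv_const hφ (EuclideanSpace.single i 1) x hx)
    (contMDiffOn_mfderiv_const hφ (EuclideanSpace.single j 1) x hx)
  have h3 := (Bundle.contMDiffWithinAt_totalSpace.1 h2).2
  exact h3

theorem contDiffOn_comp_parametrization {k : ℕ∞} {h : M → ℝ}
    (hφ : ContMDiffOn 𝓘(ℝ, EuclideanSpace ℝ (Fin n)) I ∞ φ (ball 0 r))
    (hh : ContMDiffOn I 𝓘(ℝ, ℝ) k h (φ '' ball 0 r)) : ContDiffOn ℝ k (h ∘ φ) (ball 0 r) := by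
  rw [← contMDiffOn_iff_contDiffOn]
  exact hh.comp (hφ.of_le (by exact_mod_cast le_top)) (subset_preimage_image φ _)

theorem contDiffOn_comp_parametrization_prod {k : ℕ∞} {f : M → ℝ → ℝ}
    (hφ : ContMDiffOn 𝓘(ℝ, EuclideanSpace ℝ (Fin n)) I ∞ φ (ball 0 r))
    (hf : ContMDiffOn (I.prod 𝓘(ℝ, ℝ)) 𝓘(ℝ, ℝ) k (fun q : M × ℝ => f q.1 q.2)
      ((φ '' ball 0 r) ×ˢ univ)) :
    ContDiffOn ℝ k (fun p : EuclideanSpace ℝ (Fin n) × ℝ => f (φ p.1) p.2)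
      (ball 0 r ×ˢ univ) := by
  rw [← contMDiffOn_iff_contDiffOn, modelWithCornersSelf_prod, ← chartedSpaceSelf_prod]
  have h1 : ContMDiffOn (𝓘(ℝ, EuclideanSpace ℝ (Fin n)).prod 𝓘(ℝ, ℝ)) (I.prod 𝓘(ℝ, ℝ)) k
      (Prod.map φ (id : ℝ → ℝ)) (ball 0 r ×ˢ univ) :=
    (hφ.of_le (by exact_mod_cast le_top)).prodMap contMDiffOn_id
  exact hf.comp h1 fun p hp => ⟨mem_image_of_mem φ hp.1, mem_univ _⟩

theorem CTwoNormLE.mono {k : ℕ} {G : EuclideanSpace ℝ (Fin n) → Matrix (Fin n) (Fin n) ℝ}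
    {T : TensorComponents n k} {N N' : ℝ} (h : CTwoNormLE G T r N) (hN : N ≤ N') :
    CTwoNormLE G T r N' := fun x hx => (h x hx).trans hN

theorem MetricCThreeNormLE.mono {G : EuclideanSpace ℝ (Fin n) → Matrix (Fin n) (Fin n) ℝ}
    {N N' : ℝ} (h : MetricCThreeNormLE G r N) (hN : N ≤ N') : MetricCThreeNormLE G r N' :=
  fun x hx i j => ⟨fun k hk => ((h x hx i j).1 k hk).trans hN, (h x hx i j).2.trans hN⟩

/-- A solution on a geodesic ball, read in its normal coordinates. -/
def SolData.ofGeodesicBall [IsManifold I ∞ M] {t δ₁ ε Λ Na Nb NS Ng Nf N : ℝ} {Γ : Set (Fin n → ℝ)}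
    {F : (Fin n → ℝ) → ℝ} {a b : M → ℝ}
    {S : (p : M) → TangentSpace I p →L[ℝ] TangentSpace I p →L[ℝ] ℝ} {f : M → ℝ → ℝ} {u : M → ℝ}
    (g : Bundle.ContMDiffRiemannianMetric I ∞ (EuclideanSpace ℝ (Fin n))
      (fun p : M => TangentSpace I p))
    (hφ : IsGeodesicBall I g.inner φ r) (hF : StructureConditions Γ F ε)
    (hu : IsAdmissibleSolution I Γ F g.inner φ r t a b S f u)
    (hN : DataBounds I g.inner φ r a b S f u Λ Na Nb NS Ng Nf)
    (hNa : Na ≤ N) (hNb : Nb ≤ N) (hNS : NS ≤ N) (hNg : Ng ≤ N) (hNf : Nf ≤ N)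
    (hδ : ∀ p ∈ φ '' ball 0 r, δ₁ ≤ (1 - t) / ((n : ℝ) - 2) * a p - b p) :
    SolData n r t δ₁ N where
  G := pullbackComponents I g.inner φ
  a := a ∘ φ
  b := b ∘ φ
  S := pullbackComponents I S φ
  f := fun y => f (φ y)
  u := u ∘ φ
  Γ := Γ
  F := F
  ε := ε
  structureConditions := hF
  G_contDiffOn := contDiffOn_pullbackComponents (k := 3) hφ.contMDiffOn
    (g.contMDiff.contMDiffOn.of_le (by exact_mod_cast le_top))
  a_contDiffOn := contDiffOn_comp_parametrization (k := 2) hφ.contMDiffOn hu.a_contMDiffOn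
  b_contDiffOn := contDiffOn_comp_parametrization (k := 2) hφ.contMDiffOn hu.b_contMDiffOn
  S_contDiffOn := contDiffOn_pullbackComponents (k := 2) hφ.contMDiffOn hu.S_contMDiffOn
  f_contDiffOn := contDiffOn_comp_parametrization_prod (k := 2) hφ.contMDiffOn hu.f_contMDiffOn
  u_contDiffOn := contDiffOn_comp_parametrization (k := 4) hφ.contMDiffOn hu.u_contMDiffOn
  equation := hu.equation
  G_bound := hN.g_bound.mono hNg
  a_bound := hN.a_bound.mono hNa
  b_bound := hN.b_bound.mono hNb
  S_bound := hN.S_bound.mono hNS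
  f_bound := fun x hx => (hN.f_bound x hx).trans hNf
  le_coeff := fun x hx => hδ _ (mem_image_of_mem φ hx)

end GeodesicBalls

end

theorem theorem2 (n : ℕ) (hn : 3 ≤ n) (t : ℝ) (ht : t ≤ 1) (r : ℝ) (hr : 0 < r)
    (Λ : ℝ) (hΛ : 0 < Λ) (δ₁ : ℝ) (hδ₁ : 0 < δ₁) (Na Nb NS Ng Nf : ℝ) :
    -- case (a): the constant does not depend on `ε`
    (∀ δ₂ : ℝ, 0 < δ₂ → ∃ C : ℝ, ∀ ε : ℝ, 0 < ε →
      ∀ (H : Type v) [TopologicalSpace H] (I : ModelWithCorners ℝ (EuclideanSpace ℝ (Fin n)) H)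
        (M : Type w) [TopologicalSpace M] [ChartedSpace H M] [IsManifold I ∞ M]
        (g : Bundle.ContMDiffRiemannianMetric I ∞ (EuclideanSpace ℝ (Fin n))
          (fun p : M => TangentSpace I p))
        (φ : EuclideanSpace ℝ (Fin n) → M)
        (Γ : Set (Fin n → ℝ)) (F : (Fin n → ℝ) → ℝ) (a b : M → ℝ)
        (S : (p : M) → TangentSpace I p →L[ℝ] TangentSpace I p →L[ℝ] ℝ)
        (f : M → ℝ → ℝ) (u : M → ℝ),
        IsGeodesicBall I g.inner φ r →
        StructureConditions Γ F ε →
        IsAdmissibleSolution I Γ F g.inner φ r t a b S f u →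
        DataBounds I g.inner φ r a b S f u Λ Na Nb NS Ng Nf →
        Γ ⊆ gammaCone n 2 →
        (∀ p ∈ φ '' ball 0 r, δ₁ ≤ (1 - t) / ((n : ℝ) - 2) * a p - b p) →
        (∀ p ∈ φ '' ball 0 r, δ₂ ≤ min (2 * a p * b p + b p ^ 2) (b p ^ 2)) →
        InteriorBound I g.inner φ (r / 2) u C) ∧
    -- case (b)
    (∀ ε : ℝ, 0 < ε → ∀ δ₃ : ℝ, 0 < δ₃ → ∃ C : ℝ,
      ∀ (H : Type v) [TopologicalSpace H] (I : ModelWithCorners ℝ (EuclideanSpace ℝ (Fin n)) H)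
        (M : Type w) [TopologicalSpace M] [ChartedSpace H M] [IsManifold I ∞ M]
        (g : Bundle.ContMDiffRiemannianMetric I ∞ (EuclideanSpace ℝ (Fin n))
          (fun p : M => TangentSpace I p))
        (φ : EuclideanSpace ℝ (Fin n) → M)
        (Γ : Set (Fin n → ℝ)) (F : (Fin n → ℝ) → ℝ) (a b : M → ℝ)
        (S : (p : M) → TangentSpace I p →L[ℝ] TangentSpace I p →L[ℝ] ℝ)
        (f : M → ℝ → ℝ) (u : M → ℝ),
        IsGeodesicBall I g.inner φ r →
        StructureConditions Γ F ε →
        IsAdmissibleSolution I Γ F g.inner φ r t a b S f u →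
        DataBounds I g.inner φ r a b S f u Λ Na Nb NS Ng Nf →
        (∀ p ∈ φ '' ball 0 r, δ₁ ≤ (1 - t) / ((n : ℝ) - 2) * a p - b p) →
        (∀ p ∈ φ '' ball 0 r, a p + n * b p ≤ -δ₃) →
        (∀ p ∈ φ '' ball 0 r, 0 ≤ a p) →
        InteriorBound I g.inner φ (r / 2) u C) := by
  -- a single bound for all the data
  set N : ℝ := max Na (max Nb (max NS (max Ng Nf)))
  have hNa : Na ≤ N := le_max_left _ _
  have hNb : Nb ≤ N := (le_max_left _ _).trans (le_max_right _ _)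
  have hNS : NS ≤ N :=
    (le_max_left _ _).trans ((le_max_right _ _).trans (le_max_right _ _))
  have hNg : Ng ≤ N :=
    (le_max_left _ _).trans ((le_max_right _ _).trans ((le_max_right _ _).trans (le_max_right _ _)))
  have hNf : Nf ≤ N :=
    (le_max_right _ _).trans ((le_max_right _ _).trans ((le_max_right _ _).trans (le_max_right _ _)))
  constructor
  · intro δ₂ hδ₂
    obtain ⟨C, hC⟩ := SolData.exists_estimate_trace (N := N) hn hr ht hδ₁ hδ₂
    refine ⟨C, ?_⟩
    intro ε _ H _ I M _ _ _ g φ Γ F a b S f u hφ hF hu hN hΓ hδ h₂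
    exact hC (SolData.ofGeodesicBall g hφ hF hu hN hNa hNb hNS hNg hNf hδ) hΓ
      fun x hx => h₂ _ (mem_image_of_mem φ hx)
  · intro ε hε δ₃ hδ₃
    obtain ⟨C, hC⟩ := SolData.exists_estimate_eigenvalue (N := N) hn hr ht hδ₁ hδ₃
    refine ⟨C, ?_⟩
    intro H _ I M _ _ _ g φ Γ F a b S f u hφ hF hu hN hδ h₃ ha
    exact hC (SolData.ofGeodesicBall g hφ hF hu hN hNa hNb hNS hNg hNf hδ)
      (fun x hx => h₃ _ (mem_image_of_mem φ hx)) fun x hx => ha _ (mem_image_of_mem φ hx)
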